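/- Let $K$ be a non-archimedean local field of characteristic $0$, with ring of integers $\mathcal O_K$, uniformizer $\varpi$ and (finite) residue field of characteristic $p$. Let $d\ge 0$, $G=\mathrm{GL}_{d+1}(K)$, and let $\mathcal{BT}$ be the Bruhat–Tits building of $\mathrm{PGL}_{d+1}(K)$: its vertices are the homothety classes $[M]$ of $\mathcal O_K$-lattices $M\subset K^{d+1}$, and its $k$-simplices are the sets $\{[M_0],\dots,[M_k]\}$ with $\varpi M_k\subsetneq M_0\subsetneq M_1\subsetneq\cdots\subsetneq M_k$. Let $s_0=[\mathcal O_K^{d+1}]$. For $n\ge 1$ put $\Gamma^{(n)}_{s_0}=\{g\in \mathrm{GL}_{d+1}(\mathcal O_K) : g\equiv \mathrm{Id} \bmod \varpi^n\}$ and $\Gamma^{(n)}_{s}=g\,\Gamma^{(n)}_{s_0}g^{-1}$ for a vertex $s=gs_0$ (this does not depend on $g$); for a simplex $\sigma$ let $\Gamma^{(n)}_\sigma$ be the subgroup of $G$ generated by the $\Gamma^{(n)}_s$, $s$ a vertex of $\sigma$. For a basis $f=(f_0,\dots,f_d)$ of $K^{d+1}$, the simplices with vertices of the form $[\langle \varpi^{\alpha_0}f_0,\dots,\varpi^{\alpha_d}f_d\rangle]$,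 $\alpha\in\mathbf Z^{d+1}$, form an apartment, whose geometric realization is identified with $\mathbf R^{d+1}/\mathbf R(1,\dots,1)$, such a vertex corresponding to the class of $\alpha$. The geodesic $[x,y]$ between two points of $|\mathcal{BT}|$ is the straight segment in an apartment containing both. A subset of $|\mathcal{BT}|$ is geodesically convex if it contains $[x,y]$ whenever it contains $x$ and $y$. Let $A$ be a principal ideal domain that is a $\mathbf Z[1/p]$-algebra, and let $\Lambda$ be $A$, $\mathrm{Frac}(A)$, or $A/(a)$ for some $a\in A$. Let $V$ be a smooth $A[G]$-module (the stabilizer in $G$ of every vector is open) which is generated as an $A[G]$-module by $V^{\Gamma^{(n)}_{s_0}}$, and put $V_\Lambda=V\otimes_A\Lambda$. Let $Y$ be a simplicial subcomplex of $\mathcal{BT}$ whose geometric realization is geodesically convex, and let $Y_k$ be its set of $k$-simplices. Then the coefficient system $\sigma\mapsto V_\Lambda^{\Gamma^{(n)}_\sigma}$, with the inclusions $V_\Lambda^{\Gamma^{(n)}_\tau}\subseteq V_\Lambda^{\Gamma^{(n)}_\sigma}$ for $\sigma\subseteq\tau$, is $Y$-acyclic: the chain complex $$\cdots\longrightarrow\bigoplus_{\sigma\in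 Y_{2}}V_\Lambda^{\Gamma^{(n)}_\sigma}\longrightarrow\bigoplus_{\sigma\in Y_{1}}V_\Lambda^{\Gamma^{(n)}_\sigma}\longrightarrow\bigoplus_{\sigma\in Y_{0}}V_\Lambda^{\Gamma^{(n)}_\sigma}\longrightarrow 0,$$ whose differentials are the alternating sums of these inclusions over the faces of codimension one (with signs given by any total order on the vertices), has zero homology in every degree $\ge 1$. -/

import Mathlib

open scoped ValuativeRel Pointwise DirectSum TensorProduct

noncomputable section

namespace BruhatTits

section Building

variable (K : Type*) [Field K] [ValuativeRel K] (d : ℕ)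

/-- The `𝒪[K]`-lattices of `K ^ (d + 1)`. -/
abbrev Lattice : Type _ :=
  {M : Submodule 𝒪[K] (Fin (d + 1) → K) // Submodule.IsLattice K M}

variable {K d}

/-- The lattice `g M`, for `g` in `GL_{d+1}(K)`. -/
def Lattice.translate (g : GL (Fin (d + 1)) K) (M : Lattice K d) : Lattice K d :=
  ⟨M.1.map ((Matrix.toLin' (g : Matrix (Fin (d + 1)) (Fin (d + 1)) K)).restrictScalars 𝒪[K]), by
    have hM := M.2
    refine ⟨hM.fg.map _, ?_⟩
    have hsurj : Function.Surjective
        (Matrix.toLin' (g : Matrix (Fin (d + 1)) (Fin (d + 1)) K)) := by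
      intro v
      refine ⟨(↑(g⁻¹) : Matrix (Fin (d + 1)) (Fin (d + 1)) K).mulVec v, ?_⟩
      rw [Matrix.toLin'_apply, Matrix.mulVec_mulVec, ← Units.val_mul]
      simp
    rw [Submodule.map_coe, LinearMap.coe_restrictScalars, ← Submodule.map_span, hM.span_eq_top,
      Submodule.map_top, LinearMap.range_eq_top.mpr hsurj]⟩

variable (K d)

/-- Two lattices are homothetic if they differ by a factor in `Kˣ`. -/
def homothety : Setoid (Lattice K d) where
  r M N := ∃ c : Kˣ, N.1 = c • M.1
  iseqv :=
    { refl := fun _ => ⟨1, (one_smul _ _).symm⟩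
      symm := fun ⟨c, hc⟩ => ⟨c⁻¹, by rw [hc, inv_smul_smul]⟩
      trans := fun ⟨c, hc⟩ ⟨c', hc'⟩ => ⟨c' * c, by rw [hc', hc, mul_smul]⟩ }

/-- The vertices of the Bruhat-Tits building of `PGL_{d+1}(K)`: homothety classes of lattices. -/
def Vertex : Type _ := Quotient (homothety K d)

variable {K d}

/-- The vertex `[M]` defined by a lattice `M`. -/
def Lattice.toVertex (M : Lattice K d) : Vertex K d := Quotient.mk (homothety K d) M

/-- The action of `GL_{d+1}(K)` on vertices, `g [M] = [g M]`. -/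
def Vertex.translate (g : GL (Fin (d + 1)) K) : Vertex K d → Vertex K d :=
  Quotient.map (Lattice.translate g) (by
    rintro M N ⟨c, hc⟩
    refine ⟨c, ?_⟩
    simp only [Lattice.translate, hc]
    ext v
    simp only [Submodule.mem_map, LinearMap.coe_restrictScalars]
    constructor
    · rintro ⟨_, ⟨w, hw, rfl⟩, rfl⟩
      exact ⟨_, ⟨w, hw, rfl⟩, by simp⟩
    · rintro ⟨_, ⟨w, hw, rfl⟩, rfl⟩
      exact ⟨_, ⟨w, hw, rfl⟩, by simp⟩)

variable (K d)

/-- The standard lattice `𝒪[K] ^ (d + 1)`. -/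
def standardLattice : Lattice K d :=
  ⟨Submodule.span 𝒪[K] (Set.range (Pi.basisFun K (Fin (d + 1)))), by
    refine ⟨Submodule.fg_span (Set.finite_range _), ?_⟩
    rw [Submodule.span_span_of_tower, Module.Basis.span_eq]⟩

/-- The standard vertex `s₀ = [𝒪[K] ^ (d + 1)]`. -/
def standardVertex : Vertex K d := (standardLattice K d).toVertex

variable {K d}

/-- `{s_0, …, s_k}` is a `k`-simplex if `s_i = [M_i]` for lattices `M_i`, up to reordering, with
`ϖ M_k ⊊ M_0 ⊊ M_1 ⊊ ⋯ ⊊ M_k`; here `ϖ M_k` is written as `𝓂[K] • M_k`. -/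
def IsSimplex (σ : Finset (Vertex K d)) : Prop :=
  ∃ (k : ℕ) (M : Fin (k + 1) → Lattice K d),
    StrictMono (fun i => (M i).1) ∧ 𝓂[K] • (M (Fin.last k)).1 < (M 0).1 ∧
      (σ : Set (Vertex K d)) = Set.range fun i => (M i).toVertex

variable (K d)

/-- The simplices of the building, ordered by inclusion. A `k`-simplex has `k + 1` vertices. -/
abbrev Simplex : Type _ := {σ : Finset (Vertex K d) // IsSimplex σ}

/-- The simplicial subcomplexes of the building. -/
structure Subcomplex where
  faces : Set (Finset (Vertex K d))
  isSimplex : ∀ σ ∈ faces, IsSimplex σ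
  down_closed : ∀ σ ∈ faces, ∀ τ ⊆ σ, τ.Nonempty → τ ∈ faces

/-- The geometric realization `|BT|` of the building: a point is a family of barycentric
coordinates whose support is a simplex. -/
structure Realization where
  weight : Vertex K d →₀ ℝ
  nonneg : ∀ s, 0 ≤ weight s
  sum_eq_one : (weight.sum fun _ a => a) = 1
  isSimplex_support : IsSimplex weight.support

variable {K d}

/-- The subset `|Y|` of `|BT|` defined by a subcomplex `Y`. -/
def Subcomplex.realization (Y : Subcomplex K d) : Set (Realization K d) :=
  {w | w.weight.support ∈ Y.faces}

/-- The lattice `⟨ϖ ^ α_0 f_0, …, ϖ ^ α_d f_d⟩`, as a submodule. -/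
def apartmentLattice (ϖ : 𝒪[K]) (f : Module.Basis (Fin (d + 1)) K (Fin (d + 1) → K))
    (α : Fin (d + 1) → ℤ) : Submodule 𝒪[K] (Fin (d + 1) → K) :=
  Submodule.span 𝒪[K] (Set.range fun i => (ϖ : K) ^ α i • f i)

/-- The point `w` of `|BT|` lies in the apartment `ℝ ^ (d + 1) / ℝ (1, …, 1)` of the basis `f`, and
`x` represents it there. The vertex `[⟨ϖ ^ α_0 f_0, …, ϖ ^ α_d f_d⟩]` has coordinates `α`, and
coordinates are affine on each simplex; the exponents of the vertices of the simplex have to be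
normalized simultaneously, so that the lattices form a chain between `L` and `ϖ L`. -/
def Realization.HasCoordinates (ϖ : 𝒪[K])
    (f : Module.Basis (Fin (d + 1)) K (Fin (d + 1) → K))
    (w : Realization K d) (x : Fin (d + 1) → ℝ) : Prop :=
  ∃ α : Vertex K d → Fin (d + 1) → ℤ,
    (∀ s ∈ w.weight.support,
      ∃ M : Lattice K d, M.1 = apartmentLattice ϖ f (α s) ∧ M.toVertex = s) ∧
    (∀ s ∈ w.weight.support, ∀ t ∈ w.weight.support,
      (α s ≤ α t ∧ α t ≤ α s + 1) ∨ (α t ≤ α s ∧ α s ≤ α t + 1)) ∧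
    ∀ i, x i = w.weight.sum fun s a => a * (α s i : ℝ)

/-- The geodesic `[x, y]` in `|BT|`: the straight segment from `x` to `y` in an apartment
`ℝ ^ (d + 1) / ℝ (1, …, 1)` containing both points. -/
def geodesic (ϖ : 𝒪[K]) (x y : Realization K d) : Set (Realization K d) :=
  {z | ∃ (f : Module.Basis (Fin (d + 1)) K (Fin (d + 1) → K)) (a b c : Fin (d + 1) → ℝ),
    x.HasCoordinates ϖ f a ∧ y.HasCoordinates ϖ f b ∧ z.HasCoordinates ϖ f c ∧
      ∃ t ∈ Set.Icc (0 : ℝ) 1, ∃ r : ℝ, ∀ i, c i = (1 - t) * a i + t * b i + r}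

/-- A subset of `|BT|` is geodesically convex if it contains the geodesics between its points. -/
def GeodesicallyConvex (ϖ : 𝒪[K]) (S : Set (Realization K d)) : Prop :=
  ∀ x ∈ S, ∀ y ∈ S, geodesic ϖ x y ⊆ S

end Building

section CongruenceSubgroups

variable (K : Type*) [Field K] [ValuativeRel K] (d : ℕ)

/-- `Γ^{(n)}_{s₀}`: the matrices in `GL_{d+1}(𝒪[K])` congruent to `1` modulo `ϖ ^ n`, as a subgroup
of `GL_{d+1}(K)`. -/
def standardCongruenceSubgroup (n : ℕ) : Subgroup (GL (Fin (d + 1)) K) :=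
  (Matrix.GeneralLinearGroup.map (n := Fin (d + 1)) (Ideal.Quotient.mk (𝓂[K] ^ n))).ker.map
    (Matrix.GeneralLinearGroup.map (n := Fin (d + 1)) (algebraMap 𝒪[K] K))

variable {K d}

/-- `Γ^{(n)}_s = g Γ^{(n)}_{s₀} g⁻¹` for any `g` with `g s₀ = s`. The supremum runs over all such
`g`; they all give the same group. -/
def vertexCongruenceSubgroup (n : ℕ) (s : Vertex K d) : Subgroup (GL (Fin (d + 1)) K) :=
  ⨆ (g : GL (Fin (d + 1)) K) (_ : Vertex.translate g (standardVertex K d) = s),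
    (standardCongruenceSubgroup K d n).map (MulAut.conj g).toMonoidHom

/-- `Γ^{(n)}_σ`: the subgroup generated by the `Γ^{(n)}_s` for the vertices `s` of `σ`. -/
def congruenceSubgroup (n : ℕ) (σ : Finset (Vertex K d)) : Subgroup (GL (Fin (d + 1)) K) :=
  ⨆ s ∈ σ, vertexCongruenceSubgroup n s

theorem congruenceSubgroup_mono (n : ℕ) {σ τ : Finset (Vertex K d)} (h : σ ⊆ τ) :
    congruenceSubgroup n σ ≤ congruenceSubgroup n τ :=
  biSup_mono fun _ hs => h hs

end CongruenceSubgroups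

section Representations

variable {A G V : Type*} [CommRing A] [Group G] [AddCommGroup V] [Module A V]

/-- A representation is smooth if the stabilizer of every vector is open. -/
def IsSmooth [TopologicalSpace G] (ρ : Representation A G V) : Prop :=
  ∀ v : V, IsOpen {g : G | ρ g v = v}

/-- The submodule `V ^ H` of vectors fixed by a subgroup `H`. -/
def fixedBy (ρ : Representation A G V) (H : Subgroup G) : Submodule A V :=
  Representation.invariants (ρ.comp H.subtype : Representation A H V)

theorem fixedBy_anti (ρ : Representation A G V) {H H' : Subgroup G} (h : H ≤ H') :
    fixedBy ρ H' ≤ fixedBy ρ H :=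
  fun _ hv g => hv ⟨g, h g.2⟩

theorem inclusion_comp {P Q R : Submodule A V} (h : P ≤ Q) (h' : Q ≤ R) :
    Submodule.inclusion h' ∘ₗ Submodule.inclusion h = Submodule.inclusion (h.trans h') :=
  rfl

/-- `V` is generated, as an `A[G]`-module, by `V ^ H`. -/
def IsGeneratedByFixed (ρ : Representation A G V) (H : Subgroup G) : Prop :=
  Submodule.span A {w : V | ∃ g : G, ∃ v ∈ fixedBy ρ H, w = ρ g v} = ⊤

/-- The base change `Λ ⊗_A V` of a representation. -/
def baseChange (Λ : Type*) [CommRing Λ] [Algebra A Λ] (ρ : Representation A G V) :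
    Representation Λ G (Λ ⊗[A] V) where
  toFun g := (ρ g).baseChange Λ
  map_one' := by ext; simp
  map_mul' g h := by ext; simp

end Representations

section CoefficientSystems

variable (K : Type*) [Field K] [ValuativeRel K] (d : ℕ) (Λ : Type*) [CommRing Λ]

/-- A homological coefficient system of `Λ`-modules on the building: modules `M_σ` with compatible
maps `M_τ → M_σ` for `σ ⊆ τ`. -/
structure CoefficientSystem where
  obj : Simplex K d → Type*
  [addCommGroup : ∀ σ, AddCommGroup (obj σ)]
  [module : ∀ σ, Module Λ (obj σ)]
  map : ∀ {σ τ : Simplex K d}, σ ≤ τ → obj τ →ₗ[Λ] obj σ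
  map_refl : ∀ σ : Simplex K d, map (le_refl σ) = LinearMap.id
  map_comp : ∀ {σ τ υ : Simplex K d} (h : σ ≤ τ) (h' : τ ≤ υ),
    map h ∘ₗ map h' = map (h.trans h')

attribute [instance] CoefficientSystem.addCommGroup CoefficientSystem.module

variable {K d Λ}

/-- The coefficient system `V^{(n),•} : σ ↦ V ^ Γ^{(n)}_σ`, whose maps are the inclusions. -/
def fixedSystem {V : Type*} [AddCommGroup V] [Module Λ V]
    (ρ : Representation Λ (GL (Fin (d + 1)) K) V) (n : ℕ) : CoefficientSystem K d Λ where
  obj σ := fixedBy ρ (congruenceSubgroup n σ.1)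
  map h := Submodule.inclusion (fixedBy_anti ρ (congruenceSubgroup_mono n h))
  map_refl _ := rfl
  map_comp h h' := inclusion_comp (fixedBy_anti ρ (congruenceSubgroup_mono n h'))
    (fixedBy_anti ρ (congruenceSubgroup_mono n h))

/-- The set `Y_k` of `k`-simplices of `Y`. -/
abbrev Subcomplex.Cell (Y : Subcomplex K d) (k : ℕ) : Type _ :=
  {σ : Simplex K d // σ.1 ∈ Y.faces ∧ σ.1.card = k + 1}

/-- The module of `k`-chains `⨁_{σ ∈ Y_k} M_σ`. -/
abbrev CoefficientSystem.Chain (M : CoefficientSystem K d Λ) (Y : Subcomplex K d) (k : ℕ) :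
    Type _ :=
  ⨁ σ : Y.Cell k, M.obj σ.1

section Differential

variable [LinearOrder (Vertex K d)]

/-- The codimension-one face of a simplex opposite to the vertex `s`. -/
def Subcomplex.face (Y : Subcomplex K d) {k : ℕ} (τ : Y.Cell (k + 1)) (s : {s // s ∈ τ.1.1}) :
    Y.Cell k :=
  have hcard : (τ.1.1.erase s.1).card = k + 1 := by
    rw [Finset.card_erase_of_mem s.2, τ.2.2]; rfl
  have hmem : τ.1.1.erase s.1 ∈ Y.faces :=
    Y.down_closed _ τ.2.1 _ (Finset.erase_subset _ _) (Finset.card_pos.mp (by omega))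
  ⟨⟨τ.1.1.erase s.1, Y.isSimplex _ hmem⟩, hmem, hcard⟩

theorem Subcomplex.face_le (Y : Subcomplex K d) {k : ℕ} (τ : Y.Cell (k + 1))
    (s : {s // s ∈ τ.1.1}) : (Y.face τ s).1 ≤ τ.1 :=
  Finset.erase_subset s.1 τ.1.1

/-- The differential from `(k+1)`-chains to `k`-chains: the alternating sum of the maps
`M_τ → M_σ` over the codimension-one faces `σ` of `τ`. If the vertices of `τ` are
`s_0 < s_1 < ⋯ < s_{k+1}` then the face opposite to `s_i` comes with the sign `(-1) ^ i`. -/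
def CoefficientSystem.differential (M : CoefficientSystem K d Λ) (Y : Subcomplex K d) (k : ℕ) :
    M.Chain Y (k + 1) →ₗ[Λ] M.Chain Y k :=
  DirectSum.toModule Λ (Y.Cell (k + 1)) (M.Chain Y k) fun τ =>
    ∑ s : {s // s ∈ τ.1.1}, (-1 : Λ) ^ (τ.1.1.filter (· < s.1)).card •
      (DirectSum.lof Λ (Y.Cell k) (fun σ => M.obj σ.1) (Y.face τ s) ∘ₗ M.map (Y.face_le τ s))

/-- `M` is `Y`-acyclic: the chain complex of `M` on `Y` is exact in all positive degrees. -/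
def CoefficientSystem.IsAcyclicOn (M : CoefficientSystem K d Λ) (Y : Subcomplex K d) : Prop :=
  ∀ k : ℕ, Function.Exact (M.differential Y (k + 1)) (M.differential Y k)

end Differential

end CoefficientSystems

end BruhatTits

end

/-! Fix a uniformizer `π`. A homothety class contains exactly one lattice that lies in the standard
lattice but not in `π` times it. Inclusion of these normalized lattices is a partial order on the
vertices, and it is total on every simplex. A cycle involves finitely many vertices, and these lie
in a finite upward closed set. For a minimal vertex `x` of that set, the part of the cycle through
`x` is a reduced cycle on the upper link of `x`, with coefficients σ ↦ V^Γ_{x∪σ}. If it bounds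
there, the cone over a filling with apex `x` pushes the original cycle off `x`; removing the
vertices one at a time leaves nothing (`exists_boundary_eq_of_links`). It remains to treat upper
links.

Let M be the lattice of `x`, L = π⁻¹M and n = m + 1. The vertices of the link are lattices N with πL
< N ≤ L. Convexity of Y enters twice. The midpoint of N and N' is also the midpoint of N + N' and N
∩ N', so N + N' is again a vertex of Y (`exists_sup_mem_faces`). A face whose lattices all lie below
a vertex T of Y spans a face of Y together with T (`insert_mem_faces`).

For N ≤ T let P(T,N) be the group of the g = 1 + X with XL ⊆ π^m N and XT ⊆ π^(m+1) L
(`filtrationSubgroup`). It is pro-p, so averaging over it gives a projector e(T,N), because p is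
invertible in the coefficients. Four facts are used: (a) P(T,N) lies in the group generated by Γ_L =
Γ_x and Γ_N, so e(T,N) fixes the coefficients of simplices through `x` and N; (b) P(T,N+N') is
contained in the group generated by P(T,N) and P(T,N'), and these normalize each other, so e(T,N)
e(T,N') = e(T,N+N'); (c) P(T,N) normalizes Γ_s for s = x and for link vertices s ≤ T, so e(T,N)
preserves coefficients; (d) Γ_T ≤ P(T,T), so the values of e(T,T) extend over the cone with apex T.

Given these, a cycle on the link below T is killed by treating N = T first and then smaller N
(`exists_boundary_eq_of_projections`). Once e(T,N') kills the cycle for all N' > N, (b) confines its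
image under e(T,N) to simplices below N. That image bounds, by (d) if N = T and by induction
otherwise, and can be subtracted. A cycle killed by every e(T,N) vanishes by (a). -/

noncomputable section

namespace BruhatTits

/-! ### Chains on a full simplex, and two acyclicity criteria for coefficient systems -/

section SimplicialChains

variable {X V : Type*} [LinearOrder X] (R : Type*) [CommRing R] [AddCommGroup V] [Module R V]

/-- The incidence sign `(-1) ^ #{t ∈ σ | t < s}`. -/
def faceSign (s : X) (σ : Finset X) : R := (-1) ^ (σ.filter (· < s)).card

theorem faceSign_mul_self (s : X) (σ : Finset X) : faceSign R s σ * faceSign R s σ = 1 := by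
  rw [faceSign, ← mul_pow]; simp

theorem faceSign_insert {s t : X} {σ : Finset X} (ht : t ∉ σ) :
    faceSign R s (insert t σ) = (if t < s then -1 else 1) * faceSign R s σ := by
  unfold faceSign
  rw [Finset.filter_insert]
  split_ifs with h
  · rw [Finset.card_insert_of_notMem (by simp [ht]), pow_succ]; ring
  · simp

theorem faceSign_insert_self (s : X) (σ : Finset X) :
    faceSign R s (insert s σ) = faceSign R s σ := by
  unfold faceSign
  rw [Finset.filter_insert]
  simp

theorem faceSign_erase_self (s : X) (σ : Finset X) :
    faceSign R s (σ.erase s) = faceSign R s σ := by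
  by_cases h : s ∈ σ
  · rw [← faceSign_insert_self, Finset.insert_erase h]
  · rw [Finset.erase_eq_of_notMem h]

theorem faceSign_swap {s t : X} (hst : s ≠ t) {σ : Finset X} (hs : s ∉ σ) (ht : t ∉ σ) :
    faceSign R s σ * faceSign R t (insert s σ) = -(faceSign R t σ * faceSign R s (insert t σ)) := by
  rw [faceSign_insert R hs, faceSign_insert R ht]
  rcases lt_or_gt_of_ne hst with h | h
  · simp [h, h.not_gt]; ring
  · simp [h, h.not_gt]; ring

/-- The part of the simplicial boundary that removes the vertex `s`. -/
def vertexBoundary (s : X) : (Finset X → V) →ₗ[R] (Finset X → V) where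
  toFun c σ := if s ∈ σ then 0 else faceSign R s σ • c (insert s σ)
  map_add' c c' := by ext σ; by_cases h : s ∈ σ <;> simp [h]
  map_smul' r c := by
    ext σ
    by_cases h : s ∈ σ
    · simp [h]
    · simpa [h] using smul_comm _ _ _

/-- The cone with apex `s`. -/
def cone (s : X) : (Finset X → V) →ₗ[R] (Finset X → V) where
  toFun c σ := if s ∈ σ then faceSign R s σ • c (σ.erase s) else 0
  map_add' c c' := by ext σ; by_cases h : s ∈ σ <;> simp [h]
  map_smul' r c := by
    ext σ
    by_cases h : s ∈ σ
    · simpa [h] using smul_comm _ _ _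
    · simp [h]

variable {R}

theorem vertexBoundary_apply (s : X) (c : Finset X → V) (σ : Finset X) :
    vertexBoundary R s c σ = if s ∈ σ then 0 else faceSign R s σ • c (insert s σ) := rfl

theorem cone_apply (s : X) (c : Finset X → V) (σ : Finset X) :
    cone R s c σ = if s ∈ σ then faceSign R s σ • c (σ.erase s) else 0 := rfl

theorem vertexBoundary_self (s : X) (c : Finset X → V) :
    vertexBoundary R s (vertexBoundary R s c) = 0 := by
  ext σ
  simp [vertexBoundary_apply]

theorem vertexBoundary_anticomm {s t : X} (hst : s ≠ t) (c : Finset X → V) :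
    vertexBoundary R s (vertexBoundary R t c) = -vertexBoundary R t (vertexBoundary R s c) := by
  ext σ
  simp only [vertexBoundary_apply, Pi.neg_apply]
  by_cases hs : s ∈ σ
  · simp [hs]
  by_cases ht : t ∈ σ
  · simp [ht]
  simp only [hs, ht, Finset.mem_insert, hst, hst.symm, or_self, if_false, smul_smul]
  rw [faceSign_swap R hst hs ht, Finset.insert_comm, neg_smul]

theorem cone_vertexBoundary_self (s : X) (c : Finset X → V) :
    cone R s (vertexBoundary R s c) + vertexBoundary R s (cone R s c) = c := by
  ext σ
  simp only [vertexBoundary_apply, cone_apply, Pi.add_apply]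
  by_cases hs : s ∈ σ
  · simp [hs, smul_smul, faceSign_erase_self, faceSign_mul_self]
  · simp [hs, smul_smul, faceSign_insert_self, faceSign_mul_self]

theorem cone_vertexBoundary_anticomm {s t : X} (hst : s ≠ t) (c : Finset X → V) :
    cone R s (vertexBoundary R t c) = -vertexBoundary R t (cone R s c) := by
  ext σ
  simp only [vertexBoundary_apply, cone_apply, Pi.neg_apply]
  by_cases hs : s ∈ σ
  · by_cases ht : t ∈ σ
    · simp [ht, hst.symm]
    · have hs' : s ∉ σ.erase s := Finset.notMem_erase s σ
      have ht' : t ∉ σ.erase s := fun h => ht (Finset.mem_of_mem_erase h)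
      have h := faceSign_swap R hst hs' ht'
      rw [Finset.insert_erase hs, faceSign_erase_self] at h
      have hne : (insert t σ).erase s = insert t (σ.erase s) :=
        Finset.erase_insert_of_ne hst.symm
      have h2 : faceSign R s (insert t σ) = faceSign R s (insert t (σ.erase s)) := by
        rw [← hne, faceSign_erase_self]
      simp only [hs, ht, ht', if_true, if_false, smul_smul, hne, Finset.mem_insert, or_true]
      rw [h2, ← neg_smul]
      congr 1
      calc faceSign R s σ * faceSign R t (σ.erase s)
          = faceSign R s σ * faceSign R t (σ.erase s) *
            (faceSign R t σ * faceSign R t σ) := by rw [faceSign_mul_self, mul_one]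
        _ = (faceSign R s σ * faceSign R t σ) * faceSign R t σ *
              faceSign R t (σ.erase s) := by ring
        _ = -(faceSign R t σ * faceSign R s (insert t (σ.erase s))) *
              (faceSign R t (σ.erase s) * faceSign R t (σ.erase s)) := by rw [h]; ring
        _ = _ := by rw [faceSign_mul_self, mul_one]
  · by_cases ht : t ∈ σ <;> simp [hs, ht, hst]

variable (R)

/-- The simplicial boundary of chains on the full simplex with vertex set `U`. -/
def boundary (U : Finset X) : (Finset X → V) →ₗ[R] (Finset X → V) :=
  ∑ s ∈ U, vertexBoundary R s

variable {R}

theorem boundary_apply (U : Finset X) (c : Finset X → V) :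
    boundary R U c = ∑ s ∈ U, vertexBoundary R s c := by
  simp [boundary]

theorem boundary_boundary (U : Finset X) (c : Finset X → V) :
    boundary R U (boundary R U c) = 0 := by
  simp only [boundary_apply, map_sum]
  rw [← Finset.sum_product']
  refine Finset.sum_involution (fun a _ => (a.2, a.1)) ?_ ?_ ?_ ?_
  · rintro ⟨s, t⟩ -
    by_cases h : s = t
    · subst h; simp [vertexBoundary_self]
    · simp [vertexBoundary_anticomm h]
  · rintro ⟨s, t⟩ - h h'
    simp only [Prod.mk.injEq] at h'
    obtain rfl : t = s := h'.1
    exact h (vertexBoundary_self _ _)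
  · rintro ⟨s, t⟩ h
    simpa [and_comm] using h
  · simp

/-- The summands for t ≠ s cancel by anticommutation, and the one for s gives the identity. The
empty face is included, so this contracts the augmented complex. -/
theorem cone_boundary {U : Finset X} {s : X} (hs : s ∈ U) (c : Finset X → V) :
    cone R s (boundary R U c) + boundary R U (cone R s c) = c := by
  simp only [boundary_apply, map_sum]
  rw [← Finset.sum_add_distrib, Finset.sum_eq_single s]
  · exact cone_vertexBoundary_self s c
  · intro t _ ht
    rw [cone_vertexBoundary_anticomm ht.symm, neg_add_cancel]
  · exact fun h => (h hs).elim

/-- Consequently the part of a cycle through `s`, read on the link of `s`, is again a cycle. -/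
theorem vertexBoundary_boundary (U : Finset X) (s : X) (c : Finset X → V) :
    vertexBoundary R s (boundary R U c) = -boundary R U (vertexBoundary R s c) := by
  simp only [boundary_apply, map_sum, ← Finset.sum_neg_distrib]
  refine Finset.sum_congr rfl fun t _ => ?_
  by_cases h : s = t
  · subst h; simp [vertexBoundary_self]
  · exact vertexBoundary_anticomm h c

/-- Chains with values in the coefficient system `F`, supported on the simplices with `k`
vertices, all of them in `S`. -/
structure IsChainOn (F : Finset X → Submodule R V) (S : Set X) (k : ℕ) (c : Finset X → V) :
    Prop where
  mem : ∀ σ, c σ ∈ F σ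
  supp : ∀ σ, c σ ≠ 0 → (σ : Set X) ⊆ S ∧ σ.card = k

namespace IsChainOn

variable {F : Finset X → Submodule R V} {S S' : Set X} {k : ℕ} {c c' : Finset X → V}

set_option linter.unusedSectionVars false

theorem zero : IsChainOn F S k 0 := ⟨fun _ => zero_mem _, fun _ h => (h rfl).elim⟩

theorem add (h : IsChainOn F S k c) (h' : IsChainOn F S k c') : IsChainOn F S k (c + c') := by
  refine ⟨fun σ => add_mem (h.mem σ) (h'.mem σ), fun σ hσ => ?_⟩
  by_cases h0 : c σ = 0
  · exact h'.supp σ (by simpa [h0] using hσ)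
  · exact h.supp σ h0

theorem neg (h : IsChainOn F S k c) : IsChainOn F S k (-c) :=
  ⟨fun σ => neg_mem (h.mem σ), fun σ hσ => h.supp σ (by simpa using hσ)⟩

theorem sub (h : IsChainOn F S k c) (h' : IsChainOn F S k c') : IsChainOn F S k (c - c') := by
  rw [sub_eq_add_neg]; exact h.add h'.neg

theorem mono (h : IsChainOn F S k c) (hS : S ⊆ S') : IsChainOn F S' k c :=
  ⟨h.mem, fun σ hσ => ⟨(h.supp σ hσ).1.trans hS, (h.supp σ hσ).2⟩⟩

theorem sum {ι : Type*} {s : Finset ι} {f : ι → Finset X → V}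
    (h : ∀ i ∈ s, IsChainOn F S k (f i)) : IsChainOn F S k (∑ i ∈ s, f i) := by
  classical
  induction s using Finset.induction_on with
  | empty => simpa using zero
  | insert a s ha ih =>
    rw [Finset.sum_insert ha]
    exact (h a (by simp)).add (ih fun i hi => h i (by simp [hi]))

theorem vertexBoundary (hF : ∀ σ τ, σ.Nonempty → σ ⊆ τ → F τ ≤ F σ) (hk : k ≠ 0)
    (h : IsChainOn F S (k + 1) c) (s : X) : IsChainOn F S k (vertexBoundary R s c) := by
  have key : ∀ σ, BruhatTits.vertexBoundary R s c σ ≠ 0 → s ∉ σ ∧ c (insert s σ) ≠ 0 := by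
    intro σ hσ
    rw [vertexBoundary_apply] at hσ
    split_ifs at hσ with hs
    · exact (hσ rfl).elim
    · exact ⟨hs, fun h0 => hσ (by simp [h0])⟩
  have hsupp : ∀ σ, BruhatTits.vertexBoundary R s c σ ≠ 0 → (σ : Set X) ⊆ S ∧ σ.card = k := by
    intro σ hσ
    obtain ⟨hs, h0⟩ := key σ hσ
    obtain ⟨h1, h2⟩ := h.supp _ h0
    rw [Finset.card_insert_of_notMem hs] at h2
    exact ⟨fun t ht => h1 (by simp [Finset.mem_coe.mp ht]), by omega⟩
  refine ⟨fun σ => ?_, hsupp⟩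
  by_cases h0 : BruhatTits.vertexBoundary R s c σ = 0
  · rw [h0]; exact zero_mem _
  · have hne : σ.Nonempty := Finset.card_pos.mp (by have := (hsupp σ h0).2; omega)
    rw [vertexBoundary_apply, if_neg (key σ h0).1]
    exact Submodule.smul_mem _ _ (hF _ _ hne (Finset.subset_insert s σ) (h.mem _))

theorem boundary (hF : ∀ σ τ, σ.Nonempty → σ ⊆ τ → F τ ≤ F σ) (hk : k ≠ 0)
    (h : IsChainOn F S (k + 1) c) (U : Finset X) : IsChainOn F S k (boundary R U c) := by
  rw [boundary_apply]
  exact sum fun s _ => h.vertexBoundary hF hk s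

end IsChainOn

/-- Acyclicity of the closed lower links: every cycle on the vertices in `D` bounds, provided that
there are suitable projections `p T N`. -/
theorem exists_boundary_eq_of_projections {P : Type*} [SemilatticeSup P] {lam : X → P}
    (hlam : Function.Injective lam) {U D : Finset X} (hDU : D ⊆ U)
    (hsup : ∀ s ∈ D, ∀ t ∈ D, ∃ u ∈ D, lam u = lam s ⊔ lam t)
    {F : Finset X → Submodule R V} (hF : ∀ σ τ, σ.Nonempty → σ ⊆ τ → F τ ≤ F σ)
    (p : P → P → V →ₗ[R] V)
    (hfix : ∀ T ∈ D, ∀ N ∈ D, lam N ≤ lam T → ∀ σ ⊆ D, N ∈ σ → ∀ v ∈ F σ,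
      p (lam T) (lam N) v = v)
    (hmul : ∀ T ∈ D, ∀ N ∈ D, ∀ N' ∈ D, lam N ≤ lam T → lam N' ≤ lam T → ∀ σ ⊆ D, σ.Nonempty →
      ∀ v ∈ F σ,
      p (lam T) (lam N) (p (lam T) (lam N') v) = p (lam T) (lam N ⊔ lam N') v)
    (hmem : ∀ T ∈ D, ∀ N ∈ D, lam N ≤ lam T → ∀ σ ⊆ D, σ.Nonempty → (∀ s ∈ σ, lam s ≤ lam T) →
      ∀ v ∈ F σ, p (lam T) (lam N) v ∈ F σ)
    (htop : ∀ T ∈ D, ∀ σ ⊆ D, σ.Nonempty → (∀ s ∈ σ, lam s ≤ lam T) →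
      ∀ v ∈ F σ, p (lam T) (lam T) v ∈ F (insert T σ))
    {k : ℕ} (hk : k ≠ 0) {c : Finset X → V} (hc : IsChainOn F D k c)
    (hcycle : boundary R U c = 0) :
    ∃ b, IsChainOn F D (k + 1) b ∧ boundary R U b = c := by
  classical
  have pcomm : ∀ (q : V →ₗ[R] V) (c : Finset X → V),
      boundary R U (fun σ => q (c σ)) = fun σ => q (boundary R U c σ) := by
    intro q c
    ext σ
    simp only [boundary_apply, Finset.sum_apply, map_sum]
    refine Finset.sum_congr rfl fun s _ => ?_
    simp only [vertexBoundary_apply]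
    split_ifs <;> simp
  -- Induction on the number of vertices below `T`. The operators `p (lam T)` change with `T`, so
  -- the claim is made for all `T` at once; the original statement is the case of the greatest
  -- element of `D`, which exists by `hsup`.
  suffices main : ∀ m : ℕ, ∀ T ∈ D, (D.filter (lam · ≤ lam T)).card = m →
      ∀ c : Finset X → V, IsChainOn F (D.filter (lam · ≤ lam T)) k c → boundary R U c = 0 →
      ∃ b, IsChainOn F (D.filter (lam · ≤ lam T)) (k + 1) b ∧ boundary R U b = c by
    by_cases hD : D.Nonempty
    · obtain ⟨T, hT, hmax⟩ := D.exists_maximalFor lam hD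
      have hTtop : ∀ s ∈ D, lam s ≤ lam T := by
        intro s hs
        obtain ⟨u, hu, huv⟩ := hsup s hs T hT
        have := hmax hu (by rw [huv]; exact le_sup_right)
        exact le_trans (by rw [huv]; exact le_sup_left) this
      have hfilt : D.filter (lam · ≤ lam T) = D := Finset.filter_true_of_mem hTtop
      have := main _ T hT rfl c
      rw [hfilt] at this
      exact this hc hcycle
    · refine ⟨0, IsChainOn.zero, ?_⟩
      rw [map_zero]
      ext σ
      by_contra h0
      obtain ⟨h1, h2⟩ := hc.supp σ (fun h => h0 h.symm)
      rw [Finset.not_nonempty_iff_eq_empty.mp hD, Finset.coe_empty, Set.subset_empty_iff,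
        Finset.coe_eq_empty] at h1
      rw [h1] at h2
      exact hk h2.symm
  intro m
  induction m using Nat.strong_induction_on with
  | _ m ih =>
  intro T hT hm c hc hcycle
  set DT := D.filter (lam · ≤ lam T) with hDT
  have memDT : ∀ s, s ∈ DT ↔ s ∈ D ∧ lam s ≤ lam T := fun s => by simp [hDT]
  have hchain : ∀ {c : Finset X → V} {k : ℕ}, k ≠ 0 → IsChainOn F DT k c → ∀ σ, c σ ≠ 0 →
      σ ⊆ D ∧ σ.Nonempty ∧ ∀ s ∈ σ, lam s ≤ lam T := by
    intro c k hk hc σ hσ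
    obtain ⟨h1, h2⟩ := hc.supp σ hσ
    exact ⟨fun s hs => ((memDT s).mp (h1 hs)).1, Finset.card_pos.mp (by omega),
      fun s hs => ((memDT s).mp (h1 hs)).2⟩
  have pchain : ∀ N ∈ DT, ∀ {c : Finset X → V}, IsChainOn F DT k c →
      IsChainOn F DT k (fun σ => p (lam T) (lam N) (c σ)) := by
    intro N hN c hc
    obtain ⟨hN, hNT⟩ := (memDT N).mp hN
    refine ⟨fun σ => ?_, fun σ hσ => hc.supp σ fun h0 => hσ (by simp [h0])⟩
    by_cases h0 : c σ = 0
    · rw [h0, map_zero]; exact zero_mem _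
    · obtain ⟨h1, h2, h3⟩ := hchain hk hc σ h0
      exact hmem T hT N hN hNT σ h1 h2 h3 _ (hc.mem σ)
  -- `A` is an upper set, enlarged downwards by one minimal element `N` at a time; the corrected
  -- cycle is killed by the projections attached to all elements of `A`.
  have inner : ∀ n : ℕ, ∀ A ⊆ DT, A.card = n → (∀ s ∈ A, ∀ t ∈ DT, lam s ≤ lam t → t ∈ A) →
      ∃ b, IsChainOn F DT (k + 1) b ∧
        ∀ N ∈ A, ∀ σ, p (lam T) (lam N) ((c - boundary R U b) σ) = 0 := by
    intro n
    induction n with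
    | zero =>
      intro A _ hA _
      rw [Finset.card_eq_zero.mp hA]
      exact ⟨0, IsChainOn.zero, by simp⟩
    | succ n ihn =>
      intro A hA hcard hup
      have hne : A.Nonempty := Finset.card_pos.mp (by omega)
      obtain ⟨N, hN, hmin⟩ := A.exists_minimalFor lam hne
      obtain ⟨hND, hNT⟩ := (memDT N).mp (hA hN)
      obtain ⟨b, hb, hb'⟩ := ihn (A.erase N) ((Finset.erase_subset _ _).trans hA)
        (by rw [Finset.card_erase_of_mem hN]; omega) (by
          intro s hs t ht hst
          have hs' := Finset.mem_of_mem_erase hs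
          refine Finset.mem_erase.mpr ⟨?_, hup s hs' t ht hst⟩
          rintro rfl
          exact Finset.ne_of_mem_erase hs (hlam (le_antisymm hst (hmin hs' hst))))
      set c' := c - boundary R U b with hc'
      have hc'ch : IsChainOn F DT k c' := hc.sub (hb.boundary hF hk U)
      have hc'cy : boundary R U c' = 0 := by rw [hc', map_sub, hcycle, boundary_boundary, sub_zero]
      -- Only simplices below `N` survive: for s ∈ σ the value `c' σ` is fixed by the projection of
      -- s, so applying that of `N` amounts to applying that of N ⊔ s, which already kills it unless
      -- N ⊔ s = N.
      have hsuppN : IsChainOn F (D.filter (lam · ≤ lam N)) k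
          (fun σ => p (lam T) (lam N) (c' σ)) := by
        refine ⟨(pchain N (hA hN) hc'ch).mem, fun σ hσ => ⟨fun s hs => ?_, ?_⟩⟩
        · have h0 : c' σ ≠ 0 := fun h0 => hσ (by simp [h0])
          obtain ⟨h1, h2, h3⟩ := hchain hk hc'ch σ h0
          obtain ⟨u, hu, huv⟩ := hsup N hND s (h1 hs)
          have huT : u ∈ DT := (memDT u).mpr ⟨hu, by rw [huv]; exact sup_le hNT (h3 s hs)⟩
          have huA : u ∈ A := hup N hN u huT (by rw [huv]; exact le_sup_left)
          have huN : u = N := by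
            by_contra hne
            apply hσ
            have hfixs := hfix T hT s (h1 hs) (h3 s hs) σ h1 hs _ (hc'ch.mem σ)
            have hm := hmul T hT N hND s (h1 hs) hNT (h3 s hs) σ h1 h2 _ (hc'ch.mem σ)
            rw [hfixs, ← huv] at hm
            exact hm.trans (hb' u (Finset.mem_erase.mpr ⟨hne, huA⟩) σ)
          simp only [Finset.coe_filter, Set.mem_ofPred_eq]
          refine ⟨h1 hs, ?_⟩
          rw [← huN, huv]
          exact le_sup_right
        · exact (hc'ch.supp σ fun h0 => hσ (by simp [h0])).2
      have hcyN : boundary R U (fun σ => p (lam T) (lam N) (c' σ)) = 0 := by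
        rw [pcomm, hc'cy]; ext; simp
      have hbN : ∃ b', IsChainOn F DT (k + 1) b' ∧
          boundary R U b' = fun σ => p (lam T) (lam N) (c' σ) := by
        -- For N = T the image is filled by the cone with apex `T`, whose values are admissible by
        -- `htop`. For N < T the set below `N` is smaller, and the outer induction applies.
        by_cases hNeq : N = T
        · subst hNeq
          set e : Finset X → V := fun σ => p (lam N) (lam N) (c' σ) with he
          refine ⟨cone R N e, ⟨fun σ => ?_, fun σ hσ => ?_⟩, ?_⟩
          · rw [cone_apply]
            split_ifs with h
            · refine Submodule.smul_mem _ _ ?_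
              by_cases h0 : c' (σ.erase N) = 0
              · simp only [he, h0, map_zero]; exact zero_mem _
              · obtain ⟨h1, h2, h3⟩ := hchain hk hc'ch _ h0
                have := htop N hND _ h1 h2 h3 _ (hc'ch.mem _)
                rwa [Finset.insert_erase h] at this
            · exact zero_mem _
          · rw [cone_apply] at hσ
            split_ifs at hσ with h
            · have h0 : c' (σ.erase N) ≠ 0 := fun h0 => hσ (by simp [he, h0])
              obtain ⟨h1, h2⟩ := hc'ch.supp _ h0
              rw [← Finset.insert_erase h]
              refine ⟨?_, ?_⟩
              · rw [Finset.coe_insert]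
                exact Set.insert_subset (hA hN) h1
              · rw [Finset.card_insert_of_notMem (Finset.notMem_erase _ _), h2]
            · exact (hσ rfl).elim
          · have := cone_boundary (R := R) (hDU hND) e
            rwa [hcyN, map_zero, zero_add] at this
        · have hlt : (D.filter (lam · ≤ lam N)).card < m := by
            rw [← hm]
            refine Finset.card_lt_card ⟨fun s hs => ?_, fun hsub => ?_⟩
            · rw [Finset.mem_filter] at hs
              exact (memDT s).mpr ⟨hs.1, hs.2.trans hNT⟩
            · have := hsub ((memDT T).mpr ⟨hT, le_rfl⟩)
              rw [Finset.mem_filter] at this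
              exact hNeq (hlam (le_antisymm hNT this.2))
          obtain ⟨b', h1, h2⟩ := ih _ hlt N hND rfl _ hsuppN hcyN
          refine ⟨b', h1.mono fun s hs => ?_, h2⟩
          simp only [Finset.coe_filter, Set.mem_ofPred_eq] at hs
          exact (memDT s).mpr ⟨hs.1, hs.2.trans hNT⟩
      obtain ⟨b', hb'1, hb'2⟩ := hbN
      -- The new cycle is c' - p_N c'. Since p_N' p_N = p_(N' ⊔ N), the case N' = N gives zero; for
      -- other N' in `A`, both N' and N' ⊔ N differ from `N` and so already kill c'.
      refine ⟨b + b', hb.add hb'1, fun N' hN' σ => ?_⟩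
      have hrew : (c - boundary R U (b + b')) σ = c' σ - p (lam T) (lam N) (c' σ) := by
        rw [map_add, hb'2, hc']
        simp only [Pi.sub_apply, Pi.add_apply]
        abel
      rw [hrew, map_sub]
      obtain ⟨hN'D, hN'T⟩ := (memDT N').mp (hA hN')
      by_cases h0 : c' σ = 0
      · simp [h0]
      obtain ⟨h1, h2, h3⟩ := hchain hk hc'ch σ h0
      rw [hmul T hT N' hN'D N hND hN'T hNT σ h1 h2 _ (hc'ch.mem σ)]
      by_cases hNN : N' = N
      · subst hNN; simp
      · obtain ⟨u, hu, huv⟩ := hsup N' hN'D N hND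
        have huA : u ∈ A := hup N' hN' u ((memDT u).mpr ⟨hu, by rw [huv]; exact sup_le hN'T hNT⟩)
          (by rw [huv]; exact le_sup_left)
        have huN : u ≠ N := by
          rintro rfl
          exact hNN (hlam (le_antisymm (by rw [huv]; exact le_sup_left)
            (hmin hN' (by rw [huv]; exact le_sup_left))))
        have e1 := hb' N' (Finset.mem_erase.mpr ⟨hNN, hN'⟩) σ
        have e2 := hb' u (Finset.mem_erase.mpr ⟨huN, huA⟩) σ
        rw [huv] at e2
        rw [e1, e2, sub_zero]
  -- With `A` equal to everything below `T` all projections kill the corrected cycle. Its value on σ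
  -- is fixed by the projection of any vertex of σ, hence is zero.
  obtain ⟨b, hb, hb'⟩ := inner _ DT le_rfl rfl fun s _ t ht _ => ht
  refine ⟨b, hb, ?_⟩
  have hch : IsChainOn F DT k (c - boundary R U b) := hc.sub (hb.boundary hF hk U)
  have : c - boundary R U b = 0 := by
    ext σ
    by_contra h0
    obtain ⟨h1, ⟨s, hs⟩, h3⟩ := hchain hk hch σ h0
    have := hb' s ((memDT s).mpr ⟨h1 hs, h3 s hs⟩) σ
    rw [hfix T hT s (h1 hs) (h3 s hs) σ h1 hs _ (hch.mem σ)] at this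
    exact h0 this
  exact (sub_eq_zero.mp this).symm

/-- A coefficient system on simplices whose vertices are linearly ordered by `lam` is acyclic if
its upper links are. -/
theorem exists_boundary_eq_of_links {P : Type*} [PartialOrder P] {lam : X → P}
    (hlam : Function.Injective lam) {U : Finset X}
    (hU : ∀ s ∈ U, ∀ t, lam s ≤ lam t → t ∈ U)
    {F : Finset X → Submodule R V} (hF : ∀ σ τ, σ.Nonempty → σ ⊆ τ → F τ ≤ F σ)
    (htot : ∀ σ, F σ ≠ ⊥ → ∀ s ∈ σ, ∀ t ∈ σ, lam s ≤ lam t ∨ lam t ≤ lam s)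
    (hlink : ∀ x ∈ U, ∀ k : ℕ, k ≠ 0 → ∀ c : Finset X → V,
      IsChainOn (fun σ => F (insert x σ)) {t | lam x < lam t} k c → boundary R U c = 0 →
      ∃ b, IsChainOn (fun σ => F (insert x σ)) {t | lam x < lam t} (k + 1) b ∧
        boundary R U b = c)
    {k : ℕ} (hk : 1 < k) {c : Finset X → V} (hc : IsChainOn F U k c)
    (hcycle : boundary R U c = 0) :
    ∃ b, IsChainOn F U (k + 1) b ∧ boundary R U b = c := by
  classical
  -- The support `A` shrinks by one minimal vertex per step and stays an upper set of `U`.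
  suffices main : ∀ n : ℕ, ∀ A ⊆ U, A.card = n → (∀ s ∈ A, ∀ t ∈ U, lam s ≤ lam t → t ∈ A) →
      ∀ c : Finset X → V, IsChainOn F A k c → boundary R U c = 0 →
      ∃ b, IsChainOn F A (k + 1) b ∧ boundary R U b = c from
    main _ U le_rfl rfl (fun _ _ t ht _ => ht) c hc hcycle
  intro n
  induction n with
  | zero =>
    intro A _ hA _ c hc _
    refine ⟨0, IsChainOn.zero, ?_⟩
    rw [map_zero]
    ext σ
    by_contra h0
    obtain ⟨h1, h2⟩ := hc.supp σ (fun h => h0 h.symm)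
    rw [Finset.card_eq_zero.mp hA, Finset.coe_empty, Set.subset_empty_iff,
      Finset.coe_eq_empty] at h1
    rw [h1, Finset.card_empty] at h2
    omega
  | succ n ih =>
    intro A hA hcard hup c hc hcycle
    obtain ⟨x, hx, hmin⟩ := A.exists_minimalFor lam (Finset.card_pos.mp (by omega))
    have hxU := hA hx
    obtain ⟨j, rfl⟩ : ∃ j, k = j + 1 := ⟨k - 1, by omega⟩
    have hj : j ≠ 0 := by omega
    -- A simplex with nonzero coefficients is totally ordered, so the minimal vertex `x` of `A` is
    -- its least vertex and its other vertices lie in the upper link.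
    have hge : ∀ σ, F σ ≠ ⊥ → x ∈ σ → (σ : Set X) ⊆ A → ∀ t ∈ σ, t ≠ x → lam x < lam t := by
      intro σ hσ hxσ hσA t ht htx
      have hle : lam x ≤ lam t := by
        rcases htot σ hσ x hxσ t ht with h | h
        · exact h
        · exact hmin (hσA ht) h
      exact lt_of_le_of_ne hle fun h => htx (hlam h).symm
    have hupx : ∀ t, lam x < lam t → t ∈ A.erase x := by
      intro t ht
      refine Finset.mem_erase.mpr ⟨by rintro rfl; exact lt_irrefl _ ht, ?_⟩
      exact hup x hx t (hU x hxU t ht.le) ht.le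
    -- `g` collects the simplices of `c` through `x`, with `x` deleted; its coefficients still
    -- remember `x`.
    set g := vertexBoundary R x c with hg
    have hgsupp : ∀ σ, g σ ≠ 0 → x ∉ σ ∧ c (insert x σ) ≠ 0 := by
      intro σ hσ
      rw [hg, vertexBoundary_apply] at hσ
      split_ifs at hσ with hs
      · exact (hσ rfl).elim
      · exact ⟨hs, fun h0 => hσ (by simp [h0])⟩
    have hFne : ∀ {σ} {v : V}, v ∈ F σ → v ≠ 0 → F σ ≠ ⊥ := by
      intro σ v hv h0 hbot
      rw [hbot] at hv
      exact h0 hv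
    have hgch : IsChainOn (fun σ => F (insert x σ)) {t | lam x < lam t} j g := by
      refine ⟨fun σ => ?_, fun σ hσ => ?_⟩
      · rw [hg, vertexBoundary_apply]
        split_ifs
        · exact zero_mem _
        · exact Submodule.smul_mem _ _ (hc.mem _)
      · obtain ⟨h1, h2⟩ := hgsupp σ hσ
        obtain ⟨h3, h4⟩ := hc.supp _ h2
        rw [Finset.card_insert_of_notMem h1] at h4
        refine ⟨fun t ht => ?_, by omega⟩
        exact hge _ (hFne (hc.mem _) h2) (Finset.mem_insert_self _ _) h3 t
          (Finset.mem_insert_of_mem ht) (by rintro rfl; exact h1 ht)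
    have hgcy : boundary R U g = 0 := by
      have := vertexBoundary_boundary (R := R) U x c
      rw [hcycle, map_zero] at this
      exact neg_eq_zero.mp this.symm
    obtain ⟨b, hb, hbg⟩ := hlink x hxU j hj g hgch hgcy
    have hbx : ∀ σ, b σ ≠ 0 → x ∉ σ := fun σ hσ hxσ => lt_irrefl _ ((hb.supp σ hσ).1 hxσ)
    have hconeb : IsChainOn F A (j + 1 + 1) (cone R x b) := by
      refine ⟨fun σ => ?_, fun σ hσ => ?_⟩
      · rw [cone_apply]
        split_ifs with h
        · refine Submodule.smul_mem _ _ ?_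
          have := hb.mem (σ.erase x)
          simpa only [Finset.insert_erase h] using this
        · exact zero_mem _
      · rw [cone_apply] at hσ
        split_ifs at hσ with h
        · obtain ⟨h1, h2⟩ := hb.supp (σ.erase x) fun h0 => hσ (by simp [h0])
          rw [← Finset.insert_erase h]
          refine ⟨?_, ?_⟩
          · rw [Finset.coe_insert]
            exact Set.insert_subset hx fun t ht => Finset.mem_of_mem_erase (hupx t (h1 ht))
          · rw [Finset.card_insert_of_notMem (Finset.notMem_erase _ _), h2]
        · exact (hσ rfl).elim
    -- As ∂b = g, the homotopy formula gives ∂(cone b) = b - cone g, and cone g is the part of `c`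
    -- through `x`. So that part is replaced by `b`, which avoids `x`.
    set c' := c + boundary R U (cone R x b) with hc'
    have hc'eq : c' = vertexBoundary R x (cone R x c) + b := by
      have h1 := cone_boundary (R := R) hxU b
      have h2 := cone_vertexBoundary_self (R := R) x c
      rw [hbg] at h1
      rw [← hg] at h2
      rw [hc', eq_sub_of_add_eq' h1]
      nth_rewrite 1 [← h2]
      abel
    have hc'ch : IsChainOn F A (j + 1) c' := hc.add (hconeb.boundary hF (by omega) U)
    have hc'supp : IsChainOn F (A.erase x) (j + 1) c' := by
      refine ⟨hc'ch.mem, fun σ hσ => ⟨fun t ht => ?_, (hc'ch.supp σ hσ).2⟩⟩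
      refine Finset.mem_coe.mpr (Finset.mem_erase.mpr ⟨?_, (hc'ch.supp σ hσ).1 ht⟩)
      rintro rfl
      apply hσ
      rw [hc'eq, Pi.add_apply, vertexBoundary_apply, if_pos (Finset.mem_coe.mp ht), zero_add]
      by_contra h0
      exact hbx σ h0 ht
    obtain ⟨b', hb', hb'c⟩ := ih (A.erase x) ((Finset.erase_subset _ _).trans hA)
      (by rw [Finset.card_erase_of_mem hx]; omega) (by
        intro s hs t ht hst
        have hs' := Finset.mem_of_mem_erase hs
        refine Finset.mem_erase.mpr ⟨?_, hup s hs' t ht hst⟩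
        rintro rfl
        exact Finset.ne_of_mem_erase hs (hlam (le_antisymm hst (hmin hs' hst)))) c' hc'supp
      (by rw [hc', map_add, hcycle, boundary_boundary, add_zero])
    refine ⟨b' - cone R x b, (hb'.mono (Finset.coe_subset.mpr (Finset.erase_subset _ _))).sub hconeb,
      ?_⟩
    rw [map_sub, hb'c, hc', add_sub_cancel_right]

end SimplicialChains

/-! ### Averaging over a group with finite quotients of invertible order -/

section Averaging

variable {R H V : Type*} [CommRing R] [Group H] [AddCommGroup V] [Module R V]

theorem apply_out_mul {ρ : Representation R H V} {U : Subgroup H} [U.Normal] {v : V}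
    (hv : ∀ u ∈ U, ρ u v = v) (g : H) : ρ (g : H ⧸ U).out v = ρ g v := by
  obtain ⟨u, hu⟩ := QuotientGroup.mk_out_eq_mul U g
  rw [hu, map_mul, Module.End.mul_apply, hv u u.2]

/-- If a group acts smoothly, with quotients of invertible order, then there is an equivariant
projection onto the fixed vectors. -/
theorem exists_averaging (ρ : Representation R H V) (U : ℕ → Subgroup H) (hanti : Antitone U)
    (hnormal : ∀ m, (U m).Normal) (hfin : ∀ m, Finite (H ⧸ U m))
    (hunit : ∀ m, IsUnit ((Nat.card (H ⧸ U m) : ℕ) : R))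
    (hsmooth : ∀ v, ∃ m, ∀ u ∈ U m, ρ u v = v) :
    ∃ p : V →ₗ[R] V, (∀ h v, ρ h (p v) = p v) ∧ (∀ v, (∀ h, ρ h v = v) → p v = v) ∧
      (∀ h v, p (ρ h v) = p v) ∧
      (∀ φ : V →ₗ[R] V, (∀ h v, φ (ρ h v) = φ v) → ∀ v, φ (p v) = φ v) ∧
      (∀ S : Submodule R V, (∀ h, ∀ v ∈ S, ρ h v ∈ S) → ∀ v ∈ S, p v ∈ S) := by
  classical
  have := hnormal
  have := fun m => Fintype.ofFinite (H ⧸ U m)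
  -- The projection of v is characterized as the unique invariant vector in v + I. Uniqueness makes
  -- the level of the averaging irrelevant and yields linearity.
  set I : Submodule R V := Submodule.span R {w | ∃ h v, w = ρ h v - v} with hI
  have memI : ∀ h v, ρ h v - v ∈ I := fun h v => Submodule.subset_span ⟨h, v, rfl⟩
  let S (m : ℕ) : V →ₗ[R] V := ∑ q : H ⧸ U m, ρ q.out
  have hS : ∀ m v, S m v = ∑ q : H ⧸ U m, ρ q.out v := fun m v => by simp [S]
  have hSinv : ∀ m v, (∀ u ∈ U m, ρ u v = v) → ∀ h, ρ h (S m v) = S m v := by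
    intro m v hv h
    rw [hS, map_sum]
    refine Fintype.sum_equiv (Equiv.mulLeft (h : H ⧸ U m)) _ _ fun q => ?_
    rw [← Module.End.mul_apply, ← map_mul, ← apply_out_mul hv]
    congr 2
    simp
  have hSfix : ∀ m v, (∀ h, ρ h v = v) → S m v = (Nat.card (H ⧸ U m) : R) • v := by
    intro m v hv
    simp only [hS, hv, Finset.sum_const, Finset.card_univ, Nat.card_eq_fintype_card]
    rw [Nat.cast_smul_eq_nsmul]
  -- The sums vanish at all sufficiently deep levels, not just at one, so that finitely many
  -- generators can be treated at a common level.
  have hScoinv : ∀ w ∈ I, ∃ m, ∀ m' ≥ m, S m' w = 0 := by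
    intro w hw
    induction hw using Submodule.span_induction with
    | mem w hw =>
      obtain ⟨h, v, rfl⟩ := hw
      obtain ⟨m, hm⟩ := hsmooth v
      refine ⟨m, fun m' hm' => ?_⟩
      have hv : ∀ u ∈ U m', ρ u v = v := fun u hu => hm u (hanti hm' hu)
      rw [map_sub, sub_eq_zero, hS, hS]
      refine Fintype.sum_equiv (Equiv.mulRight (h : H ⧸ U m')) _ _ fun q => ?_
      rw [← Module.End.mul_apply, ← map_mul, ← apply_out_mul hv]
      congr 2
      simp
    | zero => exact ⟨0, by simp⟩
    | add x y _ _ hx hy =>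
      obtain ⟨m, hm⟩ := hx
      obtain ⟨m', hm'⟩ := hy
      exact ⟨max m m', fun n hn => by
        rw [map_add, hm n (le_of_max_le_left hn), hm' n (le_of_max_le_right hn), add_zero]⟩
    | smul r x _ hx =>
      obtain ⟨m, hm⟩ := hx
      exact ⟨m, fun n hn => by rw [map_smul, hm n hn, smul_zero]⟩
  -- A deep sum kills `w` as an element of `I`, but multiplies it by an invertible index as an
  -- invariant.
  have huniq : ∀ w ∈ I, (∀ h, ρ h w = w) → w = 0 := by
    intro w hw hinv
    obtain ⟨m, hm⟩ := hScoinv w hw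
    have h1 := hm m le_rfl
    rw [hSfix m w hinv] at h1
    exact (hunit m).smul_eq_zero.mp h1
  have hex : ∀ v, ∃ w, (∀ h, ρ h w = w) ∧ w - v ∈ I ∧
      ∀ S : Submodule R V, (∀ h, ∀ v ∈ S, ρ h v ∈ S) → v ∈ S → w ∈ S := by
    intro v
    obtain ⟨m, hm⟩ := hsmooth v
    obtain ⟨r, hr⟩ := (hunit m).exists_left_inv
    have hv : v = r • ∑ q : H ⧸ U m, v := by
      rw [Finset.sum_const, Finset.card_univ, ← Nat.card_eq_fintype_card,
        ← Nat.cast_smul_eq_nsmul R, smul_smul, hr, one_smul]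
    refine ⟨r • S m v, fun h => by rw [map_smul, hSinv m v hm], ?_, fun S' hS' hvS => ?_⟩
    · nth_rewrite 2 [hv]
      rw [hS, ← smul_sub, ← Finset.sum_sub_distrib]
      exact Submodule.smul_mem _ _ (Submodule.sum_mem _ fun q _ => memI _ _)
    · rw [hS]
      exact Submodule.smul_mem _ _ (Submodule.sum_mem _ fun q _ => hS' _ _ hvS)
  choose p hp1 hp2 hp3 using hex
  have heq : ∀ v w, (∀ h, ρ h w = w) → w - v ∈ I → p v = w := by
    intro v w hw hwv
    refine sub_eq_zero.mp (huniq _ ?_ fun h => by rw [map_sub, hp1, hw])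
    have := sub_mem (hp2 v) hwv
    rwa [sub_sub_sub_cancel_right] at this
  refine ⟨⟨⟨p, fun v w => heq _ _ (fun h => by rw [map_add, hp1, hp1]) ?_⟩,
    fun r v => heq _ _ (fun h => by rw [map_smul]; exact congrArg _ (hp1 _ _)) ?_⟩,
    fun h v => hp1 v h, fun v hv => heq v v hv (by simp),
    fun h v => heq _ _ (hp1 v) ?_, ?_, fun S hS v hv => hp3 v S hS hv⟩
  · rw [add_sub_add_comm]; exact add_mem (hp2 v) (hp2 w)
  · rw [RingHom.id_apply, ← smul_sub]; exact Submodule.smul_mem _ _ (hp2 v)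
  · rw [← sub_sub_sub_cancel_right _ _ v]; exact sub_mem (hp2 v) (memI h v)
  · intro φ hφ v
    have : I ≤ LinearMap.ker φ := by
      rw [hI, Submodule.span_le]
      rintro _ ⟨h, v, rfl⟩
      simp [hφ]
    have h2 := this (hp2 v)
    rw [LinearMap.mem_ker, map_sub, sub_eq_zero] at h2
    exact h2

end Averaging

/-! ### From direct sums over cells to functions on finite vertex sets -/

section Transfer

variable {K : Type*} [Field K] [ValuativeRel K] {d : ℕ} {R V : Type*} [CommRing R]
  [AddCommGroup V] [Module R V] {ρ : Representation R (GL (Fin (d + 1)) K) V} {n : ℕ}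

/-- The values of the coefficient system of fixed vectors, extended by zero outside `Y`. -/
def fixedValues (ρ : Representation R (GL (Fin (d + 1)) K) V) (n : ℕ) (Y : Subcomplex K d)
    (σ : Finset (Vertex K d)) : Submodule R V :=
  open Classical in if σ ∈ Y.faces then fixedBy ρ (congruenceSubgroup n σ) else ⊥

theorem mem_fixedValues_of_mem {Y : Subcomplex K d} {σ : Finset (Vertex K d)} (h : σ ∈ Y.faces)
    {v : V} : v ∈ fixedValues ρ n Y σ ↔ v ∈ fixedBy ρ (congruenceSubgroup n σ) := by
  rw [fixedValues, if_pos h]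

theorem mem_faces_of_mem_fixedValues {Y : Subcomplex K d} {σ : Finset (Vertex K d)}
    {v : V} (h : v ∈ fixedValues ρ n Y σ) (h0 : v ≠ 0) : σ ∈ Y.faces := by
  by_contra h1
  rw [fixedValues, if_neg h1] at h
  exact h0 h

/-- The empty set is never a face, so its value is `⊥`; this is why σ must be nonempty. -/
theorem fixedValues_anti (Y : Subcomplex K d) (σ τ : Finset (Vertex K d)) (hσ : σ.Nonempty)
    (h : σ ⊆ τ) : fixedValues ρ n Y τ ≤ fixedValues ρ n Y σ := by
  intro v hv
  by_cases h0 : v = 0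
  · rw [h0]; exact zero_mem _
  have hτ := mem_faces_of_mem_fixedValues hv h0
  rw [mem_fixedValues_of_mem (Y.down_closed τ hτ σ h hσ)]
  rw [mem_fixedValues_of_mem hτ] at hv
  exact fixedBy_anti ρ (congruenceSubgroup_mono n h) hv

/-- The inclusion of the values of the system of fixed vectors into the representation. -/
def fixedSystemVal (ρ : Representation R (GL (Fin (d + 1)) K) V) (n : ℕ) (σ : Simplex K d) :
    (fixedSystem ρ n).obj σ →ₗ[R] V :=
  (fixedBy ρ (congruenceSubgroup n σ.1)).subtype

theorem fixedSystemVal_injective (σ : Simplex K d) : Function.Injective (fixedSystemVal ρ n σ) :=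
  Subtype.val_injective

theorem fixedSystemVal_mem (σ : Simplex K d) (v : (fixedSystem ρ n).obj σ) :
    fixedSystemVal ρ n σ v ∈ fixedBy ρ (congruenceSubgroup n σ.1) :=
  Subtype.property (p := fun v => v ∈ fixedBy ρ (congruenceSubgroup n σ.1)) v

theorem exists_fixedSystemVal_eq (σ : Simplex K d) {v : V}
    (hv : v ∈ fixedBy ρ (congruenceSubgroup n σ.1)) : ∃ w, fixedSystemVal ρ n σ w = v :=
  ⟨(⟨v, hv⟩ : fixedBy ρ (congruenceSubgroup n σ.1)), rfl⟩

theorem subtype_inclusion {P Q : Submodule R V} (h : P ≤ Q) (v : P) :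
    Q.subtype (Submodule.inclusion h v) = P.subtype v := rfl

theorem fixedSystemVal_map {σ τ : Simplex K d} (h : σ ≤ τ) (v : (fixedSystem ρ n).obj τ) :
    fixedSystemVal ρ n σ ((fixedSystem ρ n).map h v) = fixedSystemVal ρ n τ v :=
  subtype_inclusion (fixedBy_anti ρ (congruenceSubgroup_mono n h)) v

/-- The function on all finite sets of vertices defined by a chain. -/
def chainFun (ρ : Representation R (GL (Fin (d + 1)) K) V) (n : ℕ) (Y : Subcomplex K d) (k : ℕ) :
    (fixedSystem ρ n).Chain Y k →ₗ[R] (Finset (Vertex K d) → V) :=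
  open Classical in
  LinearMap.pi fun σ =>
    if h : σ ∈ Y.faces ∧ σ.card = k + 1 then
      fixedSystemVal ρ n ⟨σ, Y.isSimplex σ h.1⟩ ∘ₗ DirectSum.component R (Y.Cell k)
        (fun σ => (fixedSystem ρ n).obj σ.1) ⟨⟨σ, Y.isSimplex σ h.1⟩, h⟩
    else 0

theorem chainFun_apply (Y : Subcomplex K d) (k : ℕ) (c : (fixedSystem ρ n).Chain Y k)
    (τ : Y.Cell k) :
    chainFun ρ n Y k c τ.1.1 = fixedSystemVal ρ n τ.1 (c τ) := by
  rw [chainFun, LinearMap.pi_apply, dif_pos τ.2]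
  rfl

theorem chainFun_of_not (Y : Subcomplex K d) (k : ℕ) (c : (fixedSystem ρ n).Chain Y k)
    {σ : Finset (Vertex K d)} (h : ¬ (σ ∈ Y.faces ∧ σ.card = k + 1)) :
    chainFun ρ n Y k c σ = 0 := by
  rw [chainFun, LinearMap.pi_apply, dif_neg h]
  rfl

theorem chainFun_injective (Y : Subcomplex K d) (k : ℕ) :
    Function.Injective (chainFun ρ n Y k) := by
  intro c c' h
  refine DFinsupp.ext fun τ => fixedSystemVal_injective τ.1 ?_
  have := congrFun h τ.1.1
  rwa [chainFun_apply, chainFun_apply] at this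

theorem chainFun_lof (Y : Subcomplex K d) (k : ℕ) (τ : Y.Cell k)
    [DecidableEq (Finset (Vertex K d))] [DecidableEq (Y.Cell k)] (v : (fixedSystem ρ n).obj τ.1) :
    chainFun ρ n Y k (DirectSum.lof R (Y.Cell k) (fun σ => (fixedSystem ρ n).obj σ.1) τ v) =
      Pi.single τ.1.1 (fixedSystemVal ρ n τ.1 v) := by
  ext σ
  by_cases h : σ ∈ Y.faces ∧ σ.card = k + 1
  · obtain ⟨τ', rfl⟩ : ∃ τ' : Y.Cell k, σ = τ'.1.1 := ⟨⟨⟨σ, Y.isSimplex σ h.1⟩, h⟩, rfl⟩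
    rw [chainFun_apply]
    by_cases hσ : τ' = τ
    · subst hσ
      rw [Pi.single_eq_same, DirectSum.lof_apply]
    · rw [Pi.single_eq_of_ne fun h' => hσ (Subtype.ext (Subtype.ext h')), DirectSum.lof_eq_of,
        DirectSum.of_eq_of_ne _ _ _ hσ, map_zero]
  · rw [chainFun_of_not Y k _ h, Pi.single_eq_of_ne]
    rintro rfl
    exact h τ.2

theorem boundary_single {X : Type*} [LinearOrder X] (U τ : Finset X) (hτ : τ ⊆ U) (v : V) :
    boundary R U (Pi.single τ v) =
      ∑ s : {s // s ∈ τ}, faceSign R s.1 τ • Pi.single (τ.erase s.1) v := by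
  rw [boundary_apply, Finset.univ_eq_attach,
    Finset.sum_attach τ fun s => faceSign R s τ • (Pi.single (τ.erase s) v : Finset X → V)]
  refine (Finset.sum_subset_zero_on_sdiff hτ (fun s hs => ?_) fun s hs => ?_).symm
  · ext σ
    rw [vertexBoundary_apply, Pi.zero_apply]
    split_ifs with h
    · rfl
    · rw [Pi.single_eq_of_ne, smul_zero]
      rintro rfl
      simp at hs
  · ext σ
    rw [vertexBoundary_apply, Pi.smul_apply]
    split_ifs with h
    · rw [Pi.single_eq_of_ne, smul_zero]
      rintro rfl
      simp at h
    · by_cases h' : insert s σ = τ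
      · subst h'
        rw [Pi.single_eq_same, Finset.erase_insert h, Pi.single_eq_same, faceSign_insert_self]
      · rw [Pi.single_eq_of_ne h', Pi.single_eq_of_ne, smul_zero, smul_zero]
        rintro rfl
        exact h' (Finset.insert_erase hs)

variable [LinearOrder (Vertex K d)]

/-- Deleting or inserting vertices outside the support contributes nothing, so any finite `U`
containing the support computes the differential. -/
theorem chainFun_differential (Y : Subcomplex K d) (k : ℕ) (U : Finset (Vertex K d))
    (c : (fixedSystem ρ n).Chain Y (k + 1))
    (hU : ∀ σ, chainFun ρ n Y (k + 1) c σ ≠ 0 → σ ⊆ U) :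
    chainFun ρ n Y k ((fixedSystem ρ n).differential Y k c) =
      boundary R U (chainFun ρ n Y (k + 1) c) := by
  classical
  have hsum := DirectSum.sum_support_of c
  rw [← hsum]
  simp only [map_sum]
  refine Finset.sum_congr rfl fun τ hτ => ?_
  have hτU : τ.1.1 ⊆ U := by
    apply hU
    rw [chainFun_apply]
    intro h0
    exact DFinsupp.mem_support_iff.mp hτ (fixedSystemVal_injective τ.1 (h0.trans (map_zero _).symm))
  rw [← DirectSum.lof_eq_of R, chainFun_lof Y (k + 1) τ (c τ), boundary_single U _ hτU,
    CoefficientSystem.differential, DirectSum.toModule_lof]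
  simp only [LinearMap.sum_apply, LinearMap.smul_apply, LinearMap.comp_apply, map_sum, map_smul]
  refine Finset.sum_congr rfl fun s _ => ?_
  congr 1
  rw [chainFun_lof, fixedSystemVal_map]
  rfl

theorem exists_chainFun_eq (Y : Subcomplex K d) (k : ℕ) (U : Finset (Vertex K d))
    {b : Finset (Vertex K d) → V} (hb : IsChainOn (fixedValues ρ n Y) U (k + 1) b) :
    ∃ c, chainFun ρ n Y k c = b := by
  classical
  have hfaces : ∀ σ, b σ ≠ 0 → σ ∈ Y.faces ∧ σ.card = k + 1 := fun σ hσ =>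
    ⟨mem_faces_of_mem_fixedValues (hb.mem σ) hσ, (hb.supp σ hσ).2⟩
  have hex : ∀ σ, ∃ c, chainFun ρ n Y k c = Pi.single σ (b σ) := by
    intro σ
    by_cases h : b σ = 0
    · exact ⟨0, by rw [map_zero, h, Pi.single_zero]⟩
    · let τ : Y.Cell k := ⟨⟨σ, Y.isSimplex σ (hfaces σ h).1⟩, hfaces σ h⟩
      obtain ⟨w, hw⟩ := exists_fixedSystemVal_eq τ.1
        ((mem_fixedValues_of_mem (hfaces σ h).1).mp (hb.mem σ))
      exact ⟨DirectSum.lof R (Y.Cell k) (fun σ => (fixedSystem ρ n).obj σ.1) τ w, by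
        rw [chainFun_lof, hw]⟩
  choose c hc using hex
  refine ⟨∑ σ ∈ U.powerset, c σ, ?_⟩
  rw [map_sum]
  simp only [hc]
  ext σ
  rw [Finset.sum_apply, Finset.sum_pi_single]
  split_ifs with h
  · rfl
  · by_contra h0
    exact h (Finset.mem_powerset.mpr (Finset.coe_subset.mp (hb.supp σ (Ne.symm h0)).1))

omit [LinearOrder (Vertex K d)] in
theorem isChainOn_chainFun (Y : Subcomplex K d) (k : ℕ) (U : Finset (Vertex K d))
    (c : (fixedSystem ρ n).Chain Y k) (hU : ∀ σ, chainFun ρ n Y k c σ ≠ 0 → σ ⊆ U) :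
    IsChainOn (fixedValues ρ n Y) U (k + 1) (chainFun ρ n Y k c) := by
  have hf : ∀ σ, chainFun ρ n Y k c σ ≠ 0 → σ ∈ Y.faces ∧ σ.card = k + 1 := fun σ hσ => by
    by_contra h
    exact hσ (chainFun_of_not Y k c h)
  refine ⟨fun σ => ?_, fun σ hσ => ⟨Finset.coe_subset.mpr (hU σ hσ), (hf σ hσ).2⟩⟩
  by_cases h0 : chainFun ρ n Y k c σ = 0
  · rw [h0]; exact zero_mem _
  · obtain ⟨τ, rfl⟩ : ∃ τ : Y.Cell k, σ = τ.1.1 :=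
      ⟨⟨⟨σ, Y.isSimplex σ (hf σ h0).1⟩, hf σ h0⟩, rfl⟩
    rw [mem_fixedValues_of_mem τ.2.1, chainFun_apply]
    exact fixedSystemVal_mem _ _

/-- Acyclicity of the system of fixed vectors follows from the vanishing of homology for chains
with vertices in arbitrarily large finite sets. -/
theorem isAcyclicOn_of_exists_boundary_eq (Y : Subcomplex K d)
    (h : ∀ S : Finset (Vertex K d), ∃ U : Finset (Vertex K d), S ⊆ U ∧ ∀ k : ℕ, 1 < k →
      ∀ c, IsChainOn (fixedValues ρ n Y) U k c → boundary R U c = 0 →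
      ∃ b, IsChainOn (fixedValues ρ n Y) U (k + 1) b ∧ boundary R U b = c) :
    (fixedSystem ρ n).IsAcyclicOn Y := by
  classical
  have hsupp : ∀ (k : ℕ) (c : (fixedSystem ρ n).Chain Y k),
      ∃ S : Finset (Vertex K d), ∀ σ, chainFun ρ n Y k c σ ≠ 0 → σ ⊆ S := by
    intro k c
    refine ⟨(DFinsupp.support c).biUnion fun τ => τ.1.1, fun σ hσ => ?_⟩
    have hσ' : σ ∈ Y.faces ∧ σ.card = k + 1 := by
      by_contra h'
      exact hσ (chainFun_of_not Y k c h')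
    let τ : Y.Cell k := ⟨⟨σ, Y.isSimplex σ hσ'.1⟩, hσ'⟩
    refine Finset.subset_biUnion_of_mem (fun τ : Y.Cell k => τ.1.1) (x := τ) ?_
    rw [DFinsupp.mem_support_iff]
    intro h0
    apply hσ
    exact (chainFun_apply Y k c τ).trans (by rw [h0, map_zero])
  intro k c
  constructor
  · intro hc
    obtain ⟨S, hS⟩ := hsupp _ c
    obtain ⟨U, hSU, hU⟩ := h S
    have hcU := fun σ hσ => (hS σ hσ).trans hSU
    have hch := isChainOn_chainFun Y (k + 1) U c hcU
    -- Here simplices are counted by vertices: degree `k + 1` means `k + 2` vertices, so positive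
    -- degree becomes `1 <` the number of vertices.
    obtain ⟨b, hb, hbc⟩ := hU _ (by omega) _ hch
      (by rw [← chainFun_differential Y k U c hcU, hc, map_zero])
    obtain ⟨b', hb'⟩ := exists_chainFun_eq Y (k + 1 + 1) U hb
    refine ⟨b', chainFun_injective Y _ ?_⟩
    rw [chainFun_differential Y (k + 1) U b', hb', hbc]
    rw [hb']
    exact fun σ hσ => Finset.coe_subset.mp (hb.supp σ hσ).1
  · rintro ⟨b, rfl⟩
    obtain ⟨S, hS⟩ := hsupp _ b
    obtain ⟨S', hS'⟩ := hsupp _ ((fixedSystem ρ n).differential Y (k + 1) b)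
    apply chainFun_injective
    rw [chainFun_differential Y k (S ∪ S') _ fun σ hσ => (hS' σ hσ).trans Finset.subset_union_right,
      chainFun_differential Y (k + 1) (S ∪ S') _
        fun σ hσ => (hS σ hσ).trans Finset.subset_union_left, boundary_boundary, map_zero]

end Transfer

/-! ### Common adapted bases of subspaces -/

section AdaptedSets

variable {k E : Type*} [Field k] [AddCommGroup E] [Module k E]

/-- A finite chain of subspaces has a common adapted basis. -/
theorem exists_linearIndepOn_adapted_chain (C : Finset (Submodule k E))
    (hC : IsChain (· ≤ ·) (C : Set (Submodule k E))) :
    ∃ B : Set E, LinearIndepOn k id B ∧ ∀ N ∈ C, N ≤ Submodule.span k (B ∩ N) := by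
  classical
  induction C using Finset.strongInduction with
  | H C ih =>
  rcases C.eq_empty_or_nonempty with rfl | hne
  · exact ⟨∅, linearIndepOn_empty _ _, by simp⟩
  obtain ⟨T, hT, hmax⟩ := C.exists_maximal hne
  have hle : ∀ N ∈ C, N ≤ T := fun N hN => (hC.total hN hT).elim id (hmax hN)
  obtain ⟨B, hB, hB'⟩ := ih (C.erase T) (Finset.erase_ssubset hT)
    (hC.mono (Finset.coe_subset.mpr (Finset.erase_subset _ _)))
  -- The remaining members of the chain lie in `T`, so vectors of `B` outside `T` are dispensable;
  -- what is left extends to a basis of `T`.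
  have hBT : LinearIndepOn k id (B ∩ T) := hB.mono Set.inter_subset_left
  have hsub : B ∩ T ⊆ (T : Set E) := Set.inter_subset_right
  refine ⟨hBT.extend hsub, hBT.linearIndepOn_extend hsub, fun N hN => ?_⟩
  by_cases hNT : N = T
  · subst hNT
    rw [Set.inter_eq_left.mpr (hBT.extend_subset hsub)]
    exact hBT.subset_span_extend hsub
  · refine (hB' N (Finset.mem_erase.mpr ⟨hNT, hN⟩)).trans (Submodule.span_mono ?_)
    exact fun v hv => ⟨hBT.subset_extend hsub ⟨hv.1, hle N hN hv.2⟩, hv.2⟩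

/-- Two subspaces have a common adapted basis. -/
theorem exists_linearIndepOn_adapted_pair (N N' : Submodule k E) :
    ∃ B : Set E, LinearIndepOn k id B ∧
      N ≤ Submodule.span k (B ∩ N) ∧ N' ≤ Submodule.span k (B ∩ N') := by
  classical
  -- A basis adapted to N ∩ N' ≤ N is extended by vectors of `N'` alone.
  obtain ⟨B, hB, hB'⟩ := exists_linearIndepOn_adapted_chain {N ⊓ N', N} (by
    rw [Finset.coe_pair]
    exact IsChain.pair inf_le_left)
  have h1 := hB' (N ⊓ N') (by simp)
  have h2 := hB' N (by simp)
  have hBN : LinearIndepOn k id (B ∩ N) := hB.mono Set.inter_subset_left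
  have hsub : B ∩ N ⊆ (B ∩ N) ∪ N' := Set.subset_union_left
  set B' := hBN.extend hsub
  have hBB' : B ∩ N ⊆ B' := hBN.subset_extend hsub
  refine ⟨B', hBN.linearIndepOn_extend hsub,
    h2.trans (Submodule.span_mono fun v hv => ⟨hBB' hv, hv.2⟩), fun v hv => ?_⟩
  have h3 : v ∈ Submodule.span k B' := hBN.subset_span_extend hsub (Or.inr hv)
  have h4 : B' ⊆ (B ∩ N) ∪ (B' ∩ N') := fun w hw =>
    (hBN.extend_subset hsub hw).imp id fun h => ⟨hw, h⟩
  have h5 := Submodule.span_mono h4 h3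
  rw [Submodule.span_union] at h5
  obtain ⟨a, ha, b, hb, rfl⟩ := Submodule.mem_sup.mp h5
  have haN : a ∈ N := (Submodule.span_le.mpr Set.inter_subset_right : Submodule.span k (B ∩ N) ≤ N) ha
  have hbN : b ∈ N' := (Submodule.span_le.mpr Set.inter_subset_right :
    Submodule.span k (B' ∩ N') ≤ N') hb
  -- The component of v along the vectors of `N` lies in N ∩ N', where the first basis is already
  -- adapted.
  have haN' : a ∈ N' := by simpa using sub_mem hv hbN
  refine add_mem ?_ hb
  refine Submodule.span_mono ?_ (h1 ⟨haN, haN'⟩)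
  exact fun w hw => ⟨hBB' ⟨hw.1, hw.2.1⟩, hw.2.2⟩

end AdaptedSets

/-! ### Lattices and powers of a uniformizer -/

section Lattices

variable {K : Type*} [Field K] [ValuativeRel K] {d : ℕ}

theorem mem_units_smul {E : Type*} [AddCommGroup E] [Module K E] (a : Kˣ) (M : Submodule 𝒪[K] E)
    (v : E) : v ∈ a • M ↔ a⁻¹ • v ∈ M := by
  rw [Units.smul_def, Submodule.mem_smul_pointwise_iff_exists]
  constructor
  · rintro ⟨w, hw, rfl⟩
    rwa [← Units.smul_def, inv_smul_smul]
  · exact fun h => ⟨_, h, smul_inv_smul a v⟩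

theorem units_smul_le_iff {E : Type*} [AddCommGroup E] [Module K E] (a : Kˣ)
    (M N : Submodule 𝒪[K] E) : a • M ≤ N ↔ M ≤ a⁻¹ • N := by
  refine ⟨fun h v hv => ?_, fun h v hv => ?_⟩
  · rw [mem_units_smul, inv_inv]
    exact h (by rwa [mem_units_smul, inv_smul_smul])
  · rw [mem_units_smul] at hv
    have := h hv
    rwa [mem_units_smul, inv_inv, smul_inv_smul] at this

theorem units_smul_mono {E : Type*} [AddCommGroup E] [Module K E] (a : Kˣ)
    {M N : Submodule 𝒪[K] E} (h : M ≤ N) : a • M ≤ a • N := by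
  rw [units_smul_le_iff, inv_smul_smul]; exact h

/-- `π` is a uniformizer, as an element of `Kˣ`. -/
def IsUniformizer (π : Kˣ) : Prop := ∃ ϖ : 𝒪[K], Irreducible ϖ ∧ (ϖ : K) = π

section Uniformizer

variable {π : Kˣ} (hπ : IsUniformizer π) {E : Type*} [AddCommGroup E] [Module K E]
include hπ

theorem IsUniformizer.smul_le (M : Submodule 𝒪[K] E) : π • M ≤ M := by
  obtain ⟨ϖ, -, h⟩ := hπ
  intro v hv
  obtain ⟨w, hw, rfl⟩ := (Submodule.mem_smul_pointwise_iff_exists _ _ _).mp hv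
  have : π • w = ϖ • w := by
    rw [Units.smul_def, ← h]; rfl
  rw [this]
  exact M.smul_mem _ hw

theorem IsUniformizer.pow_smul_le (M : Submodule 𝒪[K] E) (k : ℕ) : π ^ k • M ≤ M := by
  induction k with
  | zero => rw [pow_zero, one_smul]
  | succ k ih => rw [pow_succ', mul_smul]; exact (hπ.smul_le _).trans ih

theorem IsUniformizer.zpow_smul_le (M : Submodule 𝒪[K] E) {j k : ℤ} (h : j ≤ k) :
    π ^ k • M ≤ π ^ j • M := by
  obtain ⟨m, rfl⟩ := Int.le.dest h
  rw [zpow_add, mul_smul, zpow_natCast]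
  exact units_smul_mono _ (hπ.pow_smul_le M m)

theorem IsUniformizer.pow_smul_anti (M : Submodule 𝒪[K] E) {j k : ℕ} (h : j ≤ k) :
    π ^ k • M ≤ π ^ j • M := by
  simpa using hπ.zpow_smul_le M (Int.ofNat_le.mpr h)

end Uniformizer

variable [TopologicalSpace K] [IsNonarchimedeanLocalField K] {π : Kˣ} (hπ : IsUniformizer π)

section
include hπ

theorem IsUniformizer.exists_eq_mul_pow {x : 𝒪[K]} (hx : x ≠ 0) :
    ∃ (u : 𝒪[K]ˣ) (k : ℕ), (x : K) = ((u : 𝒪[K]) : K) * (π : K) ^ k := by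
  obtain ⟨ϖ, hϖ, h⟩ := hπ
  obtain ⟨k, u, hu⟩ := IsDiscreteValuationRing.eq_unit_mul_pow_irreducible hx hϖ
  refine ⟨u, k, ?_⟩
  rw [hu, ← h]
  rfl

theorem IsUniformizer.exists_zpow_mul_mem (c : K) : ∃ k : ℕ, ∃ a : 𝒪[K], (a : K) = π ^ k * c := by
  obtain ⟨x, y, hy, rfl⟩ := IsFractionRing.div_surjective (A := 𝒪[K]) c
  have hy0 : y ≠ 0 := nonZeroDivisors.ne_zero hy
  obtain ⟨u, k, hu⟩ := hπ.exists_eq_mul_pow hy0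
  refine ⟨k, x * (u⁻¹ : 𝒪[K]ˣ), ?_⟩
  have hyK : algebraMap 𝒪[K] K y = (y : K) := rfl
  have hxK : algebraMap 𝒪[K] K x = (x : K) := rfl
  have huu : ((u : 𝒪[K]) : K) * (((u⁻¹ : 𝒪[K]ˣ) : 𝒪[K]) : K) = 1 := by
    exact_mod_cast congrArg (Subtype.val) (Units.mul_inv u)
  have hy1 : (y : K) ≠ 0 := fun h => hy0 (Subtype.ext h)
  rw [hyK, hxK]
  have hπ0 : (π : K) ≠ 0 := π.ne_zero
  have hu0 : ((u : 𝒪[K]) : K) ≠ 0 := left_ne_zero_of_mul_eq_one huu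
  rw [hu]
  push_cast
  field_simp
  rw [mul_assoc, mul_comm (((u⁻¹ : 𝒪[K]ˣ) : 𝒪[K]) : K), huu, mul_one]

theorem IsUniformizer.exists_eq_mul_zpow (c : Kˣ) :
    ∃ (u : 𝒪[K]ˣ) (k : ℤ), (c : K) = ((u : 𝒪[K]) : K) * (π ^ k : Kˣ) := by
  obtain ⟨k, a, ha⟩ := hπ.exists_zpow_mul_mem c
  have ha0 : a ≠ 0 := by
    rintro rfl
    have : (π : K) ^ k * c ≠ 0 := mul_ne_zero (pow_ne_zero _ π.ne_zero) c.ne_zero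
    exact this ha.symm
  obtain ⟨u, j, hu⟩ := hπ.exists_eq_mul_pow ha0
  refine ⟨u, j - k, ?_⟩
  have hπ0 : (π : K) ≠ 0 := π.ne_zero
  rw [ha] at hu
  rw [Units.val_zpow_eq_zpow_val, zpow_sub₀ hπ0, zpow_natCast, zpow_natCast]
  field_simp
  rw [mul_comm, hu]

/-- Units of the valuation ring preserve every submodule, so only the valuation of `c` matters. -/
theorem IsUniformizer.exists_smul_eq {E : Type*} [AddCommGroup E] [Module K E] (c : Kˣ)
    (M : Submodule 𝒪[K] E) : ∃ k : ℤ, c • M = π ^ k • M := by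
  obtain ⟨u, k, h⟩ := hπ.exists_eq_mul_zpow c
  refine ⟨k, ?_⟩
  have key : ∀ (u : 𝒪[K]ˣ) (a b : Kˣ), (a : K) = ((u : 𝒪[K]) : K) * b → a • M ≤ b • M := by
    intro u a b hab v hv
    obtain ⟨w, hw, rfl⟩ := (Submodule.mem_smul_pointwise_iff_exists _ _ _).mp hv
    have : a • w = b • (u : 𝒪[K]) • w := by
      rw [Units.smul_def, hab, mul_comm, mul_smul]; rfl
    rw [this]
    exact Submodule.smul_mem_pointwise_smul _ _ _ (M.smul_mem (u : 𝒪[K]) hw)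
  refine le_antisymm (key u _ _ h) (key u⁻¹ _ _ ?_)
  have huu : ((u : 𝒪[K]) : K) * (((u⁻¹ : 𝒪[K]ˣ) : 𝒪[K]) : K) = 1 := by
    exact_mod_cast congrArg (Subtype.val) (Units.mul_inv u)
  rw [h, ← mul_assoc, mul_comm (((u⁻¹ : 𝒪[K]ˣ) : 𝒪[K]) : K), huu, one_mul]

theorem IsUniformizer.maximalIdeal_smul {E : Type*} [AddCommGroup E] [Module K E]
    (M : Submodule 𝒪[K] E) : 𝓂[K] • M = π • M := by
  obtain ⟨ϖ, hϖ, h⟩ := hπ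
  rw [hϖ.maximalIdeal_eq, Submodule.ideal_span_singleton_smul]
  ext v
  simp only [Submodule.mem_smul_pointwise_iff_exists]
  rw [Units.smul_def, Submodule.mem_smul_pointwise_iff_exists, ← h]
  exact Iff.rfl

theorem IsUniformizer.exists_pow_smul_le {E : Type*} [AddCommGroup E] [Module K E]
    {M N : Submodule 𝒪[K] E} (hM : M.FG) (hN : Submodule.span K (N : Set E) = ⊤) :
    ∃ k : ℕ, π ^ k • M ≤ N := by
  have hpt : ∀ v : E, ∃ k : ℕ, π ^ k • v ∈ N := by
    intro v
    have hv : v ∈ Submodule.span K (N : Set E) := by rw [hN]; trivial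
    have hmono : ∀ {w : E} {j k : ℕ}, j ≤ k → π ^ j • w ∈ N → π ^ k • w ∈ N := by
      intro w j k hjk hw
      obtain ⟨m, rfl⟩ := Nat.exists_eq_add_of_le' hjk
      rw [pow_add, mul_smul]
      exact hπ.pow_smul_le N m (Submodule.smul_mem_pointwise_smul _ _ _ hw)
    induction hv using Submodule.span_induction with
    | mem v hv => exact ⟨0, by simpa using hv⟩
    | zero => exact ⟨0, by simp⟩
    | add v w _ _ hv hw =>
      obtain ⟨j, hj⟩ := hv
      obtain ⟨k, hk⟩ := hw
      exact ⟨max j k, by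
        rw [smul_add]; exact add_mem (hmono (le_max_left _ _) hj) (hmono (le_max_right _ _) hk)⟩
    | smul c v _ hv =>
      obtain ⟨j, hj⟩ := hv
      obtain ⟨k, a, ha⟩ := hπ.exists_zpow_mul_mem c
      refine ⟨k + j, ?_⟩
      have : π ^ (k + j) • c • v = a • π ^ j • v := by
        change _ = (a : K) • π ^ j • v
        rw [ha]
        simp only [Units.smul_def, smul_smul, Units.val_pow_eq_pow_val]
        congr 1
        ring
      rw [this]
      exact N.smul_mem _ hj
  obtain ⟨S, rfl⟩ := hM
  choose k hk using hpt
  refine ⟨S.sup k, ?_⟩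
  rw [units_smul_le_iff, Submodule.span_le]
  intro v hv
  rw [SetLike.mem_coe, mem_units_smul, inv_inv]
  obtain ⟨m, hm⟩ := Nat.exists_eq_add_of_le' (Finset.le_sup (f := k) hv)
  rw [hm, pow_add, mul_smul]
  exact hπ.pow_smul_le N m (Submodule.smul_mem_pointwise_smul _ _ _ (hk v))

/-- A lattice is not contained in a proper multiple of itself by a power of the uniformizer. -/
theorem IsUniformizer.nonneg_of_zpow_smul_le {M : Submodule 𝒪[K] (Fin (d + 1) → K)}
    (hM : Submodule.IsLattice K M) {k : ℤ} (h : π ^ k • M ≤ M) : 0 ≤ k := by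
  by_contra hk
  have h1 : M ≤ π • M := by
    have h2 : π ^ (-1 : ℤ) • M ≤ π ^ k • M := hπ.zpow_smul_le M (by omega)
    have h3 := h2.trans h
    rw [units_smul_le_iff] at h3
    simpa using h3
  have h4 : M ≤ (⊥ : Submodule 𝒪[K] (Fin (d + 1) → K)) := by
    refine Submodule.le_of_le_smul_of_le_jacobson_bot (I := 𝓂[K]) hM.fg
      (IsLocalRing.maximalIdeal_le_jacobson ⊥) ?_
    rw [bot_sup_eq, hπ.maximalIdeal_smul]
    exact h1
  have h5 := hM.span_eq_top
  rw [le_bot_iff.mp h4] at h5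
  simp at h5

omit hπ in
theorem isLattice_of_le {A M B : Submodule 𝒪[K] (Fin (d + 1) → K)}
    (hA : Submodule.IsLattice K A) (hB : Submodule.IsLattice K B) (h : A ≤ M) (h' : M ≤ B) :
    Submodule.IsLattice K M := by
  refine ⟨?_, ?_⟩
  · have := isNoetherian_of_fg_of_noetherian _ hB.fg
    have : IsNoetherian 𝒪[K] M := isNoetherian_of_le h'
    exact (isNoetherian_submodule.mp this) M le_rfl
  · rw [eq_top_iff, ← hA.span_eq_top]
    exact Submodule.span_mono h

/-- The quotient of a lattice by a multiple of itself is finite. -/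
theorem IsUniformizer.finite_quotient {B : Submodule 𝒪[K] (Fin (d + 1) → K)}
    (hB : Submodule.IsLattice K B) {A : Submodule 𝒪[K] (Fin (d + 1) → K)} {k : ℕ}
    (h : π ^ k • B ≤ A) : Finite (B ⧸ A.comap B.subtype) := by
  have : Module.Finite 𝒪[K] B := Module.Finite.iff_fg.mpr hB.fg
  have : Finite (𝒪[K] ⧸ 𝓂[K]) := (inferInstance : Finite 𝓀[K])
  have : Finite (𝒪[K] ⧸ 𝓂[K] ^ k) := Ideal.finite_quotient_pow (IsNoetherian.noetherian _) k
  have : Finite (B ⧸ (𝓂[K] ^ k • ⊤ : Submodule 𝒪[K] B)) :=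
    Module.finite_of_finite (𝒪[K] ⧸ 𝓂[K] ^ k)
  have hle : (𝓂[K] ^ k • ⊤ : Submodule 𝒪[K] B) ≤ A.comap B.subtype := by
    rw [← Submodule.map_le_iff_le_comap, Submodule.map_smul'', Submodule.map_top,
      Submodule.range_subtype]
    refine le_trans (le_of_eq ?_) h
    clear h this
    induction k with
    | zero => simp
    | succ k ih =>
      rw [pow_succ', pow_succ', Submodule.mul_smul,
        ih (Ideal.finite_quotient_pow (IsNoetherian.noetherian _) k), hπ.maximalIdeal_smul,
        mul_smul]
  exact Finite.of_surjective _ (Submodule.factor_surjective hle)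

/-- A lattice between `A` and `B` is determined by its image in B/A, which is finite because `A`
contains some π^k B and the residue field is finite. -/
theorem IsUniformizer.finite_Icc {A B : Submodule 𝒪[K] (Fin (d + 1) → K)}
    (hA : Submodule.IsLattice K A) (hB : Submodule.IsLattice K B) :
    (Set.Icc A B).Finite := by
  obtain ⟨k, hk⟩ := hπ.exists_pow_smul_le hB.fg hA.span_eq_top
  have := hπ.finite_quotient hB hk
  refine Set.Finite.of_injOn (f := fun N => (A.comap B.subtype).mkQ '' (N.comap B.subtype : Set B))
    (t := Set.univ) (fun _ _ => trivial) ?_ Set.finite_univ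
  have key : ∀ N ∈ Set.Icc A B, ∀ N' ∈ Set.Icc A B,
      (A.comap B.subtype).mkQ '' (N.comap B.subtype : Set B) =
        (A.comap B.subtype).mkQ '' (N'.comap B.subtype : Set B) → N ≤ N' := by
    intro N hN N' hN' h v hv
    have h1 : (A.comap B.subtype).mkQ ⟨v, hN.2 hv⟩ ∈
        (A.comap B.subtype).mkQ '' (N.comap B.subtype : Set B) := ⟨_, hv, rfl⟩
    rw [h] at h1
    obtain ⟨w, hw, hwv⟩ := h1
    rw [← sub_eq_zero, ← map_sub, ← LinearMap.mem_ker, Submodule.ker_mkQ] at hwv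
    have h2 : (w : Fin (d + 1) → K) - v ∈ N' := hN'.1 hwv
    have h3 : (w : Fin (d + 1) → K) ∈ N' := hw
    simpa using sub_mem h3 h2
  exact fun N hN N' hN' h => le_antisymm (key N hN N' hN' h) (key N' hN' N hN h.symm)

end

end Lattices

/-! ### Normalized lattices and the order on vertices -/

section NormalizedLattices

variable {K : Type*} [Field K] [ValuativeRel K] [TopologicalSpace K]
  [IsNonarchimedeanLocalField K] {d : ℕ} {π : Kˣ} (hπ : IsUniformizer π)

/-- A lattice is normalized if it is contained in the standard lattice `L`, but not in `π L`. -/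
def IsNormalized (π : Kˣ) (M : Submodule 𝒪[K] (Fin (d + 1) → K)) : Prop :=
  M ≤ (standardLattice K d).1 ∧ ¬ M ≤ π • (standardLattice K d).1

omit [TopologicalSpace K] [IsNonarchimedeanLocalField K] in
theorem IsNormalized.of_le {M N : Submodule 𝒪[K] (Fin (d + 1) → K)} (hM : IsNormalized π M)
    (h : M ≤ N) (hN : N ≤ (standardLattice K d).1) : IsNormalized π N :=
  ⟨hN, fun h' => hM.2 (h.trans h')⟩

omit [TopologicalSpace K] [IsNonarchimedeanLocalField K] in
theorem toVertex_eq_iff {M N : Lattice K d} :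
    M.toVertex = N.toVertex ↔ ∃ c : Kˣ, N.1 = c • M.1 :=
  Quotient.eq (r := homothety K d)

include hπ

theorem IsUniformizer.toVertex_eq_iff {M N : Lattice K d} :
    M.toVertex = N.toVertex ↔ ∃ k : ℤ, N.1 = π ^ k • M.1 := by
  rw [BruhatTits.toVertex_eq_iff]
  constructor
  · rintro ⟨c, hc⟩
    obtain ⟨k, hk⟩ := hπ.exists_smul_eq c M.1
    exact ⟨k, hc.trans hk⟩
  · rintro ⟨k, hk⟩
    exact ⟨_, hk⟩

omit [TopologicalSpace K] [IsNonarchimedeanLocalField K] in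
theorem IsUniformizer.isNormalized_unique {M : Submodule 𝒪[K] (Fin (d + 1) → K)} {k : ℤ}
    (hM : IsNormalized π M) (hk : IsNormalized π (π ^ k • M)) : k = 0 := by
  rcases lt_trichotomy k 0 with h | h | h
  · refine (hM.2 ?_).elim
    have h1 := units_smul_mono (π ^ (-k)) hk.1
    rw [smul_smul, ← zpow_add, neg_add_cancel, zpow_zero, one_smul] at h1
    refine h1.trans ?_
    simpa using hπ.zpow_smul_le (standardLattice K d).1 (show 1 ≤ -k by omega)
  · exact h
  · refine (hk.2 ?_).elim
    have h1 := hπ.zpow_smul_le M (show 1 ≤ k by omega)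
    rw [zpow_one] at h1
    exact h1.trans (units_smul_mono _ hM.1)

/-- The exponents that move `M` into the standard lattice are bounded below, because `M` contains a
multiple of that lattice. The least such exponent normalizes `M`. -/
theorem IsUniformizer.exists_isNormalized (M : Lattice K d) : ∃ k : ℤ, IsNormalized π (π ^ k • M.1) := by
  obtain ⟨a, ha⟩ := hπ.exists_pow_smul_le M.2.fg (standardLattice K d).2.span_eq_top
  obtain ⟨b, hb⟩ := hπ.exists_pow_smul_le (standardLattice K d).2.fg M.2.span_eq_top
  obtain ⟨k, hk, hmin⟩ := Int.exists_least_of_bdd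
    (P := fun k : ℤ => π ^ k • M.1 ≤ (standardLattice K d).1) ⟨-b, fun k hk => by
      have h1 := units_smul_mono (π ^ k) hb
      rw [← zpow_natCast, smul_smul, ← zpow_add] at h1
      have := hπ.nonneg_of_zpow_smul_le (standardLattice K d).2 (h1.trans hk)
      omega⟩ ⟨a, by simpa using ha⟩
  refine ⟨k, hk, fun h => ?_⟩
  have h1 := hmin (k - 1) (by
    rwa [zpow_sub_one, mul_comm, mul_smul, units_smul_le_iff, inv_inv])
  omega

theorem IsUniformizer.exists_toVertex_eq (s : Vertex K d) :
    ∃ M : Lattice K d, M.toVertex = s ∧ IsNormalized π M.1 := by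
  obtain ⟨M, rfl⟩ := Quotient.exists_rep s
  obtain ⟨k, hk⟩ := hπ.exists_isNormalized M
  refine ⟨⟨π ^ k • M.1, ?_⟩, ?_, hk⟩
  · have := M.2
    exact Submodule.IsLattice.smul K M.1 (π ^ k)
  · exact (hπ.toVertex_eq_iff.mpr ⟨k, rfl⟩ :
      M.toVertex = Lattice.toVertex ⟨π ^ k • M.1, _⟩).symm

omit hπ in
/-- The normalized lattice in a homothety class. -/
def normalizedLattice (hπ : IsUniformizer π) (s : Vertex K d) :
    Submodule 𝒪[K] (Fin (d + 1) → K) :=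
  (hπ.exists_toVertex_eq s).choose.1

omit hπ in
theorem isLattice_normalizedLattice (hπ : IsUniformizer π) (s : Vertex K d) :
    Submodule.IsLattice K (normalizedLattice hπ s) :=
  (hπ.exists_toVertex_eq s).choose.2

omit hπ in
theorem toVertex_normalizedLattice (hπ : IsUniformizer π) (s : Vertex K d) :
    Lattice.toVertex ⟨normalizedLattice hπ s, isLattice_normalizedLattice hπ s⟩ = s :=
  (hπ.exists_toVertex_eq s).choose_spec.1

omit hπ in
theorem isNormalized_normalizedLattice (hπ : IsUniformizer π) (s : Vertex K d) :
    IsNormalized π (normalizedLattice hπ s) :=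
  (hπ.exists_toVertex_eq s).choose_spec.2

omit hπ in
theorem exists_zpow_normalizedLattice (hπ : IsUniformizer π) (M : Lattice K d) :
    ∃ k : ℤ, normalizedLattice hπ M.toVertex = π ^ k • M.1 :=
  hπ.toVertex_eq_iff.mp (toVertex_normalizedLattice hπ M.toVertex).symm

omit hπ in
theorem normalizedLattice_toVertex (hπ : IsUniformizer π) {M : Lattice K d}
    (hM : IsNormalized π M.1) : normalizedLattice hπ M.toVertex = M.1 := by
  obtain ⟨k, hk⟩ := exists_zpow_normalizedLattice hπ M
  have := isNormalized_normalizedLattice hπ M.toVertex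
  rw [hk] at this
  rw [hk, hπ.isNormalized_unique hM this, zpow_zero, one_smul]

omit hπ in
theorem normalizedLattice_injective (hπ : IsUniformizer π) :
    Function.Injective (normalizedLattice (d := d) hπ) := by
  intro s t h
  rw [← toVertex_normalizedLattice hπ s, ← toVertex_normalizedLattice hπ t]
  congr 1
  exact Subtype.ext h

omit hπ in
/-- The normalized lattices of two vertices of a simplex are contained in one another, with index
a proper power of the residue cardinality. -/
theorem IsSimplex.normalizedLattice_le_or_le (hπ : IsUniformizer π) {σ : Finset (Vertex K d)}
    (hσ : IsSimplex σ) {s t : Vertex K d} (hs : s ∈ σ) (ht : t ∈ σ) :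
    (normalizedLattice hπ s ≤ normalizedLattice hπ t ∧
      π • normalizedLattice hπ t ≤ normalizedLattice hπ s) ∨
    (normalizedLattice hπ t ≤ normalizedLattice hπ s ∧
      π • normalizedLattice hπ s ≤ normalizedLattice hπ t) := by
  obtain ⟨k, M, hM, hlast, hrange⟩ := hσ
  rw [hπ.maximalIdeal_smul] at hlast
  have key : ∀ i j, i ≤ j → ∀ a b : ℤ, IsNormalized π (π ^ a • (M i).1) →
      IsNormalized π (π ^ b • (M j).1) →
      (π ^ a • (M i).1 ≤ π ^ b • (M j).1 ∧ π • π ^ b • (M j).1 ≤ π ^ a • (M i).1) ∨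
      (π ^ b • (M j).1 ≤ π ^ a • (M i).1 ∧ π • π ^ a • (M i).1 ≤ π ^ b • (M j).1) := by
    intro i j hij a b ha hb
    have h1 : (M i).1 ≤ (M j).1 := hM.monotone hij
    have h2 : π • (M j).1 ≤ (M i).1 :=
      (units_smul_mono π (hM.monotone (Fin.le_last j))).trans
        (hlast.le.trans (hM.monotone (Fin.zero_le i)))
    -- For M_i ≤ M_j in the chain the normalizing exponents satisfy a ≤ b ≤ a + 1. The inclusion is
    -- kept if b = a and is reversed if b = a + 1.
    have hab : a ≤ b := by
      by_contra h
      apply ha.2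
      calc π ^ a • (M i).1 ≤ π ^ (1 + b) • (M i).1 := hπ.zpow_smul_le _ (by omega)
        _ = π • π ^ b • (M i).1 := by rw [zpow_add, zpow_one, mul_smul]
        _ ≤ π • π ^ b • (M j).1 := units_smul_mono _ (units_smul_mono _ h1)
        _ ≤ _ := units_smul_mono _ hb.1
    have hba : b ≤ a + 1 := by
      by_contra h
      apply hb.2
      calc π ^ b • (M j).1 ≤ π ^ (1 + a + 1) • (M j).1 := hπ.zpow_smul_le _ (by omega)
        _ = π • π ^ a • π • (M j).1 := by rw [zpow_add, zpow_add, zpow_one, mul_smul, mul_smul]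
        _ ≤ π • π ^ a • (M i).1 := units_smul_mono _ (units_smul_mono _ h2)
        _ ≤ _ := units_smul_mono _ ha.1
    rcases hab.eq_or_lt with rfl | hlt
    · left
      refine ⟨units_smul_mono _ h1, ?_⟩
      rw [smul_comm]
      exact units_smul_mono _ h2
    · obtain rfl : b = a + 1 := by omega
      right
      rw [zpow_add, zpow_one, mul_smul, smul_comm π (π ^ a)]
      exact ⟨units_smul_mono _ h2, units_smul_mono _ (units_smul_mono _ h1)⟩
  rw [← Finset.mem_coe, hrange] at hs ht
  obtain ⟨i, rfl⟩ := hs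
  obtain ⟨j, rfl⟩ := ht
  obtain ⟨a, ha⟩ := exists_zpow_normalizedLattice hπ (M i)
  obtain ⟨b, hb⟩ := exists_zpow_normalizedLattice hπ (M j)
  have ha' := isNormalized_normalizedLattice hπ (M i).toVertex
  have hb' := isNormalized_normalizedLattice hπ (M j).toVertex
  simp only [ha, hb] at ha' hb' ⊢
  rcases le_total i j with hij | hij
  · exact key i j hij a b ha' hb'
  · exact (key j i hij b a hb' ha').symm

omit hπ in
theorem smul_normalizedLattice_ne (hπ : IsUniformizer π) (s t : Vertex K d) :
    π • normalizedLattice hπ s ≠ normalizedLattice hπ t := by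
  intro h
  have := (isNormalized_normalizedLattice hπ t).2
  rw [← h] at this
  exact this (units_smul_mono _ (isNormalized_normalizedLattice hπ s).1)

omit hπ in
/-- Every finite set of vertices is contained in a finite set that is closed under passing to
larger normalized lattices. -/
theorem exists_finset_upperClosed (hπ : IsUniformizer π) (S : Finset (Vertex K d)) :
    ∃ U : Finset (Vertex K d), S ⊆ U ∧
      ∀ s ∈ U, ∀ t, normalizedLattice hπ s ≤ normalizedLattice hπ t → t ∈ U := by
  classical
  have h1 : ∀ s : Vertex K d, ∃ k : ℕ, π ^ k • (standardLattice K d).1 ≤ normalizedLattice hπ s :=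
    fun s => hπ.exists_pow_smul_le (standardLattice K d).2.fg
      (isLattice_normalizedLattice hπ s).span_eq_top
  choose k hk using h1
  set a := S.sup k
  have hA : Submodule.IsLattice K (π ^ a • (standardLattice K d).1) := by
    have := (standardLattice K d).2
    exact Submodule.IsLattice.smul K _ (π ^ a)
  -- The closed set consists of all vertices whose normalized lattice contains π^a times the
  -- standard one, with `a` large enough for every vertex of `S`.
  have hfin : {s : Vertex K d | π ^ a • (standardLattice K d).1 ≤ normalizedLattice hπ s}.Finite := by
    refine Set.Finite.of_injOn (f := normalizedLattice hπ) ?_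
      ((normalizedLattice_injective hπ).injOn) (hπ.finite_Icc hA (standardLattice K d).2)
    exact fun s hs => ⟨hs, (isNormalized_normalizedLattice hπ s).1⟩
  refine ⟨hfin.toFinset, fun s hs => ?_, fun s hs t hst => ?_⟩
  · rw [Set.Finite.mem_toFinset]
    exact (hπ.pow_smul_anti _ (Finset.le_sup hs)).trans (hk s)
  · rw [Set.Finite.mem_toFinset] at hs ⊢
    exact le_trans hs hst

end NormalizedLattices

/-! ### Bases of a lattice adapted to intermediate lattices -/

section AdaptedBases

variable {K : Type*} [Field K] [ValuativeRel K] {d : ℕ}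

/-- The basis `f` of the lattice `L` is adapted to the lattice `N` between `π L` and `L`. -/
structure IsAdapted (π : Kˣ) (f : Module.Basis (Fin (d + 1)) K (Fin (d + 1) → K))
    (L N : Submodule 𝒪[K] (Fin (d + 1) → K)) : Prop where
  span_eq : Submodule.span 𝒪[K] (Set.range f) = L
  smul_le : π • L ≤ N
  le : N ≤ L
  le_span : N ≤ Submodule.span 𝒪[K] (Set.range f ∩ N) ⊔ π • L

open Classical in
/-- The coordinates in the apartment of `f` of a lattice to which `f` is adapted. -/
def adaptedCoordinates (f : Module.Basis (Fin (d + 1)) K (Fin (d + 1) → K))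
    (N : Submodule 𝒪[K] (Fin (d + 1) → K)) (i : Fin (d + 1)) : ℤ := if f i ∈ N then 0 else 1

theorem mem_apartmentLattice {ϖ : 𝒪[K]} (f : Module.Basis (Fin (d + 1)) K (Fin (d + 1) → K))
    (α : Fin (d + 1) → ℤ) (v : Fin (d + 1) → K) :
    v ∈ apartmentLattice ϖ f α ↔ ∀ i, ∃ a : 𝒪[K], f.repr v i = a * (ϖ : K) ^ α i := by
  rw [apartmentLattice, Submodule.mem_span_range_iff_exists_fun]
  constructor
  · rintro ⟨c, rfl⟩ i
    refine ⟨c i, ?_⟩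
    have : ∀ j, c j • (ϖ : K) ^ α j • f j = ((c j : K) * (ϖ : K) ^ α j) • f j := fun j => by
      rw [mul_smul]; rfl
    simp_rw [this]
    rw [f.repr_sum_self]
  · intro h
    choose a ha using h
    refine ⟨a, ?_⟩
    conv_rhs => rw [← f.sum_repr v]
    refine Finset.sum_congr rfl fun i _ => ?_
    rw [ha, mul_smul]
    rfl

theorem apartmentLattice_anti {ϖ : 𝒪[K]} (h0 : (ϖ : K) ≠ 0)
    (f : Module.Basis (Fin (d + 1)) K (Fin (d + 1) → K)) {α β : Fin (d + 1) → ℤ} (h : α ≤ β) :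
    apartmentLattice ϖ f β ≤ apartmentLattice ϖ f α := by
  intro v hv
  rw [mem_apartmentLattice] at hv ⊢
  intro i
  obtain ⟨a, ha⟩ := hv i
  obtain ⟨m, hm⟩ := Int.le.dest (h i)
  refine ⟨a * ϖ ^ m, ?_⟩
  rw [ha, ← hm, zpow_add₀ h0, zpow_natCast]
  push_cast
  ring

theorem apartmentLattice_inf {ϖ : 𝒪[K]} (h0 : (ϖ : K) ≠ 0)
    (f : Module.Basis (Fin (d + 1)) K (Fin (d + 1) → K)) (α β : Fin (d + 1) → ℤ) :
    apartmentLattice ϖ f α ⊓ apartmentLattice ϖ f β = apartmentLattice ϖ f (α ⊔ β) := by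
  refine le_antisymm (fun v hv => ?_) (le_inf (apartmentLattice_anti h0 f le_sup_left)
    (apartmentLattice_anti h0 f le_sup_right))
  rw [Submodule.mem_inf, mem_apartmentLattice, mem_apartmentLattice] at hv
  rw [mem_apartmentLattice]
  intro i
  rcases le_total (α i) (β i) with h | h
  · rw [Pi.sup_apply, sup_eq_right.mpr h]; exact hv.2 i
  · rw [Pi.sup_apply, sup_eq_left.mpr h]; exact hv.1 i

theorem apartmentLattice_sup {ϖ : 𝒪[K]} (h0 : (ϖ : K) ≠ 0)
    (f : Module.Basis (Fin (d + 1)) K (Fin (d + 1) → K)) (α β : Fin (d + 1) → ℤ) :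
    apartmentLattice ϖ f α ⊔ apartmentLattice ϖ f β = apartmentLattice ϖ f (α ⊓ β) := by
  refine le_antisymm (sup_le (apartmentLattice_anti h0 f inf_le_left)
    (apartmentLattice_anti h0 f inf_le_right)) ?_
  rw [apartmentLattice, Submodule.span_le]
  rintro _ ⟨i, rfl⟩
  rw [SetLike.mem_coe]
  rcases le_total (α i) (β i) with h | h
  · refine Submodule.mem_sup_left (Submodule.subset_span ⟨i, ?_⟩)
    simp only [Pi.inf_apply, inf_eq_left.mpr h]
  · refine Submodule.mem_sup_right (Submodule.subset_span ⟨i, ?_⟩)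
    simp only [Pi.inf_apply, inf_eq_right.mpr h]

variable {π : Kˣ} {f : Module.Basis (Fin (d + 1)) K (Fin (d + 1) → K)}
  {L N : Submodule 𝒪[K] (Fin (d + 1) → K)}

theorem IsAdapted.eq_apartmentLattice (h : IsAdapted π f L N) {ϖ : 𝒪[K]} (hϖ : (ϖ : K) = π) :
    N = apartmentLattice ϖ f (adaptedCoordinates f N) := by
  have hL : π • L ≤ apartmentLattice ϖ f (adaptedCoordinates f N) := by
    rw [units_smul_le_iff, ← h.span_eq, Submodule.span_le]
    rintro _ ⟨i, rfl⟩
    rw [SetLike.mem_coe, mem_units_smul, inv_inv]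
    by_cases hi : f i ∈ N
    · have : π • f i = ϖ • f i := by rw [Units.smul_def, ← hϖ]; rfl
      rw [this]
      refine Submodule.smul_mem _ _ (Submodule.subset_span ⟨i, ?_⟩)
      simp [adaptedCoordinates, hi]
    · refine Submodule.subset_span ⟨i, ?_⟩
      simp [adaptedCoordinates, hi, hϖ, Units.smul_def]
  refine le_antisymm (h.le_span.trans (sup_le (Submodule.span_le.mpr ?_) hL)) ?_
  · rintro _ ⟨⟨i, rfl⟩, hi⟩
    refine Submodule.subset_span ⟨i, ?_⟩
    simp [adaptedCoordinates, SetLike.mem_coe.mp hi]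
  · rw [apartmentLattice, Submodule.span_le]
    rintro _ ⟨i, rfl⟩
    by_cases hi : f i ∈ N
    · simp [adaptedCoordinates, hi]
    · simp only [adaptedCoordinates, hi, if_false, zpow_one, hϖ]
      apply h.smul_le
      rw [mem_units_smul]
      have : π⁻¹ • (π : K) • f i = f i := by rw [← Units.smul_def, inv_smul_smul]
      rw [this, ← h.span_eq]
      exact Submodule.subset_span ⟨i, rfl⟩

/-- The projection onto the part of an adapted basis that lies in `N`. -/
theorem IsAdapted.exists_idempotent (h : IsAdapted π f L N) :
    ∃ e : (Fin (d + 1) → K) →ₗ[K] (Fin (d + 1) → K), (∀ v, e (e v) = e v) ∧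
      (∀ v ∈ L, e v ∈ N) ∧ ∀ v ∈ N, v - e v ∈ π • L := by
  classical
  set e := f.constr K (fun i => if f i ∈ N then f i else 0) with he
  have hef : ∀ i, e (f i) = if f i ∈ N then f i else 0 := fun i => by
    rw [he, f.constr_basis]
  have hL : ∀ v ∈ L, e v ∈ N := by
    intro v hv
    have : Submodule.span 𝒪[K] (Set.range f) ≤ N.comap (e.restrictScalars 𝒪[K]) := by
      rw [Submodule.span_le]
      rintro _ ⟨i, rfl⟩
      change e (f i) ∈ N
      rw [hef]
      split_ifs with hi
      · exact hi
      · exact zero_mem _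
    rw [h.span_eq] at this
    exact this hv
  refine ⟨e, fun v => ?_, hL, fun v hv => ?_⟩
  · have : e ∘ₗ e = e := f.ext fun i => by
      simp only [LinearMap.comp_apply, hef]
      split_ifs with hi
      · rw [hef, if_pos hi]
      · rw [map_zero]
    exact LinearMap.congr_fun this v
  · have : Submodule.span 𝒪[K] (Set.range f ∩ N) ⊔ π • L ≤
        (π • L).comap (((LinearMap.id : _ →ₗ[K] _) - e).restrictScalars 𝒪[K]) := by
      refine sup_le ?_ fun v hv => ?_
      · rw [Submodule.span_le]
        rintro _ ⟨⟨i, rfl⟩, hi⟩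
        change f i - e (f i) ∈ π • L
        rw [hef, if_pos (SetLike.mem_coe.mp hi), sub_self]
        exact zero_mem _
      · change v - e v ∈ π • L
        rw [mem_units_smul] at hv ⊢
        have h1 : π⁻¹ • e v = e (π⁻¹ • v) := (e.map_smul ((π⁻¹ : Kˣ) : K) v).symm
        rw [smul_sub, h1]
        exact sub_mem hv (h.le (hL _ hv))
    exact this (h.le_span hv)

variable [TopologicalSpace K] [IsNonarchimedeanLocalField K] (hπ : IsUniformizer π)
include hπ

/-- Reduction of a lattice modulo the uniformizer. -/
theorem IsUniformizer.exists_reduction (hL : Submodule.IsLattice K L) :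
    ∃ red : L →ₛₗ[IsLocalRing.residue 𝒪[K]] (Fin (d + 1) → 𝓀[K]), Function.Surjective red ∧
      ∀ v : L, red v = 0 ↔ (v : Fin (d + 1) → K) ∈ π • L := by
  have hfree : Module.Free 𝒪[K] L := inferInstance
  have hfin : Module.Finite 𝒪[K] L := inferInstance
  have hrank : Module.finrank 𝒪[K] L = d + 1 := by
    rw [Submodule.IsLattice.finrank_of_pi K L, Fintype.card_fin]
  let b : Module.Basis (Fin (d + 1)) 𝒪[K] L :=
    (Module.finBasis 𝒪[K] L).reindex (finCongr hrank)
  let red : L →ₛₗ[IsLocalRing.residue 𝒪[K]] (Fin (d + 1) → 𝓀[K]) :=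
    { toFun := fun v i => IsLocalRing.residue 𝒪[K] (b.repr v i)
      map_add' := fun v w => by ext i; simp
      map_smul' := fun c v => by ext i; simp }
  have hred : ∀ v i, red v i = IsLocalRing.residue 𝒪[K] (b.repr v i) := fun _ _ => rfl
  refine ⟨red, fun w => ?_, fun v => ?_⟩
  · choose c hc using fun i => IsLocalRing.residue_surjective (w i)
    refine ⟨∑ i, c i • b i, ?_⟩
    ext i
    rw [hred, b.repr_sum_self, hc]
  · obtain ⟨ϖ, hϖ, hϖπ⟩ := hπ
    have hsm : ∀ w : Fin (d + 1) → K, π • w = ϖ • w := fun w => by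
      rw [Units.smul_def, ← hϖπ]; rfl
    constructor
    · intro h
      have h1 : ∀ i, ∃ c, b.repr v i = ϖ * c := fun i => by
        have h2 : IsLocalRing.residue 𝒪[K] (b.repr v i) = 0 := by rw [← hred, h]; rfl
        rw [IsLocalRing.residue_eq_zero_iff, hϖ.maximalIdeal_eq] at h2
        exact Ideal.mem_span_singleton.mp h2
      choose c hc using h1
      have h3 : v = ϖ • ∑ i, c i • b i := by
        conv_lhs => rw [← b.sum_repr v]
        rw [Finset.smul_sum]
        exact Finset.sum_congr rfl fun i _ => by rw [hc, mul_smul]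
      rw [h3, Submodule.coe_smul, ← hsm, mem_units_smul, inv_smul_smul]
      exact Subtype.property _
    · intro h
      rw [mem_units_smul] at h
      have h1 : v = ϖ • (⟨_, h⟩ : L) := by
        ext1
        rw [Submodule.coe_smul, ← hsm, smul_inv_smul]
      rw [h1, map_smulₛₗ]
      have : IsLocalRing.residue 𝒪[K] ϖ = 0 := by
        rw [IsLocalRing.residue_eq_zero_iff, hϖ.maximalIdeal_eq]
        exact Ideal.mem_span_singleton_self ϖ
      rw [this, zero_smul]

/-- An adapted basis of the reduction of `L` lifts to an adapted basis of `L`. -/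
theorem IsUniformizer.exists_adapted_of_reduction (hL : Submodule.IsLattice K L)
    {red : L →ₛₗ[IsLocalRing.residue 𝒪[K]] (Fin (d + 1) → 𝓀[K])}
    (hsurj : Function.Surjective red)
    (hker : ∀ v : L, red v = 0 ↔ (v : Fin (d + 1) → K) ∈ π • L)
    (C : Set (Submodule 𝒪[K] (Fin (d + 1) → K))) (hC : ∀ N ∈ C, π • L ≤ N ∧ N ≤ L)
    (D : Submodule 𝒪[K] (Fin (d + 1) → K) → Submodule 𝓀[K] (Fin (d + 1) → 𝓀[K]))
    (hD : ∀ N v, v ∈ D N ↔ ∃ w : L, (w : Fin (d + 1) → K) ∈ N ∧ red w = v)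
    (B : Set (Fin (d + 1) → 𝓀[K])) (hB : LinearIndepOn 𝓀[K] id B)
    (hBC : ∀ N ∈ C, D N ≤ Submodule.span 𝓀[K] (B ∩ D N)) :
    ∃ f : Module.Basis (Fin (d + 1)) K (Fin (d + 1) → K), ∀ N ∈ C, IsAdapted π f L N := by
  classical
  let b' := Module.Basis.extend hB
  have hcard : Nat.card (hB.extend (Set.subset_univ B)) = d + 1 := by
    rw [← Module.finrank_eq_nat_card_basis b', Module.finrank_fintype_fun_eq_card, Fintype.card_fin]
  have hfin : Finite (hB.extend (Set.subset_univ B)) := Nat.finite_of_card_ne_zero (by omega)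
  let e : hB.extend (Set.subset_univ B) ≃ Fin (d + 1) := Finite.equivFinOfCardEq hcard
  let b := b'.reindex e
  have hbB : B ⊆ Set.range b := by
    rw [Module.Basis.range_reindex, Module.Basis.range_extend]
    exact hB.subset_extend _
  choose g hg using fun i => hsurj (b i)
  -- Spanning relations modulo `π` lift to relations over the valuation ring up to πL, which is the
  -- kernel of reduction.
  have hlift : ∀ S : Set (Fin (d + 1) → K), ∀ v : L,
      red v ∈ Submodule.span 𝓀[K] (red '' {w : L | (w : Fin (d + 1) → K) ∈ S}) →
      (v : Fin (d + 1) → K) ∈ Submodule.span 𝒪[K] S ⊔ π • L := by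
    intro S v hv
    have h1 : ∀ w ∈ Submodule.span 𝓀[K] (red '' {w : L | (w : Fin (d + 1) → K) ∈ S}),
        ∃ u : L, (u : Fin (d + 1) → K) ∈ Submodule.span 𝒪[K] S ∧ red u = w := by
      intro w hw
      induction hw using Submodule.span_induction with
      | mem w hw =>
        obtain ⟨u, hu, rfl⟩ := hw
        exact ⟨u, Submodule.subset_span hu, rfl⟩
      | zero => exact ⟨0, zero_mem _, map_zero _⟩
      | add x y _ _ hx hy =>
        obtain ⟨u, hu, rfl⟩ := hx
        obtain ⟨u', hu', rfl⟩ := hy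
        exact ⟨u + u', add_mem hu hu', map_add _ _ _⟩
      | smul c x _ hx =>
        obtain ⟨u, hu, rfl⟩ := hx
        obtain ⟨c, rfl⟩ := IsLocalRing.residue_surjective c
        exact ⟨c • u, Submodule.smul_mem _ _ hu, map_smulₛₗ _ _ _⟩
    obtain ⟨u, hu, huv⟩ := h1 _ hv
    have h2 : red (v - u) = 0 := by rw [map_sub, huv, sub_self]
    rw [hker] at h2
    have h3 := Submodule.add_mem_sup hu h2
    simpa using h3
  have hspan : Submodule.span 𝒪[K] (Set.range fun i => (g i : Fin (d + 1) → K)) = L := by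
    refine le_antisymm (Submodule.span_le.mpr ?_) ?_
    · rintro _ ⟨i, rfl⟩; exact (g i).2
    · refine Submodule.le_of_le_smul_of_le_jacobson_bot (I := 𝓂[K]) hL.fg
        (IsLocalRing.maximalIdeal_le_jacobson ⊥) ?_
      rw [hπ.maximalIdeal_smul]
      intro v hv
      refine hlift _ ⟨v, hv⟩ ?_
      have : Submodule.span 𝓀[K] (Set.range b) = ⊤ := b.span_eq
      refine Submodule.span_mono ?_ (by rw [this]; trivial : _ ∈ Submodule.span 𝓀[K] (Set.range b))
      rintro _ ⟨i, rfl⟩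
      exact ⟨g i, ⟨i, rfl⟩, hg i⟩
  have hspanK : ⊤ ≤ Submodule.span K (Set.range fun i => (g i : Fin (d + 1) → K)) := by
    have h1 := Submodule.span_span_of_tower 𝒪[K] K (Set.range fun i => (g i : Fin (d + 1) → K))
    rw [← h1, hspan, hL.span_eq_top]
  let f := basisOfTopLeSpanOfCardEqFinrank (fun i => (g i : Fin (d + 1) → K)) hspanK (by simp)
  have hf : ∀ i, f i = g i := fun i => by
    simp [f]
  have hrange : Set.range f = Set.range fun i => (g i : Fin (d + 1) → K) := by
    congr 1; ext1 i; exact hf i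
  refine ⟨f, fun N hN => ⟨by rw [hrange, hspan], (hC N hN).1, (hC N hN).2, fun v hv => ?_⟩⟩
  have h1 : red ⟨v, (hC N hN).2 hv⟩ ∈ D N := (hD N _).mpr ⟨_, hv, rfl⟩
  refine hlift _ ⟨v, (hC N hN).2 hv⟩ (Submodule.span_mono ?_ (hBC N hN h1))
  rintro w ⟨hwB, hwD⟩
  obtain ⟨i, rfl⟩ := hbB hwB
  refine ⟨g i, ⟨⟨i, hf i⟩, ?_⟩, hg i⟩
  -- The lifts `g i` were chosen without regard to `N`. If the reduction of `g i` lies in that of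
  -- `N`, then `g i` is in `N`, because `N` contains πL.
  obtain ⟨u, hu, hub⟩ := (hD N _).mp hwD
  have h2 : red (g i - u) = 0 := by rw [map_sub, hg, hub, sub_self]
  rw [hker] at h2
  have h3 := add_mem ((hC N hN).1 h2) hu
  simpa using h3

omit hπ in
theorem exists_reduction_image
    (red : L →ₛₗ[IsLocalRing.residue 𝒪[K]] (Fin (d + 1) → 𝓀[K])) :
    ∃ D : Submodule 𝒪[K] (Fin (d + 1) → K) → Submodule 𝓀[K] (Fin (d + 1) → 𝓀[K]),
      ∀ N v, v ∈ D N ↔ ∃ w : L, (w : Fin (d + 1) → K) ∈ N ∧ red w = v := by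
  have : RingHomSurjective (IsLocalRing.residue 𝒪[K]) := ⟨IsLocalRing.residue_surjective⟩
  refine ⟨fun N => (N.comap L.subtype).map red, fun N v => ?_⟩
  simp

theorem IsUniformizer.exists_adapted_chain (hL : Submodule.IsLattice K L)
    (C : Finset (Submodule 𝒪[K] (Fin (d + 1) → K))) (hC : ∀ N ∈ C, π • L ≤ N ∧ N ≤ L)
    (hchain : IsChain (· ≤ ·) (C : Set (Submodule 𝒪[K] (Fin (d + 1) → K)))) :
    ∃ f : Module.Basis (Fin (d + 1)) K (Fin (d + 1) → K), ∀ N ∈ C, IsAdapted π f L N := by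
  classical
  obtain ⟨red, hsurj, hker⟩ := hπ.exists_reduction hL
  obtain ⟨D, hD⟩ := exists_reduction_image red
  have hmono : Monotone D := fun N N' h v hv => by
    rw [hD] at hv ⊢
    obtain ⟨w, hw, hwv⟩ := hv
    exact ⟨w, h hw, hwv⟩
  obtain ⟨B, hB, hBC⟩ := exists_linearIndepOn_adapted_chain (C.image D) (by
    rw [Finset.coe_image]
    rintro _ ⟨N, hN, rfl⟩ _ ⟨N', hN', rfl⟩ -
    exact (hchain.total hN hN').imp (fun h => hmono h) fun h => hmono h)
  exact hπ.exists_adapted_of_reduction hL hsurj hker C hC D hD B hB fun N hN =>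
    hBC _ (Finset.mem_image_of_mem D hN)

theorem IsUniformizer.exists_adapted_pair (hL : Submodule.IsLattice K L)
    {N N' : Submodule 𝒪[K] (Fin (d + 1) → K)} (hN : π • L ≤ N ∧ N ≤ L)
    (hN' : π • L ≤ N' ∧ N' ≤ L) :
    ∃ f : Module.Basis (Fin (d + 1)) K (Fin (d + 1) → K), IsAdapted π f L N ∧
      IsAdapted π f L N' := by
  obtain ⟨red, hsurj, hker⟩ := hπ.exists_reduction hL
  obtain ⟨D, hD⟩ := exists_reduction_image red
  obtain ⟨B, hB, h1, h2⟩ := exists_linearIndepOn_adapted_pair (D N) (D N')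
  obtain ⟨f, hf⟩ := hπ.exists_adapted_of_reduction hL hsurj hker {N, N'}
    (by rintro _ (rfl | rfl) <;> assumption) D hD B hB (by rintro _ (rfl | rfl) <;> assumption)
  exact ⟨f, hf N (by simp), hf N' (by simp)⟩

end AdaptedBases

/-! ### What geodesic convexity says about links -/

section Convexity

variable {K : Type*} [Field K] [ValuativeRel K] [TopologicalSpace K]
  [IsNonarchimedeanLocalField K] {d : ℕ} {π : Kˣ} (hπ : IsUniformizer π)

/-- The vertices are enumerated by inclusion. The inclusion closing the chain is strict because `π`
times a normalized lattice is never normalized. -/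
theorem isSimplex_of_chain {σ : Finset (Vertex K d)} (hne : σ.Nonempty)
    (hchain : ∀ s ∈ σ, ∀ t ∈ σ, normalizedLattice hπ s ≤ normalizedLattice hπ t ∨
      normalizedLattice hπ t ≤ normalizedLattice hπ s)
    (hsmul : ∀ s ∈ σ, ∀ t ∈ σ, π • normalizedLattice hπ s ≤ normalizedLattice hπ t) :
    IsSimplex σ := by
  classical
  let lam : {s // s ∈ σ} → Submodule 𝒪[K] (Fin (d + 1) → K) := fun s => normalizedLattice hπ s.1
  have hlam : Function.Injective lam := fun s t h =>
    Subtype.ext (normalizedLattice_injective hπ h)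
  let _ : LinearOrder {s // s ∈ σ} :=
    { PartialOrder.lift lam hlam with
      le_total := fun s t => hchain s.1 s.2 t.1 t.2
      toDecidableLE := Classical.decRel _ }
  have hcard : Fintype.card {s // s ∈ σ} = σ.card - 1 + 1 := by
    have := Finset.card_pos.mpr hne
    rw [Fintype.card_coe]; omega
  let e : Fin (σ.card - 1 + 1) ≃o {s // s ∈ σ} := (Fintype.orderIsoFinOfCardEq _ hcard)
  refine ⟨σ.card - 1, fun i => ⟨normalizedLattice hπ (e i).1, isLattice_normalizedLattice hπ _⟩,
    fun i j hij => ?_, ?_, ?_⟩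
  · have h : e i < e j := e.strictMono hij
    exact h
  · rw [hπ.maximalIdeal_smul]
    exact lt_of_le_of_ne (hsmul _ (e _).2 _ (e _).2) (smul_normalizedLattice_ne hπ _ _)
  · ext s
    simp only [toVertex_normalizedLattice, Finset.mem_coe, Set.mem_range]
    exact ⟨fun hs => ⟨e.symm ⟨s, hs⟩, by simp⟩, by rintro ⟨i, rfl⟩; exact (e i).2⟩

omit [TopologicalSpace K] [IsNonarchimedeanLocalField K] in
/-- The midpoint of two points of a common simplex. -/
theorem Realization.exists_midpoint (a b : Realization K d) {σ : Finset (Vertex K d)}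
    (hσ : (σ : Set (Vertex K d)) =
      (a.weight.support : Set (Vertex K d)) ∪ (b.weight.support : Set (Vertex K d))) (h : IsSimplex σ) :
    ∃ z : Realization K d, z.weight.support = σ ∧
      z.weight = (1 / 2 : ℝ) • (a.weight + b.weight) := by
  have happ : ∀ s, ((1 / 2 : ℝ) • (a.weight + b.weight)) s =
      1 / 2 * (a.weight s + b.weight s) := fun s => by simp [mul_add]
  have hsupp : ((1 / 2 : ℝ) • (a.weight + b.weight)).support = σ := by
    ext s
    rw [← Finset.mem_coe (s := σ), hσ, Finsupp.mem_support_iff, happ, Set.mem_union,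
      Finset.mem_coe, Finset.mem_coe, Finsupp.mem_support_iff, Finsupp.mem_support_iff]
    have ha := a.nonneg s
    have hb := b.nonneg s
    constructor
    · intro h
      by_contra! h'
      rw [h'.1, h'.2] at h
      simp at h
    · rintro (h | h)
      · have := lt_of_le_of_ne ha h.symm
        positivity
      · have := lt_of_le_of_ne hb h.symm
        positivity
  refine ⟨⟨(1 / 2 : ℝ) • (a.weight + b.weight), fun s => ?_, ?_, hsupp ▸ h⟩, hsupp, rfl⟩
  · rw [happ]
    have ha := a.nonneg s
    have hb := b.nonneg s
    positivity
  · rw [Finsupp.sum_smul_index (fun _ => rfl), ← Finsupp.mul_sum,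
      Finsupp.sum_add_index' (fun _ => rfl) (fun _ _ _ => rfl), a.sum_eq_one, b.sum_eq_one]
    norm_num

omit [TopologicalSpace K] [IsNonarchimedeanLocalField K] in
theorem Realization.exists_support_eq {σ : Finset (Vertex K d)} (h : IsSimplex σ) :
    ∃ z : Realization K d, z.weight.support = σ := by
  classical
  have hne : σ.Nonempty := by
    obtain ⟨k, M, -, -, hr⟩ := h
    rw [← Finset.coe_nonempty, hr]
    exact Set.range_nonempty _
  have hcard : (0 : ℝ) < σ.card := by exact_mod_cast Finset.card_pos.mpr hne
  have hsupp : (Finsupp.indicator σ fun _ _ => (σ.card : ℝ)⁻¹).support = σ := by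
    ext s
    rw [Finsupp.mem_support_iff, Finsupp.indicator_apply]
    split_ifs with hs <;> simp [hs, hcard.ne']
  refine ⟨⟨Finsupp.indicator σ fun _ _ => (σ.card : ℝ)⁻¹, fun s => ?_, ?_, hsupp.symm ▸ h⟩, hsupp⟩
  · rw [Finsupp.indicator_apply]
    split_ifs <;> positivity
  · rw [Finsupp.sum, hsupp, Finset.sum_congr rfl fun s hs => Finsupp.indicator_of_mem hs _]
    rw [Finset.sum_const, nsmul_eq_mul, mul_inv_cancel₀ hcard.ne']

theorem Realization.hasCoordinates {ϖ : 𝒪[K]}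
    {f : Module.Basis (Fin (d + 1)) K (Fin (d + 1) → K)} (w : Realization K d)
    (α : Vertex K d → Fin (d + 1) → ℤ)
    (hα : ∀ s ∈ w.weight.support, normalizedLattice hπ s = apartmentLattice ϖ f (α s))
    (hchain : ∀ s ∈ w.weight.support, ∀ t ∈ w.weight.support,
      (α s ≤ α t ∧ α t ≤ α s + 1) ∨ (α t ≤ α s ∧ α s ≤ α t + 1)) :
    w.HasCoordinates ϖ f fun i => w.weight.sum fun s a => a * (α s i : ℝ) :=
  ⟨α, fun s hs => ⟨⟨normalizedLattice hπ s, isLattice_normalizedLattice hπ s⟩, hα s hs,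
    toVertex_normalizedLattice hπ s⟩, hchain, fun _ => rfl⟩

omit [TopologicalSpace K] [IsNonarchimedeanLocalField K] in
theorem adaptedCoordinates_anti (f : Module.Basis (Fin (d + 1)) K (Fin (d + 1) → K))
    {N N' : Submodule 𝒪[K] (Fin (d + 1) → K)} (h : N ≤ N') :
    adaptedCoordinates f N' ≤ adaptedCoordinates f N := by
  intro i
  unfold adaptedCoordinates
  split_ifs with h1 h2
  · exact le_rfl
  · exact zero_le_one
  · exact (h1 (h ‹_›)).elim
  · exact le_rfl

omit [TopologicalSpace K] [IsNonarchimedeanLocalField K] in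
theorem adaptedCoordinates_le_add_one (f : Module.Basis (Fin (d + 1)) K (Fin (d + 1) → K))
    (N N' : Submodule 𝒪[K] (Fin (d + 1) → K)) :
    adaptedCoordinates f N' ≤ adaptedCoordinates f N + 1 := by
  intro i
  rw [Pi.add_apply, Pi.one_apply]
  unfold adaptedCoordinates
  split_ifs <;> norm_num

variable {ϖ : 𝒪[K]} (hϖ : (ϖ : K) = π) {Y : Subcomplex K d}
  (hY : GeodesicallyConvex ϖ Y.realization)
include hϖ hY

/-- A convex subcomplex contains the cone over a face, with a vertex of the subcomplex as apex. -/
theorem GeodesicallyConvex.insert_mem_faces {M : Submodule 𝒪[K] (Fin (d + 1) → K)}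
    (hM : Submodule.IsLattice K M) {τ : Finset (Vertex K d)} (hτ : τ ∈ Y.faces)
    (hτM : ∀ t ∈ τ, M ≤ normalizedLattice hπ t ∧ π • normalizedLattice hπ t ≤ M)
    {T : Vertex K d} (hT : {T} ∈ Y.faces)
    (hTM : M ≤ normalizedLattice hπ T ∧ π • normalizedLattice hπ T ≤ M)
    (hτT : ∀ t ∈ τ, normalizedLattice hπ t ≤ normalizedLattice hπ T) [DecidableEq (Vertex K d)] :
    insert T τ ∈ Y.faces := by
  classical
  have hchain : ∀ s ∈ insert T τ, ∀ t ∈ insert T τ,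
      normalizedLattice hπ s ≤ normalizedLattice hπ t ∨
        normalizedLattice hπ t ≤ normalizedLattice hπ s := by
    intro s hs t ht
    rcases Finset.mem_insert.mp hs with h | hs'
    · rcases Finset.mem_insert.mp ht with h' | ht'
      · rw [h, h']; exact Or.inl le_rfl
      · rw [h]; exact Or.inr (hτT t ht')
    · rcases Finset.mem_insert.mp ht with h' | ht'
      · rw [h']; exact Or.inl (hτT s hs')
      · exact ((Y.isSimplex τ hτ).normalizedLattice_le_or_le hπ hs' ht').imp And.left And.left
  have hbd : ∀ s ∈ insert T τ, M ≤ normalizedLattice hπ s ∧ π • normalizedLattice hπ s ≤ M := by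
    intro s hs
    rcases Finset.mem_insert.mp hs with rfl | hs
    · exact hTM
    · exact hτM s hs
  have hsimp : IsSimplex (insert T τ) := isSimplex_of_chain hπ (Finset.insert_nonempty _ _) hchain
    fun s hs t ht => (hbd s hs).2.trans (hbd t ht).1
  -- All lattices involved form a chain between M and π⁻¹M, so a single adapted basis puts them in
  -- one apartment.
  have hL : Submodule.IsLattice K (π⁻¹ • M) := Submodule.IsLattice.smul K M π⁻¹
  obtain ⟨f, hf⟩ := hπ.exists_adapted_chain hL ((insert T τ).image (normalizedLattice hπ))
    (by
      intro N hN
      obtain ⟨s, hs, rfl⟩ := Finset.mem_image.mp hN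
      rw [smul_inv_smul]
      exact ⟨(hbd s hs).1, by rw [← units_smul_le_iff]; exact (hbd s hs).2⟩)
    (by
      rintro _ hN _ hN' -
      obtain ⟨s, hs, rfl⟩ := Finset.mem_image.mp hN
      obtain ⟨t, ht, rfl⟩ := Finset.mem_image.mp hN'
      exact hchain s hs t ht)
  set α : Vertex K d → Fin (d + 1) → ℤ := fun s => adaptedCoordinates f (normalizedLattice hπ s)
  have hcoord : ∀ w : Realization K d, w.weight.support ⊆ insert T τ →
      w.HasCoordinates ϖ f fun i => w.weight.sum fun s a => a * (α s i : ℝ) := by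
    intro w hw
    refine w.hasCoordinates hπ α (fun s hs => ?_) fun s hs t ht => ?_
    · exact (hf _ (Finset.mem_image_of_mem _ (hw hs))).eq_apartmentLattice hϖ
    · rcases hchain s (hw hs) t (hw ht) with h | h
      · exact Or.inr ⟨adaptedCoordinates_anti f h, adaptedCoordinates_le_add_one f _ _⟩
      · exact Or.inl ⟨adaptedCoordinates_anti f h, adaptedCoordinates_le_add_one f _ _⟩
  obtain ⟨a, ha⟩ := Realization.exists_support_eq (Y.isSimplex _ hτ)
  obtain ⟨b, hb⟩ := Realization.exists_support_eq (Y.isSimplex _ hT)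
  -- The midpoint of an interior point of `τ` and the vertex `T` has support exactly `insert T τ`,
  -- so convexity puts this simplex in `Y`.
  obtain ⟨z, hz, hzw⟩ := a.exists_midpoint b (σ := insert T τ)
    (by rw [ha, hb, Finset.coe_insert, Finset.coe_singleton, Set.union_comm]; rfl) hsimp
  have hmem : z ∈ Y.realization := by
    refine hY a (by change _ ∈ Y.faces; rwa [ha]) b (by change _ ∈ Y.faces; rwa [hb])
      ⟨f, _, _, _, hcoord a (by rw [ha]; exact Finset.subset_insert _ _),
      hcoord b (by rw [hb]; simp), hcoord z hz.subset, 1 / 2, ⟨by norm_num, by norm_num⟩, 0,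
      fun i => ?_⟩
    rw [hzw, Finsupp.sum_smul_index (fun _ => by simp)]
    simp_rw [mul_assoc]
    rw [← Finsupp.mul_sum, Finsupp.sum_add_index' (fun _ => by simp) (fun _ _ _ => by ring)]
    ring
  change z.weight.support ∈ Y.faces at hmem
  rwa [hz] at hmem

/-- The vertices of a convex subcomplex above a given one are closed under sums of lattices. -/
theorem GeodesicallyConvex.exists_sup_mem_faces {M : Submodule 𝒪[K] (Fin (d + 1) → K)}
    (hM : Submodule.IsLattice K M) (hMn : IsNormalized π M) {s t : Vertex K d}
    (hs : {s} ∈ Y.faces) (ht : {t} ∈ Y.faces)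
    (hsM : M ≤ normalizedLattice hπ s ∧ π • normalizedLattice hπ s ≤ M)
    (htM : M ≤ normalizedLattice hπ t ∧ π • normalizedLattice hπ t ≤ M) :
    ∃ u, {u} ∈ Y.faces ∧ normalizedLattice hπ u = normalizedLattice hπ s ⊔ normalizedLattice hπ t ∧
      π • normalizedLattice hπ u ≤ M := by
  classical
  have hNs := isNormalized_normalizedLattice hπ s
  have hNt := isNormalized_normalizedLattice hπ t
  set N := normalizedLattice hπ s with hN
  set N' := normalizedLattice hπ t with hN'
  have hsupL : Submodule.IsLattice K (N ⊔ N') := isLattice_of_le hM (standardLattice K d).2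
    (hsM.1.trans le_sup_left) (sup_le hNs.1 hNt.1)
  have hinfL : Submodule.IsLattice K (N ⊓ N') := isLattice_of_le hM (standardLattice K d).2
    (le_inf hsM.1 htM.1) (inf_le_left.trans hNs.1)
  have hu : normalizedLattice hπ (Lattice.toVertex ⟨N ⊔ N', hsupL⟩) = N ⊔ N' :=
    normalizedLattice_toVertex hπ (hNs.of_le le_sup_left (sup_le hNs.1 hNt.1))
  have hv : normalizedLattice hπ (Lattice.toVertex ⟨N ⊓ N', hinfL⟩) = N ⊓ N' :=
    normalizedLattice_toVertex hπ (hMn.of_le (le_inf hsM.1 htM.1) (inf_le_left.trans hNs.1))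
  set u := Lattice.toVertex ⟨N ⊔ N', hsupL⟩
  set v := Lattice.toVertex ⟨N ⊓ N', hinfL⟩
  have hsmul : π • (N ⊔ N') ≤ M := by
    rw [units_smul_le_iff]
    refine sup_le ?_ ?_ <;> rw [← units_smul_le_iff]
    exacts [hsM.2, htM.2]
  refine ⟨u, ?_, hu, by rw [hu]; exact hsmul⟩
  have hbd : ∀ w ∈ ({u, v} : Finset (Vertex K d)),
      M ≤ normalizedLattice hπ w ∧ π • normalizedLattice hπ w ≤ M := by
    intro w hw
    rcases Finset.mem_insert.mp hw with rfl | hw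
    · rw [hu]; exact ⟨hsM.1.trans le_sup_left, hsmul⟩
    · rw [Finset.mem_singleton] at hw
      rw [hw, hv]
      exact ⟨le_inf hsM.1 htM.1, (units_smul_mono _ inf_le_left).trans hsM.2⟩
  have hvu : normalizedLattice hπ v ≤ normalizedLattice hπ u := by
    rw [hu, hv]; exact inf_le_left.trans le_sup_left
  have hsimp : IsSimplex ({u, v} : Finset (Vertex K d)) := by
    refine isSimplex_of_chain hπ (Finset.insert_nonempty _ _) ?_
      fun s hs t ht => (hbd s hs).2.trans (hbd t ht).1
    intro w hw w' hw'
    simp only [Finset.mem_insert, Finset.mem_singleton] at hw hw'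
    rcases hw with rfl | rfl <;> rcases hw' with rfl | rfl
    exacts [Or.inl le_rfl, Or.inr hvu, Or.inl hvu, Or.inl le_rfl]
  have hpt : ∀ w ∈ ({u, v} : Finset (Vertex K d)), IsSimplex {w} := fun w hw =>
    isSimplex_of_chain hπ (Finset.singleton_nonempty _)
      (fun a ha b hb => by rw [Finset.mem_singleton.mp ha, Finset.mem_singleton.mp hb]; simp)
      fun a ha b hb => by
        rw [Finset.mem_singleton.mp ha, Finset.mem_singleton.mp hb]; exact hπ.smul_le _
  -- If sum and intersection define the same vertex, the two lattices coincide and there is nothing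
  -- to prove. Otherwise `u` and `v` span an edge.
  by_cases huv : u = v
  · have h1 : N ⊔ N' = N ⊓ N' := by rw [← hu, ← hv, huv]
    have h2 : N ⊔ N' = N := le_antisymm (h1.le.trans inf_le_left) le_sup_left
    have h3 : u = s := normalizedLattice_injective hπ (by rw [hu, h2])
    rwa [h3]
  have hL : Submodule.IsLattice K (π⁻¹ • M) := Submodule.IsLattice.smul K M π⁻¹
  obtain ⟨f, hfN, hfN'⟩ := hπ.exists_adapted_pair hL (N := N) (N' := N')
    (by rw [smul_inv_smul, ← units_smul_le_iff]; exact hsM)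
    (by rw [smul_inv_smul, ← units_smul_le_iff]; exact htM)
  set α := adaptedCoordinates f N
  set β := adaptedCoordinates f N'
  have hα : N = apartmentLattice ϖ f α := hfN.eq_apartmentLattice hϖ
  have hβ : N' = apartmentLattice ϖ f β := hfN'.eq_apartmentLattice hϖ
  have h0 : (ϖ : K) ≠ 0 := by rw [hϖ]; exact π.ne_zero
  let pt : ∀ w : Vertex K d, IsSimplex {w} → Realization K d := fun w hw =>
    ⟨Finsupp.single w 1, fun s => by
      rw [Finsupp.single_apply]; split_ifs <;> norm_num, by simp, by
      rwa [Finsupp.support_single _ one_ne_zero]⟩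
  have hptw : ∀ w hw, (pt w hw).weight = Finsupp.single w 1 := fun _ _ => rfl
  have hpts : ∀ w hw, (pt w hw).weight.support = {w} := fun w _ =>
    Finsupp.support_single _ one_ne_zero
  have hptc : ∀ w hw γ, normalizedLattice hπ w = apartmentLattice ϖ f γ →
      (pt w hw).HasCoordinates ϖ f fun i => (γ i : ℝ) := by
    intro w hw γ hγ
    have := (pt w hw).hasCoordinates hπ (ϖ := ϖ) (f := f) (fun _ => γ)
      (fun s hs => by simp only [hpts, Finset.mem_singleton] at hs; rw [hs, hγ])
      fun _ _ _ _ => Or.inl ⟨le_rfl, fun i => by simp⟩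
    simpa [hptw] using this
  obtain ⟨z, hz, hzw⟩ := (pt u (hpt u (by simp))).exists_midpoint (pt v (hpt v (by simp)))
    (σ := {u, v})
    (by simp only [hpts, Finset.coe_insert, Finset.coe_singleton]; rfl)
    hsimp
  -- Larger lattices have smaller coordinates: α ⊓ β belongs to N ⊔ N' and α ⊔ β to N ⊓ N'. Since α
  -- ⊓ β + α ⊔ β = α + β, the midpoint of the edge is also the midpoint of `s` and `t`.
  have hzc : z.HasCoordinates ϖ f fun i => 1 / 2 * (((α ⊓ β) i : ℤ) + ((α ⊔ β) i : ℤ) : ℝ) := by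
    have hle : α ⊓ β ≤ α ⊔ β := inf_le_left.trans le_sup_left
    have hle' : α ⊔ β ≤ α ⊓ β + 1 := by
      have h1 := adaptedCoordinates_le_add_one f N N'
      have h2 := adaptedCoordinates_le_add_one f N' N
      intro i
      have h3 := h1 i
      have h4 := h2 i
      simp only [Pi.add_apply, Pi.one_apply, Pi.sup_apply, Pi.inf_apply] at h3 h4 ⊢
      change β i ≤ α i + 1 at h3
      change α i ≤ β i + 1 at h4
      omega
    have := z.hasCoordinates hπ (ϖ := ϖ) (f := f) (fun w => if w = u then α ⊓ β else α ⊔ β)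
      (fun w hw => by
        rw [hz, Finset.mem_insert, Finset.mem_singleton] at hw
        rcases hw with rfl | rfl
        · rw [if_pos rfl, hu, hα, hβ, apartmentLattice_sup h0]
        · rw [if_neg (Ne.symm huv), hv, hα, hβ, apartmentLattice_inf h0])
      (fun w hw w' hw' => by
        split_ifs
        · exact Or.inl ⟨le_rfl, fun i => by simp⟩
        · exact Or.inl ⟨hle, hle'⟩
        · exact Or.inr ⟨hle, hle'⟩
        · exact Or.inl ⟨le_rfl, fun i => by simp⟩)
    convert this using 2 with i
    rw [hzw]
    simp only [hptw]
    rw [Finsupp.sum_smul_index (fun _ => by simp)]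
    simp_rw [mul_assoc]
    rw [← Finsupp.mul_sum, Finsupp.sum_add_index' (fun _ => by simp) (fun _ _ _ => by ring),
      Finsupp.sum_single_index (by simp), Finsupp.sum_single_index (by simp), if_pos rfl,
      if_neg (Ne.symm huv)]
    simp
  have hmem : z ∈ Y.realization := by
    refine hY (pt s (Y.isSimplex _ hs)) (by change _ ∈ Y.faces; simpa only [hpts])
      (pt t (Y.isSimplex _ ht)) (by change _ ∈ Y.faces; simpa only [hpts])
      ⟨f, _, _, _, hptc s (Y.isSimplex _ hs) α hα, hptc t (Y.isSimplex _ ht) β hβ, hzc, 1 / 2, ⟨by norm_num, by norm_num⟩, 0,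
        fun i => ?_⟩
    have : ((α ⊓ β) i : ℤ) + (α ⊔ β) i = α i + β i := by
      simp only [Pi.inf_apply, Pi.sup_apply]
      omega
    have h2 : (((α ⊓ β) i : ℤ) : ℝ) + ((α ⊔ β) i : ℤ) = α i + β i := by exact_mod_cast this
    rw [h2]
    ring
  change z.weight.support ∈ Y.faces at hmem
  rw [hz] at hmem
  exact Y.down_closed _ hmem _ (by simp) (Finset.singleton_nonempty _)

end Convexity

/-! ### Groups of automorphisms close to the identity on a lattice -/

section LinearAction

variable {K : Type*} [Field K] {d : ℕ}

/-- The action of `GL_{d+1}(K)` on `K ^ (d + 1)`. -/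
def linearAction (g : GL (Fin (d + 1)) K) : (Fin (d + 1) → K) →ₗ[K] (Fin (d + 1) → K) :=
  Matrix.toLin' (g : Matrix (Fin (d + 1)) (Fin (d + 1)) K)

theorem linearAction_mul (g h : GL (Fin (d + 1)) K) (v : Fin (d + 1) → K) :
    linearAction (g * h) v = linearAction g (linearAction h v) := by
  simp [linearAction, Matrix.toLin'_mul]

@[simp]
theorem linearAction_one (v : Fin (d + 1) → K) :
    linearAction (1 : GL (Fin (d + 1)) K) v = v := by
  simp [linearAction]

@[simp]
theorem linearAction_inv_apply (g : GL (Fin (d + 1)) K) (v : Fin (d + 1) → K) :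
    linearAction g⁻¹ (linearAction g v) = v := by
  rw [← linearAction_mul, inv_mul_cancel, linearAction_one]

@[simp]
theorem linearAction_apply_inv (g : GL (Fin (d + 1)) K) (v : Fin (d + 1) → K) :
    linearAction g (linearAction g⁻¹ v) = v := by
  rw [← linearAction_mul, mul_inv_cancel, linearAction_one]

theorem linearAction_units_smul (g : GL (Fin (d + 1)) K) (a : Kˣ) (v : Fin (d + 1) → K) :
    linearAction g (a • v) = a • linearAction g v :=
  (linearAction g).map_smul (a : K) v

theorem exists_linearAction_eq (F F' : (Fin (d + 1) → K) →ₗ[K] (Fin (d + 1) → K))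
    (h : ∀ v, F (F' v) = v) (h' : ∀ v, F' (F v) = v) :
    ∃ g : GL (Fin (d + 1)) K, linearAction g = F ∧ linearAction g⁻¹ = F' := by
  refine ⟨⟨LinearMap.toMatrix' F, LinearMap.toMatrix' F', ?_, ?_⟩, ?_, ?_⟩
  · rw [← LinearMap.toMatrix'_comp, ← LinearMap.toMatrix'_id]
    congr 1
    exact LinearMap.ext h
  · rw [← LinearMap.toMatrix'_comp, ← LinearMap.toMatrix'_id]
    congr 1
    exact LinearMap.ext h'
  · exact Matrix.toLin'_toMatrix' F
  · exact Matrix.toLin'_toMatrix' F'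

theorem exists_unipotent (X : (Fin (d + 1) → K) →ₗ[K] (Fin (d + 1) → K))
    (h : ∀ v, X (X v) = 0) :
    ∃ g : GL (Fin (d + 1)) K, (∀ v, linearAction g v = v + X v) ∧
      ∀ v, linearAction g⁻¹ v = v - X v := by
  obtain ⟨g, hg, hg'⟩ := exists_linearAction_eq (LinearMap.id + X) (LinearMap.id - X)
    (fun v => by simp [h]) (fun v => by simp [h])
  exact ⟨g, fun v => by rw [hg]; simp, fun v => by rw [hg']; simp⟩

variable [ValuativeRel K]

/-- `g` maps the lattice `L` to itself. -/
def Preserves (g : GL (Fin (d + 1)) K) (L : Submodule 𝒪[K] (Fin (d + 1) → K)) : Prop :=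
  (∀ v ∈ L, linearAction g v ∈ L) ∧ ∀ v ∈ L, linearAction g⁻¹ v ∈ L

theorem Preserves.smul {g : GL (Fin (d + 1)) K} {L : Submodule 𝒪[K] (Fin (d + 1) → K)}
    (h : Preserves g L) (a : Kˣ) : Preserves g (a • L) := by
  constructor <;>
  · intro v hv
    rw [mem_units_smul, ← linearAction_units_smul]
    rw [mem_units_smul] at hv
    first | exact h.1 _ hv | exact h.2 _ hv

/-- The elements `g` such that `g - 1` and `g⁻¹ - 1` map `L` to `A ∩ L`. -/
def moveSubgroup (L A : Submodule 𝒪[K] (Fin (d + 1) → K)) : Subgroup (GL (Fin (d + 1)) K) where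
  carrier := {g | (∀ v ∈ L, linearAction g v - v ∈ A ⊓ L) ∧
    ∀ v ∈ L, linearAction g⁻¹ v - v ∈ A ⊓ L}
  one_mem' := by simp
  mul_mem' := by
    have key : ∀ g h : GL (Fin (d + 1)) K, (∀ v ∈ L, linearAction g v - v ∈ A ⊓ L) →
        (∀ v ∈ L, linearAction h v - v ∈ A ⊓ L) →
        ∀ v ∈ L, linearAction (g * h) v - v ∈ A ⊓ L := by
      intro g h hg hh v hv
      have h1 := hh v hv
      have h2 := hg (linearAction h v) (by simpa using add_mem h1.2 hv)
      rw [linearAction_mul, ← sub_add_sub_cancel _ (linearAction h v)]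
      exact add_mem h2 h1
    rintro g h ⟨hg, hg'⟩ ⟨hh, hh'⟩
    refine ⟨key g h hg hh, ?_⟩
    rw [mul_inv_rev]
    exact key _ _ hh' hg'
  inv_mem' := by
    rintro g ⟨hg, hg'⟩
    exact ⟨hg', by rwa [inv_inv]⟩

variable {L A : Submodule 𝒪[K] (Fin (d + 1) → K)} {g : GL (Fin (d + 1)) K}

theorem mem_moveSubgroup (h : A ≤ L) : g ∈ moveSubgroup L A ↔
    (∀ v ∈ L, linearAction g v - v ∈ A) ∧ ∀ v ∈ L, linearAction g⁻¹ v - v ∈ A := by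
  change (_ ∧ _) ↔ _
  rw [inf_eq_left.mpr h]

theorem moveSubgroup_preserves (hg : g ∈ moveSubgroup L A) : Preserves g L :=
  ⟨fun v hv => by simpa using add_mem (hg.1 v hv).2 hv,
    fun v hv => by simpa using add_mem (hg.2 v hv).2 hv⟩

theorem preserves_of_mem_moveSubgroup {T : Submodule 𝒪[K] (Fin (d + 1) → K)}
    (hg : g ∈ moveSubgroup L A) (hT : T ≤ L) (hA : A ≤ T) : Preserves g T :=
  ⟨fun v hv => by simpa using add_mem (hA (hg.1 v (hT hv)).1) hv,
    fun v hv => by simpa using add_mem (hA (hg.2 v (hT hv)).1) hv⟩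

theorem moveSubgroup_mono {A' : Submodule 𝒪[K] (Fin (d + 1) → K)} (h : A ≤ A') :
    moveSubgroup L A ≤ moveSubgroup L A' :=
  fun _ hg => ⟨fun v hv => ⟨h (hg.1 v hv).1, (hg.1 v hv).2⟩,
    fun v hv => ⟨h (hg.2 v hv).1, (hg.2 v hv).2⟩⟩

/-- Linear maps commute with scalars; hence congruence subgroups depend only on homothety classes.
-/
theorem moveSubgroup_smul (a : Kˣ) : moveSubgroup (a • L) (a • A) = moveSubgroup L A := by
  have key : ∀ (a : Kˣ) (L A : Submodule 𝒪[K] (Fin (d + 1) → K)),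
      moveSubgroup L A ≤ moveSubgroup (a • L) (a • A) := by
    intro a L A g hg
    have : ∀ h : GL (Fin (d + 1)) K, (∀ v ∈ L, linearAction h v - v ∈ A ⊓ L) →
        ∀ v ∈ a • L, linearAction h v - v ∈ a • A ⊓ a • L := by
      intro h hh v hv
      rw [mem_units_smul] at hv
      have := hh _ hv
      rw [linearAction_units_smul, ← smul_sub] at this
      exact ⟨(mem_units_smul _ _ _).mpr this.1, (mem_units_smul _ _ _).mpr this.2⟩
    exact ⟨this g hg.1, this g⁻¹ hg.2⟩
  refine le_antisymm ?_ (key a L A)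
  simpa using key a⁻¹ (a • L) (a • A)

theorem conj_mem_moveSubgroup {h : GL (Fin (d + 1)) K} (hL : Preserves g L) (hA : Preserves g A)
    (hh : h ∈ moveSubgroup L A) : g * h * g⁻¹ ∈ moveSubgroup L A := by
  have key : ∀ h : GL (Fin (d + 1)) K, (∀ v ∈ L, linearAction h v - v ∈ A ⊓ L) →
      ∀ v ∈ L, linearAction (g * h * g⁻¹) v - v ∈ A ⊓ L := by
    intro h hh v hv
    have h1 := hh _ (hL.2 v hv)
    have h2 : linearAction (g * h * g⁻¹) v - v =
        linearAction g (linearAction h (linearAction g⁻¹ v) - linearAction g⁻¹ v) := by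
      rw [map_sub, linearAction_mul, linearAction_mul, linearAction_apply_inv]
    rw [h2]
    exact ⟨hA.1 _ h1.1, hL.1 _ h1.2⟩
  refine ⟨key h hh.1, ?_⟩
  have : (g * h * g⁻¹)⁻¹ = g * h⁻¹ * g⁻¹ := by group
  rw [this]
  exact key _ hh.2

/-- If `u = 1 + X` approximates `g` on `L` up to `A`, then `g u⁻¹` moves `L` into `A`. -/
theorem mul_inv_mem_moveSubgroup {u : GL (Fin (d + 1)) K}
    (hAL : A ≤ L) (hu : Preserves u L) (hg : Preserves g L)
    (h : ∀ v ∈ L, linearAction g v - linearAction u v ∈ A) : g * u⁻¹ ∈ moveSubgroup L A := by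
  rw [mem_moveSubgroup hAL]
  constructor
  · intro v hv
    have h1 := h _ (hu.2 v hv)
    rwa [linearAction_apply_inv, ← linearAction_mul] at h1
  · intro v hv
    have h1 := h _ (hg.2 v hv)
    rw [linearAction_apply_inv, ← neg_mem_iff, neg_sub, ← linearAction_mul] at h1
    rwa [mul_inv_rev, inv_inv]

/-- A `p`-th power moves vectors further than the given element. -/
theorem pow_mem_moveSubgroup {B C : Submodule 𝒪[K] (Fin (d + 1) → K)} (hBA : B ≤ A) (hCB : C ≤ B)
    (hAB : g ∈ moveSubgroup A B) (hBC : g ∈ moveSubgroup B C) {q : ℕ}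
    (hq : ∀ v ∈ B, q • v ∈ C) : g ^ q ∈ moveSubgroup A C := by
  have key : ∀ g : GL (Fin (d + 1)) K, g ∈ moveSubgroup A B → g ∈ moveSubgroup B C →
      ∀ v ∈ A, linearAction (g ^ q) v - v ∈ C := by
    intro g hAB hBC v hv
    have hw := (hAB.1 v hv).1
    set w := linearAction g v - v with hw'
    have hC : Preserves g C := preserves_of_mem_moveSubgroup hBC hCB le_rfl
    have hpow : ∀ j : ℕ, ∀ u ∈ C, linearAction (g ^ j) u ∈ C := by
      intro j
      induction j with
      | zero => simp
      | succ j ih =>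
        intro u hu
        rw [pow_succ, linearAction_mul]
        exact ih _ (hC.1 u hu)
    have h1 : ∀ j : ℕ, linearAction (g ^ j) w - w ∈ C := by
      intro j
      induction j with
      | zero => simp
      | succ j ih =>
        have := hpow j _ (hBC.1 w hw).1
        rw [map_sub, ← linearAction_mul, ← pow_succ] at this
        simpa using add_mem this ih
    -- Telescoping, g^j v - v is the sum of the g^i w for i < j, and each of these is congruent to
    -- `w` modulo `C`.
    have h2 : ∀ j : ℕ, linearAction (g ^ j) v - v - j • w ∈ C := by
      intro j
      induction j with
      | zero => simp
      | succ j ih =>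
        have h3 : linearAction (g ^ (j + 1)) v - v - (j + 1) • w =
            (linearAction (g ^ j) w - w) + (linearAction (g ^ j) v - v - j • w) := by
          have hgv : linearAction g v = w + v := by rw [hw', sub_add_cancel]
          rw [pow_succ, linearAction_mul, hgv, map_add, add_smul, one_smul]
          abel
        rw [h3]
        exact add_mem (h1 j) ih
    simpa using add_mem (h2 q) (hq w hw)
  rw [mem_moveSubgroup (hCB.trans hBA)]
  refine ⟨key g hAB hBC, ?_⟩
  rw [← inv_pow]
  exact key _ (inv_mem hAB) (inv_mem hBC)

end LinearAction

/-! ### The filtration subgroups and their factorizations -/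

section FiltrationSubgroups

variable {K : Type*} [Field K] [ValuativeRel K] {d : ℕ} {π : Kˣ}

/-- The elements `1 + X` with `X L ⊆ π ^ m N` and `X T ⊆ π ^ (m + 1) L`. -/
def filtrationSubgroup (π : Kˣ) (m : ℕ) (L T N : Submodule 𝒪[K] (Fin (d + 1) → K)) :
    Subgroup (GL (Fin (d + 1)) K) :=
  moveSubgroup L (π ^ m • N) ⊓ moveSubgroup T (π ^ (m + 1) • L)

variable {L T N N' : Submodule 𝒪[K] (Fin (d + 1) → K)} {m : ℕ} {g : GL (Fin (d + 1)) K}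

section
variable (hπ : IsUniformizer π)
include hπ

theorem filtrationSubgroup_le_moveSubgroup :
    filtrationSubgroup π m L T N ≤ moveSubgroup T (π • L) := by
  refine inf_le_right.trans (moveSubgroup_mono ?_)
  rw [pow_succ, mul_smul]
  exact hπ.pow_smul_le _ m

theorem preserves_of_mem_filtrationSubgroup (hN' : π • L ≤ N') (hN'T : N' ≤ T)
    (hg : g ∈ filtrationSubgroup π m L T N) : Preserves g N' :=
  preserves_of_mem_moveSubgroup
    (filtrationSubgroup_le_moveSubgroup hπ hg) hN'T hN'

end

theorem preserves_left_of_mem_filtrationSubgroup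
    (hg : g ∈ filtrationSubgroup π m L T N) : Preserves g L :=
  moveSubgroup_preserves hg.1

/-- As πL ≤ T, a vector of `L` is π⁻¹ times a vector of `T`, which costs exactly one power of `π`.
-/
theorem moveSubgroup_top_le_filtrationSubgroup (hπ : IsUniformizer π) (hT : π • L ≤ T)
    (hTL : T ≤ L) : moveSubgroup T (π ^ (m + 1) • T) ≤ filtrationSubgroup π m L T T := by
  intro g hg
  have h1 : π ^ (m + 1) • T ≤ T := hπ.pow_smul_le T _
  have h2 : π ^ (m + 1) • L ≤ T := by
    rw [pow_succ, mul_smul]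
    exact (units_smul_mono _ hT).trans (hπ.pow_smul_le T m)
  rw [mem_moveSubgroup h1] at hg
  have key : ∀ h : GL (Fin (d + 1)) K, (∀ v ∈ T, linearAction h v - v ∈ π ^ (m + 1) • T) →
      ∀ v ∈ L, linearAction h v - v ∈ π ^ m • T := by
    intro h hh v hv
    have h3 := hh (π • v) (hT (by rwa [mem_units_smul, inv_smul_smul]))
    rw [linearAction_units_smul, ← smul_sub, mem_units_smul, pow_succ, mul_inv_rev,
      mul_comm, mul_smul, inv_smul_smul] at h3
    rwa [mem_units_smul]
  refine Subgroup.mem_inf.mpr ⟨?_, ?_⟩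
  · rw [mem_moveSubgroup ((hπ.pow_smul_le T m).trans hTL)]
    exact ⟨key g hg.1, key _ hg.2⟩
  · rw [mem_moveSubgroup h2]
    exact ⟨fun v hv => units_smul_mono _ hTL (hg.1 v hv),
      fun v hv => units_smul_mono _ hTL (hg.2 v hv)⟩

/-- Elements of the filtration subgroup are products of elements of the congruence subgroups of
`L` and of `N`. -/
theorem filtrationSubgroup_le_sup (hπ : IsUniformizer π)
    {f : Module.Basis (Fin (d + 1)) K (Fin (d + 1) → K)} (hf : IsAdapted π f L N) (hNT : N ≤ T) :
    filtrationSubgroup π m L T N ≤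
      moveSubgroup L (π ^ (m + 1) • L) ⊔ moveSubgroup N (π ^ (m + 1) • N) := by
  intro g hg
  obtain ⟨e, hee, heL, heN⟩ := hf.exists_idempotent
  have hNL := hf.le
  have hmN : π ^ m • N ≤ N := hπ.pow_smul_le N m
  have hgL : ∀ v ∈ L, linearAction g v - v ∈ π ^ m • N := fun v hv => (hg.1.1 v hv).1
  have hgN : ∀ v ∈ N, linearAction g v - v ∈ π ^ (m + 1) • L := fun v hv =>
    (hg.2.1 v (hNT hv)).1
  have hesmul : ∀ (a : Kˣ) (v : Fin (d + 1) → K), e (a • v) = a • e v := fun a v =>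
    e.map_smul (a : K) v
  have heaN : ∀ (a : Kˣ), ∀ v ∈ a • N, e v ∈ a • N := by
    intro a v hv
    rw [mem_units_smul] at hv ⊢
    rw [← hesmul]
    exact heL _ (hNL hv)
  have hgsmul : ∀ (a : Kˣ), ∀ v ∈ a • L, linearAction g v - v ∈ a • π ^ m • N := by
    intro a v hv
    rw [mem_units_smul] at hv ⊢
    rw [smul_sub, ← linearAction_units_smul]
    exact hgL _ hv
  -- Here eL ⊆ N and (1 - e)N ⊆ πL. The block e(g - 1)(1 - e) has square zero and maps N to π^(m+1)
  -- N, so 1 + X is in the group of `N`. The rest of g - 1 is (g - 1)e + (1 - e)(g - 1)(1 - e),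
  -- which maps L to π^(m+1) L.
  let X : (Fin (d + 1) → K) →ₗ[K] (Fin (d + 1) → K) :=
    e ∘ₗ (linearAction g - LinearMap.id) ∘ₗ (LinearMap.id - e)
  have hX : ∀ v, X v = e (linearAction g (v - e v) - (v - e v)) := fun v => rfl
  have hX2 : ∀ v, X (X v) = 0 := by
    intro v
    rw [hX (X v), hX v, hee, sub_self, map_zero, sub_zero, map_zero]
  have hXL : ∀ v ∈ L, X v ∈ π ^ m • N := fun v hv =>
    heaN _ _ (hgL _ (sub_mem hv (hNL (heL v hv))))
  have hXN : ∀ v ∈ N, X v ∈ π ^ (m + 1) • N := by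
    intro v hv
    have h1 := hgsmul π _ (heN v hv)
    rw [smul_smul, ← pow_succ'] at h1
    exact heaN _ _ h1
  obtain ⟨u, hu, hu'⟩ := exists_unipotent X hX2
  have huN : u ∈ moveSubgroup N (π ^ (m + 1) • N) := by
    rw [mem_moveSubgroup (hπ.pow_smul_le N _)]
    exact ⟨fun v hv => by rw [hu, add_sub_cancel_left]; exact hXN v hv,
      fun v hv => by rw [hu', sub_sub_cancel_left]; exact neg_mem (hXN v hv)⟩
  have huL : Preserves u L :=
    ⟨fun v hv => by rw [hu]; exact add_mem hv (hNL (hmN (hXL v hv))),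
      fun v hv => by rw [hu']; exact sub_mem hv (hNL (hmN (hXL v hv)))⟩
  have h1 : g * u⁻¹ ∈ moveSubgroup L (π ^ (m + 1) • L) := by
    refine mul_inv_mem_moveSubgroup (hπ.pow_smul_le L _) huL
      (preserves_left_of_mem_filtrationSubgroup hg) fun v hv => ?_
    set w := linearAction g (v - e v) - (v - e v) with hw
    have hwN : w ∈ π ^ m • N := hgL _ (sub_mem hv (hNL (heL v hv)))
    have h2 : linearAction g v - linearAction u v =
        (linearAction g (e v) - e v) + (w - e w) := by
      have hgv : linearAction g v = w + linearAction g (e v) + (v - e v) := by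
        rw [hw, map_sub]; abel
      rw [hu, hX, ← hw, hgv]
      abel
    rw [h2]
    refine add_mem (hgN _ (heL v hv)) ?_
    rw [mem_units_smul] at hwN ⊢
    have h3 := heN _ hwN
    rw [hesmul, ← smul_sub, mem_units_smul, smul_smul] at h3
    rwa [pow_succ, mul_inv_rev]
  have h2 : g = g * u⁻¹ * u := by group
  rw [h2]
  exact mul_mem (Subgroup.mem_sup_left h1) (Subgroup.mem_sup_right huN)

/-- On a basis of `L`, split g - 1 into a part `Z` with values in π^m N' and a part in π^m N. Now
`Z` need not be nilpotent, nor map T to π^(m+1) L. Its block eZ(1 - e), for the projection `e`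
adapted to `T`, has square zero and does. The discarded blocks fall into π^(m+1) L, which is
contained in both π^m N and π^m N'. -/
theorem filtrationSubgroup_sup_le (hπ : IsUniformizer π)
    {f : Module.Basis (Fin (d + 1)) K (Fin (d + 1) → K)} (hf : IsAdapted π f L T)
    (hN : π • L ≤ N) (hNT : N ≤ T) (hN' : π • L ≤ N') (hN'T : N' ≤ T) :
    filtrationSubgroup π m L T (N ⊔ N') ≤
      filtrationSubgroup π m L T N ⊔ filtrationSubgroup π m L T N' := by
  intro g hg
  obtain ⟨e, hee, heL, heT⟩ := hf.exists_idempotent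
  have hTL := hf.le
  have hgL : ∀ v ∈ L, linearAction g v - v ∈ π ^ m • (N ⊔ N') := fun v hv => (hg.1.1 v hv).1
  have hgT : ∀ v ∈ T, linearAction g v - v ∈ π ^ (m + 1) • L := fun v hv => (hg.2.1 v hv).1
  have hesmul : ∀ (a : Kˣ) (v : Fin (d + 1) → K), e (a • v) = a • e v := fun a v =>
    e.map_smul (a : K) v
  have hbase : ∀ i, f i ∈ L := fun i => by
    rw [← hf.span_eq]; exact Submodule.subset_span ⟨i, rfl⟩
  have hchoice : ∀ i, ∃ y : Fin (d + 1) → K, y ∈ π ^ m • N' ∧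
      linearAction g (f i) - f i - y ∈ π ^ m • N := by
    intro i
    have h1 := hgL _ (hbase i)
    rw [mem_units_smul] at h1
    obtain ⟨a, ha, b, hb, hab⟩ := Submodule.mem_sup.mp h1
    refine ⟨π ^ m • b, by rwa [mem_units_smul, inv_smul_smul], ?_⟩
    rw [mem_units_smul, smul_sub, inv_smul_smul, ← hab, add_sub_cancel_right]
    exact ha
  choose y hyN' hyN using hchoice
  let Z : (Fin (d + 1) → K) →ₗ[K] (Fin (d + 1) → K) := f.constr K y
  have hZf : ∀ i, Z (f i) = y i := fun i => f.constr_basis K y i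
  have hZL : ∀ v ∈ L, Z v ∈ π ^ m • N' := by
    have : Submodule.span 𝒪[K] (Set.range f) ≤ (π ^ m • N').comap (Z.restrictScalars 𝒪[K]) := by
      rw [Submodule.span_le]
      rintro _ ⟨i, rfl⟩
      change Z (f i) ∈ π ^ m • N'
      rw [hZf]
      exact hyN' i
    rw [hf.span_eq] at this
    exact fun v hv => this hv
  have hgZL : ∀ v ∈ L, linearAction g v - v - Z v ∈ π ^ m • N := by
    have : Submodule.span 𝒪[K] (Set.range f) ≤
        (π ^ m • N).comap ((linearAction g - LinearMap.id - Z).restrictScalars 𝒪[K]) := by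
      rw [Submodule.span_le]
      rintro _ ⟨i, rfl⟩
      change linearAction g (f i) - f i - Z (f i) ∈ π ^ m • N
      rw [hZf]
      exact hyN i
    rw [hf.span_eq] at this
    exact fun v hv => this hv
  let X : (Fin (d + 1) → K) →ₗ[K] (Fin (d + 1) → K) := e ∘ₗ Z ∘ₗ (LinearMap.id - e)
  have hX : ∀ v, X v = e (Z (v - e v)) := fun v => rfl
  have hX2 : ∀ v, X (X v) = 0 := by
    intro v
    rw [hX (X v), hX v, hee, sub_self, map_zero, map_zero]
  have heTsub : ∀ (a : Kˣ), ∀ v ∈ a • T, v - e v ∈ (a * π) • L := by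
    intro a v hv
    rw [mem_units_smul] at hv
    have h1 := heT _ hv
    rwa [hesmul, ← smul_sub, ← mem_units_smul, smul_smul] at h1
  have h1eL : ∀ v ∈ L, v - e v ∈ L := fun v hv => sub_mem hv (hTL (heL v hv))
  have hsub : ∀ v ∈ L, Z (v - e v) - X v ∈ π ^ (m + 1) • L := by
    intro v hv
    rw [pow_succ]
    exact heTsub _ _ (units_smul_mono _ hN'T (hZL _ (h1eL v hv)))
  have hle : ∀ {N : Submodule 𝒪[K] (Fin (d + 1) → K)}, π • L ≤ N →
      π ^ (m + 1) • L ≤ π ^ m • N := fun {N} h => by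
    rw [pow_succ, mul_smul]; exact units_smul_mono _ h
  have hXL : ∀ v ∈ L, X v ∈ π ^ m • N' := by
    intro v hv
    have h1 := sub_mem (hZL _ (h1eL v hv)) (hle hN' (hsub v hv))
    rwa [sub_sub_cancel] at h1
  have hXT : ∀ v ∈ T, X v ∈ π ^ (m + 1) • L := by
    intro v hv
    have h1 := heT v hv
    rw [mem_units_smul] at h1
    have h2 := hZL _ h1
    have h3 : Z (π⁻¹ • (v - e v)) = π⁻¹ • Z (v - e v) :=
      Z.map_smul ((π⁻¹ : Kˣ) : K) _
    rw [h3, ← mem_units_smul, smul_smul, ← pow_succ', mem_units_smul] at h2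
    rw [mem_units_smul, hX, ← hesmul]
    exact hTL (heL _ (hTL (hN'T h2)))
  obtain ⟨u, hu, hu'⟩ := exists_unipotent X hX2
  have hmN : π ^ m • N ≤ L := ((hπ.pow_smul_le N m).trans hNT).trans hTL
  have hmN' : π ^ m • N' ≤ L := ((hπ.pow_smul_le N' m).trans hN'T).trans hTL
  have hmL : π ^ (m + 1) • L ≤ T := (hle hN).trans ((hπ.pow_smul_le N m).trans hNT)
  have huQ : u ∈ filtrationSubgroup π m L T N' := by
    refine Subgroup.mem_inf.mpr ⟨?_, ?_⟩
    · rw [mem_moveSubgroup hmN']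
      exact ⟨fun v hv => by rw [hu, add_sub_cancel_left]; exact hXL v hv,
        fun v hv => by rw [hu', sub_sub_cancel_left]; exact neg_mem (hXL v hv)⟩
    · rw [mem_moveSubgroup hmL]
      exact ⟨fun v hv => by rw [hu, add_sub_cancel_left]; exact hXT v hv,
        fun v hv => by rw [hu', sub_sub_cancel_left]; exact neg_mem (hXT v hv)⟩
  have hT' : π • L ≤ T := hN.trans hNT
  have h1 : g * u⁻¹ ∈ filtrationSubgroup π m L T N := by
    refine Subgroup.mem_inf.mpr ⟨mul_inv_mem_moveSubgroup hmN (preserves_left_of_mem_filtrationSubgroup huQ)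
      (preserves_left_of_mem_filtrationSubgroup hg) fun v hv => ?_,
      mul_inv_mem_moveSubgroup hmL (preserves_of_mem_filtrationSubgroup hπ hT' le_rfl huQ)
      (preserves_of_mem_filtrationSubgroup hπ hT' le_rfl hg) fun v hv => ?_⟩
    -- On L, g - u = (g - 1)e + (g - 1 - Z)(1 - e) + (1 - e)Z(1 - e). The outer terms land in
    -- π^(m+1) L and the middle one in π^m N.
    · have h2 : linearAction g v - linearAction u v =
          (linearAction g (e v) - e v) +
            (linearAction g (v - e v) - (v - e v) - Z (v - e v)) + (Z (v - e v) - X v) := by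
        rw [hu, map_sub (linearAction g)]
        abel
      rw [h2]
      exact add_mem (add_mem (hle hN (hgT _ (heL v hv))) (hgZL _ (h1eL v hv)))
        (hle hN (hsub v hv))
    · have h2 : linearAction g v - linearAction u v = (linearAction g v - v) - X v := by
        rw [hu]
        abel
      rw [h2]
      exact sub_mem (hgT v hv) (hXT v hv)
  have h2 : g = g * u⁻¹ * u := by group
  rw [h2]
  exact mul_mem (Subgroup.mem_sup_left h1) (Subgroup.mem_sup_right huQ)

end FiltrationSubgroups

/-! ### The filtration subgroups are pro-p -/

section ProP

variable {K : Type*} [Field K] [ValuativeRel K] [TopologicalSpace K]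
  [IsNonarchimedeanLocalField K] {d : ℕ} {π : Kˣ} (hπ : IsUniformizer π)
  {L T N : Submodule 𝒪[K] (Fin (d + 1) → K)} {m : ℕ} {g : GL (Fin (d + 1)) K}
  {p : ℕ} [CharP 𝓀[K] p]

include hπ

theorem IsUniformizer.natCast_smul_mem {E : Type*} [AddCommGroup E] [Module K E]
    (B : Submodule 𝒪[K] E) {v : E} (hv : v ∈ B) : p • v ∈ π • B := by
  obtain ⟨ϖ, hϖ, h⟩ := hπ
  have h1 : (p : 𝒪[K]) ∈ 𝓂[K] := by
    rw [← IsLocalRing.residue_eq_zero_iff, map_natCast, CharP.cast_eq_zero]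
  have h2 : ϖ ∣ (p : 𝒪[K]) := (hϖ.maximalIdeal_eq ▸ h1 : (p : 𝒪[K]) ∈ Ideal.span {ϖ}) |>
    Ideal.mem_span_singleton.mp
  obtain ⟨a, ha⟩ := h2
  have h3 : p • v = π • a • v := by
    rw [← Nat.cast_smul_eq_nsmul 𝒪[K], ha, mul_smul, Units.smul_def, ← h]
    rfl
  rw [h3, mem_units_smul, inv_smul_smul]
  exact B.smul_mem a hv

/-- Once g - 1 maps L to πL, each further p-th power gains a factor `π`, because p is divisible by
`π`. The first p-th power is supplied by `hgp`. -/
theorem pow_pow_mem_moveSubgroup (hg : Preserves g L) (hgp : g ^ p ∈ moveSubgroup L (π • L))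
    (j : ℕ) : g ^ p ^ j ∈ moveSubgroup L (π ^ j • L) := by
  induction j with
  | zero =>
    rw [pow_zero, pow_zero, pow_one, one_smul, mem_moveSubgroup le_rfl]
    exact ⟨fun v hv => sub_mem (hg.1 v hv) hv, fun v hv => sub_mem (hg.2 v hv) hv⟩
  | succ j ih =>
    rcases Nat.eq_zero_or_pos j with rfl | hj
    · simpa using hgp
    rw [pow_succ p, pow_mul]
    have h1 : π ^ (j + 1) • L = π ^ j • π • L := by rw [pow_succ, mul_smul]
    refine pow_mem_moveSubgroup (hπ.pow_smul_le L j) (hπ.pow_smul_anti L j.le_succ) ih ?_ ?_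
    · rw [h1, moveSubgroup_smul]
      refine moveSubgroup_mono ?_ ih
      simpa using hπ.pow_smul_anti L hj
    · intro v hv
      rw [pow_succ', mul_smul]
      exact hπ.natCast_smul_mem _ hv

/-- For m = 0 the element need not be trivial modulo πL, but g - 1 maps L into T and T into πL. So
it is unipotent of step two modulo πL, and its p-th power is trivial there. -/
theorem pow_mem_of_mem_filtrationSubgroup (hN : π • L ≤ N) (hNT : N ≤ T) (hTL : T ≤ L)
    (hg : g ∈ filtrationSubgroup π m L T N) : g ^ p ∈ moveSubgroup L (π • L) := by
  refine pow_mem_moveSubgroup hTL (hN.trans hNT)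
    (moveSubgroup_mono ((hπ.pow_smul_le N m).trans hNT) hg.1)
    (filtrationSubgroup_le_moveSubgroup hπ hg) fun v hv => ?_
  exact units_smul_mono _ hTL (hπ.natCast_smul_mem T hv)

-- A class is determined by the action on finitely many generators of L modulo π^k L, which leaves
-- finitely many possibilities.
omit [CharP 𝓀[K] p] in
theorem finite_quotient_moveSubgroup (hL : Submodule.IsLattice K L)
    {H : Subgroup (GL (Fin (d + 1)) K)} (hH : ∀ g ∈ H, Preserves g L) (k : ℕ) :
    ((moveSubgroup L (π ^ k • L)).subgroupOf H).Normal ∧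
      Finite (H ⧸ (moveSubgroup L (π ^ k • L)).subgroupOf H) := by
  have hnormal : ((moveSubgroup L (π ^ k • L)).subgroupOf H).Normal :=
    ⟨fun h hh g => conj_mem_moveSubgroup (hH g g.2) ((hH g g.2).smul _) hh⟩
  refine ⟨hnormal, ?_⟩
  have := hπ.finite_quotient hL (le_refl (π ^ k • L))
  obtain ⟨S, hS⟩ := hL.fg
  have hSL : ∀ s : S, (s : Fin (d + 1) → K) ∈ L := fun s => by
    rw [← hS]; exact Submodule.subset_span s.2
  let F : (H ⧸ (moveSubgroup L (π ^ k • L)).subgroupOf H) →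
      S → L ⧸ (π ^ k • L).comap L.subtype := fun q s =>
    Submodule.Quotient.mk ⟨linearAction q.out.1 s, (hH _ q.out.2).1 _ (hSL s)⟩
  refine Finite.of_injective F fun q q' hqq => ?_
  have h1 : L ≤ (π ^ k • L).comap
      ((linearAction q.out.1 - linearAction q'.out.1).restrictScalars 𝒪[K]) := by
    conv_lhs => rw [← hS]
    rw [Submodule.span_le]
    intro s hs
    exact (Submodule.Quotient.eq _).mp (congrFun hqq ⟨s, hs⟩)
  have h2 : q.out.1 * q'.out.1⁻¹ ∈ moveSubgroup L (π ^ k • L) :=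
    mul_inv_mem_moveSubgroup (hπ.pow_smul_le L k) (hH _ q'.out.2) (hH _ q.out.2) h1
  rw [← QuotientGroup.out_eq' q, ← QuotientGroup.out_eq' q', eq_comm, QuotientGroup.eq]
  exact hnormal.mem_comm h2

/-- Averaging operators exist for the filtration subgroups, which are pro-`p`. -/
theorem exists_averaging_filtrationSubgroup {R V : Type*} [CommRing R] [AddCommGroup V]
    [Module R V] (hp : IsUnit (p : R)) (ρ : Representation R (GL (Fin (d + 1)) K) V)
    (hL : Submodule.IsLattice K L)
    (hsmooth : ∀ v, ∃ k : ℕ, ∀ g ∈ moveSubgroup L (π ^ k • L), ρ g v = v)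
    (hN : π • L ≤ N) (hNT : N ≤ T) (hTL : T ≤ L) :
    ∃ q : V →ₗ[R] V, (∀ h ∈ filtrationSubgroup π m L T N, ∀ v, ρ h (q v) = q v) ∧
      (∀ v, (∀ h ∈ filtrationSubgroup π m L T N, ρ h v = v) → q v = v) ∧
      (∀ h ∈ filtrationSubgroup π m L T N, ∀ v, q (ρ h v) = q v) ∧
      (∀ φ : V →ₗ[R] V, (∀ h ∈ filtrationSubgroup π m L T N, ∀ v, φ (ρ h v) = φ v) →
        ∀ v, φ (q v) = φ v) ∧
      ∀ S : Submodule R V, (∀ h ∈ filtrationSubgroup π m L T N, ∀ v ∈ S, ρ h v ∈ S) →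
        ∀ v ∈ S, q v ∈ S := by
  have hH : ∀ g ∈ filtrationSubgroup π m L T N, Preserves g L :=
    fun _ => preserves_left_of_mem_filtrationSubgroup
  set H := filtrationSubgroup π m L T N with hHdef
  have hprime : p.Prime := by
    refine (CharP.char_is_prime_or_zero 𝓀[K] p).resolve_right fun h0 => ?_
    subst h0
    have : CharZero 𝓀[K] := CharP.charP_to_charZero 𝓀[K]
    have : Infinite 𝓀[K] := inferInstance
    exact not_finite 𝓀[K]
  have : Fact p.Prime := ⟨hprime⟩
  obtain ⟨q, h1, h2, h5, h3, h4⟩ := exists_averaging (ρ.comp H.subtype)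
    (fun k => (moveSubgroup L (π ^ k • L)).subgroupOf H)
    (fun j k hjk => Subgroup.comap_mono (moveSubgroup_mono (hπ.pow_smul_anti L hjk)))
    (fun k => (finite_quotient_moveSubgroup hπ hL hH k).1)
    (fun k => (finite_quotient_moveSubgroup hπ hL hH k).2)
    (fun k => by
      have := (finite_quotient_moveSubgroup hπ hL hH k).1
      have := (finite_quotient_moveSubgroup hπ hL hH k).2
      have hpg : IsPGroup p (H ⧸ (moveSubgroup L (π ^ k • L)).subgroupOf H) := by
        intro x
        obtain ⟨g, rfl⟩ := QuotientGroup.mk_surjective x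
        refine ⟨k, ?_⟩
        rw [← QuotientGroup.mk_pow, QuotientGroup.eq_one_iff]
        exact pow_pow_mem_moveSubgroup hπ (hH g g.2)
          (pow_mem_of_mem_filtrationSubgroup hπ hN hNT hTL g.2) k
      obtain ⟨j, hj⟩ := IsPGroup.iff_card.mp hpg
      rw [hj, Nat.cast_pow]
      exact hp.pow j)
    (fun v => by
      obtain ⟨k, hk⟩ := hsmooth v
      exact ⟨k, fun u hu => hk u hu⟩)
  exact ⟨q, fun h hh => h1 ⟨h, hh⟩, fun v hv => h2 v fun h => hv h h.2,
    fun h hh => h5 ⟨h, hh⟩, fun φ hφ => h3 φ fun h => hφ h h.2, fun S hS => h4 S fun h => hS h h.2⟩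

end ProP

/-- The stabilizer of a vector of a representation. -/
def vectorStabilizer {R G V : Type*} [CommRing R] [Group G] [AddCommGroup V] [Module R V]
    (ρ : Representation R G V) (v : V) : Subgroup G where
  carrier := {g | ρ g v = v}
  one_mem' := by simp
  mul_mem' := by
    intro g h hg hh
    change ρ (g * h) v = v
    rw [map_mul, Module.End.mul_apply, hh, hg]
  inv_mem' := by
    intro g hg
    change ρ g⁻¹ v = v
    conv_lhs => rw [← (hg : ρ g v = v)]
    rw [← Module.End.mul_apply, ← map_mul, inv_mul_cancel, map_one, Module.End.one_apply]

theorem mem_fixedBy_iff_le_vectorStabilizer {R G V : Type*} [CommRing R] [Group G]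
    [AddCommGroup V] [Module R V] {ρ : Representation R G V} {Γ : Subgroup G} {v : V} :
    v ∈ fixedBy ρ Γ ↔ Γ ≤ vectorStabilizer ρ v :=
  ⟨fun h g hg => h ⟨g, hg⟩, fun h g => h g.2⟩

/-! ### Congruence subgroups described by lattices -/

section CongruenceSubgroups

variable {K : Type*} [Field K] [ValuativeRel K] {d : ℕ}

theorem mem_standardLattice {v : Fin (d + 1) → K} :
    v ∈ (standardLattice K d).1 ↔ ∃ a : Fin (d + 1) → 𝒪[K], ∀ i, v i = a i := by
  rw [standardLattice, Module.Basis.mem_span_iff_repr_mem 𝒪[K] (Pi.basisFun K (Fin (d + 1))) v]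
  refine Iff.trans (forall_congr' fun i => ?_)
    (Classical.skolem (p := fun i (a : 𝒪[K]) => v i = a))
  exact ⟨fun ⟨a, ha⟩ => ⟨a, ha.symm⟩, fun ⟨a, ha⟩ => ⟨a, ha.symm⟩⟩

theorem mem_pow_smul_standardLattice {π : Kˣ} {n : ℕ} {v : Fin (d + 1) → K} :
    v ∈ π ^ n • (standardLattice K d).1 ↔
      ∃ a : Fin (d + 1) → 𝒪[K], ∀ i, v i = (π : K) ^ n * a i := by
  rw [mem_units_smul, mem_standardLattice]
  refine exists_congr fun a => forall_congr' fun i => ?_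
  have h0 : (π : K) ^ n ≠ 0 := pow_ne_zero _ π.ne_zero
  have h1 : ((π ^ n)⁻¹ • v) i = ((π : K) ^ n)⁻¹ * v i := by
    simp [Units.smul_def]
  rw [h1, inv_mul_eq_iff_eq_mul₀ h0]

/-- An element of `GL_{d+1}(K)` moves vectors of the standard lattice by multiples of `π ^ n` if
and only if this holds for its matrix entries. -/
theorem forall_standardLattice_iff {π : Kˣ} {n : ℕ} {g : GL (Fin (d + 1)) K} :
    (∀ v ∈ (standardLattice K d).1,
      linearAction g v - v ∈ π ^ n • (standardLattice K d).1) ↔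
    ∃ b : Matrix (Fin (d + 1)) (Fin (d + 1)) 𝒪[K],
      ∀ i j, g.1 i j = (1 : Matrix _ _ K) i j + (π : K) ^ n * b i j := by
  constructor
  · intro h
    have h1 : ∀ j, ∃ a : Fin (d + 1) → 𝒪[K], ∀ i,
        g.1 i j = (1 : Matrix _ _ K) i j + (π : K) ^ n * a i := by
      intro j
      have h2 := h (Pi.single j 1) (mem_standardLattice.mpr ⟨Pi.single j 1, fun i => by
        rcases eq_or_ne i j with rfl | hij
        · simp
        · simp [hij]⟩)
      obtain ⟨a, ha⟩ := mem_pow_smul_standardLattice.mp h2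
      refine ⟨a, fun i => ?_⟩
      rw [← ha i, linearAction, Matrix.toLin'_apply, Matrix.mulVec_single_one]
      simp [Matrix.one_apply, Pi.single_apply]
    choose a ha using h1
    exact ⟨fun i j => a j i, fun i j => ha j i⟩
  · rintro ⟨b, hb⟩ v hv
    obtain ⟨a, ha⟩ := mem_standardLattice.mp hv
    refine mem_pow_smul_standardLattice.mpr ⟨b.mulVec a, fun i => ?_⟩
    have h1 : g.1 = 1 + (π : K) ^ n • b.map (algebraMap 𝒪[K] K) := by
      ext i j
      rw [hb i j]
      rfl
    have h2 : v = algebraMap 𝒪[K] K ∘ a := funext ha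
    rw [linearAction, Matrix.toLin'_apply, h1, Matrix.add_mulVec, Matrix.one_mulVec,
      add_sub_cancel_left, Matrix.smul_mulVec, Pi.smul_apply, smul_eq_mul, h2,
      ← RingHom.map_mulVec]
    rfl

theorem IsUniformizer.mem_maximalIdeal_pow [TopologicalSpace K] [IsNonarchimedeanLocalField K]
    {π : Kˣ} (hπ : IsUniformizer π) {n : ℕ} {a : 𝒪[K]} :
    a ∈ 𝓂[K] ^ n ↔ ∃ b : 𝒪[K], (a : K) = (π : K) ^ n * b := by
  obtain ⟨ϖ, hϖ, h⟩ := hπ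
  rw [hϖ.maximalIdeal_eq, Ideal.span_singleton_pow, Ideal.mem_span_singleton, ← h]
  refine exists_congr fun b => ?_
  rw [Subtype.ext_iff]
  rfl

theorem standardCongruenceSubgroup_eq [TopologicalSpace K] [IsNonarchimedeanLocalField K]
    {π : Kˣ} (hπ : IsUniformizer π) (n : ℕ) : standardCongruenceSubgroup K d n =
      moveSubgroup (standardLattice K d).1 (π ^ n • (standardLattice K d).1) := by
  ext g
  rw [mem_moveSubgroup (hπ.pow_smul_le _ _), forall_standardLattice_iff,
    forall_standardLattice_iff]
  constructor
  · rintro ⟨h, hh, rfl⟩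
    have key : ∀ h : GL (Fin (d + 1)) 𝒪[K], h ∈ (Matrix.GeneralLinearGroup.map
        (n := Fin (d + 1)) (Ideal.Quotient.mk (𝓂[K] ^ n))).ker →
        ∃ b : Matrix (Fin (d + 1)) (Fin (d + 1)) 𝒪[K], ∀ i j,
          (Matrix.GeneralLinearGroup.map (algebraMap 𝒪[K] K) h).1 i j =
            (1 : Matrix _ _ K) i j + (π : K) ^ n * b i j := by
      intro h hh
      have h1 : ∀ i j, ∃ b : 𝒪[K], ((h.1 i j - (1 : Matrix _ _ 𝒪[K]) i j : 𝒪[K]) : K) =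
          (π : K) ^ n * b := by
        intro i j
        rw [← hπ.mem_maximalIdeal_pow, ← Ideal.Quotient.eq_zero_iff_mem, map_sub,
          ← Matrix.GeneralLinearGroup.map_apply, MonoidHom.mem_ker.mp hh]
        rcases eq_or_ne i j with rfl | hij
        · simp
        · simp [hij]
      choose b hb using h1
      refine ⟨b, fun i j => ?_⟩
      rw [← hb i j, Matrix.GeneralLinearGroup.map_apply]
      change (h.1 i j : K) = _
      rcases eq_or_ne i j with rfl | hij
      · simp
      · simp [hij]
    refine ⟨key h hh, ?_⟩
    rw [← map_inv]
    exact key _ (inv_mem hh)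
  -- The conditions on `g` and on `g⁻¹` give two integral matrices. They are inverse to each other
  -- over `K`, hence over the valuation ring.
  · rintro ⟨⟨b, hb⟩, ⟨b', hb'⟩⟩
    obtain ⟨ϖ, hϖ, hϖπ⟩ := id hπ
    have hmap : ∀ (g : Matrix (Fin (d + 1)) (Fin (d + 1)) K) (b : Matrix _ _ 𝒪[K]),
        (∀ i j, g i j = (1 : Matrix _ _ K) i j + (π : K) ^ n * b i j) →
        (algebraMap 𝒪[K] K).mapMatrix (1 + ϖ ^ n • b) = g := by
      intro g b hb
      ext i j
      rw [hb, ← hϖπ, map_add, map_one]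
      rfl
    have hinj : ∀ {b b' : Matrix (Fin (d + 1)) (Fin (d + 1)) 𝒪[K]},
        (algebraMap 𝒪[K] K).mapMatrix b = (algebraMap 𝒪[K] K).mapMatrix b' → b = b' :=
      fun h => Matrix.map_injective Subtype.val_injective h
    have h1 := hmap _ b hb
    have h2 := hmap _ b' hb'
    refine ⟨⟨1 + ϖ ^ n • b, 1 + ϖ ^ n • b', hinj ?_, hinj ?_⟩, ?_, ?_⟩
    · rw [map_mul, h1, h2, map_one]; exact g.mul_inv
    · rw [map_mul, h1, h2, map_one]; exact g.inv_mul
    · rw [SetLike.mem_coe, MonoidHom.mem_ker]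
      refine Matrix.GeneralLinearGroup.ext fun i j => ?_
      rw [Matrix.GeneralLinearGroup.map_apply]
      have h3 : Ideal.Quotient.mk (𝓂[K] ^ n) (ϖ ^ n) = 0 := by
        rw [Ideal.Quotient.eq_zero_iff_mem, hϖ.maximalIdeal_eq]
        exact Ideal.pow_mem_pow (Ideal.mem_span_singleton_self ϖ) n
      change Ideal.Quotient.mk (𝓂[K] ^ n) ((1 : Matrix _ _ 𝒪[K]) i j + ϖ ^ n * b i j) = _
      rw [map_add, map_mul, h3, zero_mul,
        add_zero]
      rcases eq_or_ne i j with rfl | hij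
      · simp
      · simp [hij]
    · exact Units.ext h1

/-- The lattice `g L`. -/
def translateSubmodule (g : GL (Fin (d + 1)) K) (L : Submodule 𝒪[K] (Fin (d + 1) → K)) :
    Submodule 𝒪[K] (Fin (d + 1) → K) :=
  L.map ((linearAction g).restrictScalars 𝒪[K])

theorem mem_translateSubmodule {g : GL (Fin (d + 1)) K} {L : Submodule 𝒪[K] (Fin (d + 1) → K)}
    {v : Fin (d + 1) → K} : v ∈ translateSubmodule g L ↔ linearAction g⁻¹ v ∈ L := by
  refine Submodule.mem_map.trans ⟨?_, fun h => ⟨_, h, linearAction_apply_inv g v⟩⟩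
  rintro ⟨w, hw, rfl⟩
  simpa using hw

theorem translateSubmodule_smul (g : GL (Fin (d + 1)) K)
    (L : Submodule 𝒪[K] (Fin (d + 1) → K)) (a : Kˣ) :
    translateSubmodule g (a • L) = a • translateSubmodule g L := by
  ext v
  rw [mem_translateSubmodule, mem_units_smul, mem_units_smul, mem_translateSubmodule,
    linearAction_units_smul]

theorem map_conj_moveSubgroup (g : GL (Fin (d + 1)) K)
    (L A : Submodule 𝒪[K] (Fin (d + 1) → K)) :
    (moveSubgroup L A).map (MulAut.conj g).toMonoidHom =
      moveSubgroup (translateSubmodule g L) (translateSubmodule g A) := by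
  have key : ∀ (g h : GL (Fin (d + 1)) K) (L A : Submodule 𝒪[K] (Fin (d + 1) → K)),
      h ∈ moveSubgroup L A →
      g * h * g⁻¹ ∈ moveSubgroup (translateSubmodule g L) (translateSubmodule g A) := by
    intro g h L A hh
    have h1 : ∀ h : GL (Fin (d + 1)) K, (∀ v ∈ L, linearAction h v - v ∈ A ⊓ L) →
        ∀ v ∈ translateSubmodule g L, linearAction (g * h * g⁻¹) v - v ∈
          translateSubmodule g A ⊓ translateSubmodule g L := by
      intro h hh v hv
      rw [mem_translateSubmodule] at hv
      rw [Submodule.mem_inf, mem_translateSubmodule, mem_translateSubmodule, map_sub,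
        linearAction_mul, linearAction_mul, linearAction_inv_apply]
      exact hh _ hv
    refine ⟨h1 h hh.1, ?_⟩
    have : (g * h * g⁻¹)⁻¹ = g * h⁻¹ * g⁻¹ := by group
    rw [this]
    exact h1 _ hh.2
  have hinv : ∀ L : Submodule 𝒪[K] (Fin (d + 1) → K),
      translateSubmodule g⁻¹ (translateSubmodule g L) = L := by
    intro L
    ext v
    rw [mem_translateSubmodule, mem_translateSubmodule, inv_inv, linearAction_inv_apply]
  ext h
  constructor
  · rintro ⟨h, hh, rfl⟩
    exact key g h L A hh
  · intro hh
    refine ⟨g⁻¹ * h * g, ?_, by simp [mul_assoc]⟩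
    have := key g⁻¹ h _ _ hh
    rwa [hinv, hinv, inv_inv] at this

variable [TopologicalSpace K] [IsNonarchimedeanLocalField K] {π : Kˣ}

/-- The congruence subgroup of a vertex consists of the automorphisms of its lattice that are
congruent to `1`. -/
theorem vertexCongruenceSubgroup_eq (hπ : IsUniformizer π) (n : ℕ) (s : Vertex K d) :
    vertexCongruenceSubgroup n s =
      moveSubgroup (normalizedLattice hπ s) (π ^ n • normalizedLattice hπ s) := by
  have h1 : ∀ g : GL (Fin (d + 1)) K, Vertex.translate g (standardVertex K d) = s →
      (standardCongruenceSubgroup K d n).map (MulAut.conj g).toMonoidHom =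
        moveSubgroup (normalizedLattice hπ s) (π ^ n • normalizedLattice hπ s) := by
    rintro g rfl
    obtain ⟨k, hk⟩ := exists_zpow_normalizedLattice hπ
      (Lattice.translate g (standardLattice K d))
    have h2 : normalizedLattice hπ (Vertex.translate g (standardVertex K d)) =
        π ^ k • translateSubmodule g (standardLattice K d).1 := hk
    rw [h2, smul_comm, moveSubgroup_smul, standardCongruenceSubgroup_eq hπ,
      map_conj_moveSubgroup, translateSubmodule_smul]
  -- All members of the supremum agree by `h1`. Transitivity on vertices, from a basis of the
  -- lattice, ensures that the supremum is not over an empty family.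
  have h2 : ∃ g : GL (Fin (d + 1)) K, Vertex.translate g (standardVertex K d) = s := by
    obtain ⟨f, hf⟩ := hπ.exists_adapted_chain (isLattice_normalizedLattice hπ s)
      {normalizedLattice hπ s} (by simpa using hπ.smul_le _) (by simp)
    have hf := (hf _ (Finset.mem_singleton_self _)).span_eq
    let e := (Pi.basisFun K (Fin (d + 1))).equiv f (Equiv.refl _)
    obtain ⟨g, hg, -⟩ := exists_linearAction_eq e.toLinearMap e.symm.toLinearMap
      (fun v => e.apply_symm_apply v) (fun v => e.symm_apply_apply v)
    refine ⟨g, ?_⟩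
    have h3 : Lattice.translate g (standardLattice K d) =
        ⟨normalizedLattice hπ s, isLattice_normalizedLattice hπ s⟩ := by
      refine Subtype.ext ?_
      change (Submodule.span 𝒪[K] (Set.range (Pi.basisFun K (Fin (d + 1))))).map
        ((linearAction g).restrictScalars 𝒪[K]) = _
      rw [Submodule.map_span, ← Set.range_comp, hg]
      refine Eq.trans ?_ hf
      congr 2
      funext i
      exact (Module.Basis.equiv_apply _ i _ _)
    rw [← toVertex_normalizedLattice hπ s, ← h3]
    rfl
  rw [vertexCongruenceSubgroup]
  refine le_antisymm (iSup₂_le fun g hg => (h1 g hg).le) ?_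
  obtain ⟨g, hg⟩ := h2
  rw [← h1 g hg]
  exact le_iSup₂ (f := fun (g : GL (Fin (d + 1)) K)
    (_ : Vertex.translate g (standardVertex K d) = s) =>
      (standardCongruenceSubgroup K d n).map (MulAut.conj g).toMonoidHom) g hg

theorem mem_fixedBy_congruenceSubgroup {R V : Type*} [CommRing R] [AddCommGroup V] [Module R V]
    {ρ : Representation R (GL (Fin (d + 1)) K) V} (hπ : IsUniformizer π) {n : ℕ}
    {σ : Finset (Vertex K d)} {v : V} : v ∈ fixedBy ρ (congruenceSubgroup n σ) ↔
      ∀ s ∈ σ, moveSubgroup (normalizedLattice hπ s) (π ^ n • normalizedLattice hπ s) ≤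
        vectorStabilizer ρ v := by
  rw [mem_fixedBy_iff_le_vectorStabilizer, congruenceSubgroup, iSup₂_le_iff]
  simp only [vertexCongruenceSubgroup_eq hπ]

end CongruenceSubgroups

/-! ### Smooth vectors are fixed by deep congruence subgroups -/

section Smoothness

theorem exists_pi_subset_of_mem_nhds {ι : Type*} [Finite ι] {X : ι → Type*}
    [∀ i, TopologicalSpace (X i)] {x : ∀ i, X i} {B : ∀ i, ℕ → Set (X i)}
    (hanti : ∀ i, Antitone (B i)) (hB : ∀ i, ∀ s ∈ nhds (x i), ∃ k, B i k ⊆ s)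
    {s : Set (∀ i, X i)} (hs : s ∈ nhds x) : ∃ k, {y | ∀ i, y i ∈ B i k} ⊆ s := by
  have := Fintype.ofFinite ι
  rw [nhds_pi, Filter.mem_pi] at hs
  obtain ⟨I, -, t, ht, hI⟩ := hs
  choose k hk using fun i => hB i (t i) (ht i)
  refine ⟨Finset.univ.sup k, fun y hy => hI fun i _ => hk i ?_⟩
  exact hanti i (Finset.le_sup (Finset.mem_univ i)) (hy i)

variable {K : Type*} [Field K] [ValuativeRel K] [TopologicalSpace K]
  [IsNonarchimedeanLocalField K] {d : ℕ} {π : Kˣ} (hπ : IsUniformizer π)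
include hπ

/-- The neighbourhoods of a point of `K` contain balls, in terms of powers of a uniformizer. -/
theorem IsUniformizer.exists_ball_subset {x : K} {s : Set K} (hs : s ∈ nhds x) :
    ∃ k : ℕ, {y | ∃ b : 𝒪[K], y = x + (π : K) ^ k * b} ⊆ s := by
  obtain ⟨γ, hγ⟩ := IsValuativeTopology.mem_nhds_iff.mp hs
  obtain ⟨c, hc⟩ := ValuativeRel.valuation_surjective (γ : ValuativeRel.ValueGroupWithZero K)
  have hc0 : c ≠ 0 := by
    rintro rfl
    rw [map_zero] at hc
    exact γ.ne_zero hc.symm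
  obtain ⟨k, a, ha⟩ := hπ.exists_zpow_mul_mem c⁻¹
  obtain ⟨ϖ, hϖ, h⟩ := hπ
  -- π^k c⁻¹ is integral, so π^k times an integer has valuation at most γ; the extra factor `π`
  -- makes the inequality strict.
  refine ⟨k + 1, ?_⟩
  rintro _ ⟨b, rfl⟩
  refine hγ ⟨_, ?_, rfl⟩
  have h1 : (π : K) ^ (k + 1) * b = c * ((ϖ * (a * b) : 𝒪[K]) : K) := by
    push_cast
    rw [ha, h]
    field_simp
    ring
  have h2 : ValuativeRel.valuation K (ϖ * (a * b) : 𝒪[K]) < 1 := by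
    push_cast
    rw [map_mul]
    exact mul_lt_one_of_lt_of_le (Valuation.integer.v_irreducible_lt_one hϖ) (a * b).2
  rw [Set.mem_ofPred_eq, h1, map_mul, hc]
  exact mul_lt_of_lt_one_right γ.zero_lt h2

theorem IsUniformizer.exists_moveSubgroup_subset {S : Set (GL (Fin (d + 1)) K)}
    (hS : S ∈ nhds (1 : GL (Fin (d + 1)) K)) : ∃ k : ℕ,
      (moveSubgroup (standardLattice K d).1 (π ^ k • (standardLattice K d).1) :
        Set (GL (Fin (d + 1)) K)) ⊆ S := by
  have hmat : ∀ s ∈ nhds (1 : Matrix (Fin (d + 1)) (Fin (d + 1)) K), ∃ k : ℕ,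
      {A | ∀ i j, ∃ b : 𝒪[K], A i j = (1 : Matrix _ _ K) i j + (π : K) ^ k * b} ⊆ s := by
    have hanti : ∀ x : K, Antitone fun k : ℕ => {y | ∃ b : 𝒪[K], y = x + (π : K) ^ k * b} := by
      rintro x j k hjk y ⟨b, rfl⟩
      obtain ⟨m, rfl⟩ := Nat.exists_eq_add_of_le hjk
      obtain ⟨ϖ, hϖ, h⟩ := id hπ
      refine ⟨ϖ ^ m * b, ?_⟩
      push_cast
      rw [h, pow_add, mul_assoc]
    intro s hs
    exact exists_pi_subset_of_mem_nhds (B := fun i k =>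
        {y | ∀ j, ∃ b : 𝒪[K], y j = (1 : Matrix _ _ K) i j + (π : K) ^ k * b})
      (fun i j k hjk y hy l => hanti _ hjk (hy l))
      (fun i t ht => exists_pi_subset_of_mem_nhds (fun j => hanti ((1 : Matrix _ _ K) i j))
        (fun j u hu => hπ.exists_ball_subset hu) ht) hs
  -- The topology of the unit group is induced by g ↦ (g, g⁻¹), matching the two conditions that
  -- define `moveSubgroup`.
  rw [Units.isEmbedding_embedProduct.nhds_eq_comap, Filter.mem_comap] at hS
  obtain ⟨t, ht, htS⟩ := hS
  obtain ⟨u, hu, w, hw, huw⟩ := mem_nhds_prod_iff.mp ht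
  have hw' : MulOpposite.op ⁻¹' w ∈ nhds (1 : Matrix (Fin (d + 1)) (Fin (d + 1)) K) :=
    MulOpposite.continuous_op.continuousAt.preimage_mem_nhds (by simpa using hw)
  obtain ⟨j, hj⟩ := hmat u (by simpa using hu)
  obtain ⟨k, hk⟩ := hmat _ hw'
  refine ⟨max j k, fun g hg => htS (huw ⟨hj fun i l => ?_, hk fun i l => ?_⟩)⟩
  · have h1 := moveSubgroup_mono (hπ.pow_smul_anti _ (le_max_left j k)) hg
    rw [mem_moveSubgroup (hπ.pow_smul_le _ _)] at h1
    obtain ⟨b, hb⟩ := forall_standardLattice_iff.mp h1.1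
    exact ⟨b i l, hb i l⟩
  · have h1 := moveSubgroup_mono (hπ.pow_smul_anti _ (le_max_right j k)) hg
    rw [mem_moveSubgroup (hπ.pow_smul_le _ _)] at h1
    obtain ⟨b, hb⟩ := forall_standardLattice_iff.mp h1.2
    exact ⟨b i l, hb i l⟩

/-- If π^a L' ≤ L and π^b L ≤ L', depth a + k + b suffices: rescaling a vector of L' into L costs
`a`, and returning to L' costs `b`. -/
theorem IsUniformizer.exists_moveSubgroup_le {L L' : Submodule 𝒪[K] (Fin (d + 1) → K)}
    (hL : Submodule.IsLattice K L) (hL' : Submodule.IsLattice K L') (k : ℕ) :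
    ∃ j : ℕ, moveSubgroup L (π ^ j • L) ≤ moveSubgroup L' (π ^ k • L') := by
  obtain ⟨a, ha⟩ := hπ.exists_pow_smul_le hL'.fg hL.span_eq_top
  obtain ⟨b, hb⟩ := hπ.exists_pow_smul_le hL.fg hL'.span_eq_top
  refine ⟨a + (k + b), fun g hg => ?_⟩
  rw [mem_moveSubgroup (hπ.pow_smul_le _ _)] at hg ⊢
  have key : ∀ h : GL (Fin (d + 1)) K,
      (∀ v ∈ L, linearAction h v - v ∈ π ^ (a + (k + b)) • L) →
      ∀ v ∈ L', linearAction h v - v ∈ π ^ k • L' := by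
    intro h hh v hv
    have h1 := hh (π ^ a • v) (ha (by rwa [mem_units_smul, inv_smul_smul]))
    rw [linearAction_units_smul, ← smul_sub, pow_add, mul_smul, mem_units_smul,
      inv_smul_smul, pow_add, mul_smul] at h1
    exact units_smul_mono _ hb h1
  exact ⟨key g hg.1, key _ hg.2⟩

variable {A V : Type*} [CommRing A] [AddCommGroup V] [Module A V]
  {ρ : Representation A (GL (Fin (d + 1)) K) V}

theorem IsSmooth.exists_moveSubgroup_fixed (hρ : IsSmooth ρ) (v : V) :
    ∃ k : ℕ, ∀ g ∈ moveSubgroup (standardLattice K d).1 (π ^ k • (standardLattice K d).1),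
      ρ g v = v :=
  hπ.exists_moveSubgroup_subset ((hρ v).mem_nhds (by simp))

/-- A tensor is a finite sum of pure tensors, and the congruence subgroups decrease, so one level
fixes all summands. -/
theorem IsSmooth.exists_moveSubgroup_fixed_baseChange (hρ : IsSmooth ρ)
    (Λ : Type*) [CommRing Λ] [Algebra A Λ] (v : Λ ⊗[A] V) :
    ∃ k : ℕ, ∀ g ∈ moveSubgroup (standardLattice K d).1 (π ^ k • (standardLattice K d).1),
      baseChange Λ ρ g v = v := by
  induction v using TensorProduct.induction_on with
  | zero => exact ⟨0, fun g _ => map_zero _⟩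
  | tmul a v =>
    obtain ⟨k, hk⟩ := hρ.exists_moveSubgroup_fixed hπ v
    refine ⟨k, fun g hg => ?_⟩
    change (ρ g).baseChange Λ (a ⊗ₜ v) = _
    rw [LinearMap.baseChange_tmul, hk g hg]
  | add v w hv hw =>
    obtain ⟨j, hj⟩ := hv
    obtain ⟨k, hk⟩ := hw
    refine ⟨max j k, fun g hg => ?_⟩
    rw [map_add, hj g (moveSubgroup_mono (hπ.pow_smul_anti _ (le_max_left j k)) hg),
      hk g (moveSubgroup_mono (hπ.pow_smul_anti _ (le_max_right j k)) hg)]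

end Smoothness

/-! ### Acyclicity of upper links and of convex subcomplexes -/

section Acyclicity

theorem apply_mem_vectorStabilizer_of_conj {R G V : Type*} [CommRing R] [Group G]
    [AddCommGroup V] [Module R V] {ρ : Representation R G V} {Γ : Subgroup G} {h : G}
    (hconj : ∀ g ∈ Γ, h⁻¹ * g * h ∈ Γ) {v : V} (hv : v ∈ fixedBy ρ Γ) :
    ρ h v ∈ fixedBy ρ Γ := by
  intro g
  have h1 : ρ (h⁻¹ * g * h) v = v := hv ⟨_, hconj g g.2⟩
  change ρ g (ρ h v) = ρ h v
  conv_rhs => rw [← h1]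
  rw [← Module.End.mul_apply, ← Module.End.mul_apply, ← map_mul, ← map_mul]
  congr 2
  group

variable {K : Type*} [Field K] [ValuativeRel K] {d : ℕ} {π : Kˣ}

/-- Elements of one filtration subgroup preserve L, T and every lattice between πL and T, hence
normalize all the others. This makes the averaging operators compatible. -/
theorem conj_mem_filtrationSubgroup (hπ : IsUniformizer π)
    {L T N N' : Submodule 𝒪[K] (Fin (d + 1) → K)} {m : ℕ} {g h : GL (Fin (d + 1)) K}
    (hN' : π • L ≤ N') (hN'T : N' ≤ T) (hh : h ∈ filtrationSubgroup π m L T N)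
    (hg : g ∈ filtrationSubgroup π m L T N') : h⁻¹ * g * h ∈ filtrationSubgroup π m L T N' := by
  have h1 := inv_mem hh
  have hL : Preserves h⁻¹ L := preserves_left_of_mem_filtrationSubgroup h1
  have hT : Preserves h⁻¹ T :=
    preserves_of_mem_filtrationSubgroup hπ (hN'.trans hN'T) le_rfl h1
  have hN : Preserves h⁻¹ N' := preserves_of_mem_filtrationSubgroup hπ hN' hN'T h1
  have h2 := conj_mem_moveSubgroup hL (hN.smul (π ^ m)) hg.1
  have h3 := conj_mem_moveSubgroup hT (hL.smul (π ^ (m + 1))) hg.2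
  rw [inv_inv] at h2 h3
  exact Subgroup.mem_inf.mpr ⟨h2, h3⟩

variable [TopologicalSpace K] [IsNonarchimedeanLocalField K] [LinearOrder (Vertex K d)] (hπ : IsUniformizer π) {ϖ : 𝒪[K]} (hϖ : (ϖ : K) = π)
  {Y : Subcomplex K d} (hY : GeodesicallyConvex ϖ Y.realization)
  {p : ℕ} [CharP 𝓀[K] p] {R V : Type*} [CommRing R] [AddCommGroup V] [Module R V]
  (hp : IsUnit (p : R)) {ρ : Representation R (GL (Fin (d + 1)) K) V}
  (hsmooth : ∀ v, ∃ k : ℕ,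
    ∀ g ∈ moveSubgroup (standardLattice K d).1 (π ^ k • (standardLattice K d).1), ρ g v = v)
include hπ hϖ hY hp hsmooth

/-- Acyclicity of the upper link of a vertex. -/
theorem exists_boundary_eq_of_upperLink {m : ℕ} {U : Finset (Vertex K d)}
    (hU : ∀ s ∈ U, ∀ t, normalizedLattice hπ s ≤ normalizedLattice hπ t → t ∈ U)
    {x : Vertex K d} (hx : x ∈ U) {k : ℕ} (hk : k ≠ 0) {c : Finset (Vertex K d) → V}
    (hc : IsChainOn (fun σ => fixedValues ρ (m + 1) Y (insert x σ))
      {t | normalizedLattice hπ x < normalizedLattice hπ t} k c)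
    (hcycle : boundary R U c = 0) :
    ∃ b, IsChainOn (fun σ => fixedValues ρ (m + 1) Y (insert x σ))
      {t | normalizedLattice hπ x < normalizedLattice hπ t} (k + 1) b ∧ boundary R U b = c := by
  classical
  set nrm := normalizedLattice (d := d) hπ with hnrm
  set M := nrm x with hMdef
  set L := π⁻¹ • M with hLdef
  have hML : π • L = M := smul_inv_smul π M
  have hM : Submodule.IsLattice K M := isLattice_normalizedLattice hπ x
  have hL : Submodule.IsLattice K L := Submodule.IsLattice.smul K M π⁻¹
  -- The vertices of `Y` that can occur in the upper link of `x`: their lattices lie strictly above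
  -- M = πL and inside L.
  set D := U.filter fun t => {t} ∈ Y.faces ∧ M < nrm t ∧ π • nrm t ≤ M with hDdef
  have hDU : D ⊆ U := Finset.filter_subset _ _
  have hDY : ∀ t ∈ D, {t} ∈ Y.faces := fun t ht => (Finset.mem_filter.mp ht).2.1
  have hDlt : ∀ t ∈ D, M < nrm t := fun t ht => (Finset.mem_filter.mp ht).2.2.1
  have hDπ : ∀ t ∈ D, π • nrm t ≤ M := fun t ht => (Finset.mem_filter.mp ht).2.2.2
  have hDL : ∀ t ∈ D, nrm t ≤ L := fun t ht => (units_smul_le_iff π _ _).mp (hDπ t ht)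
  have hDM : ∀ t ∈ D, π • L ≤ nrm t := fun t ht => hML.le.trans (hDlt t ht).le
  have hΓx : moveSubgroup M (π ^ (m + 1) • M) = moveSubgroup L (π ^ (m + 1) • L) := by
    rw [hLdef, smul_comm _ π⁻¹, moveSubgroup_smul]
  have hsmoothL : ∀ v, ∃ k : ℕ, ∀ g ∈ moveSubgroup L (π ^ k • L), ρ g v = v := by
    intro v
    obtain ⟨j, hj⟩ := hsmooth v
    obtain ⟨i, hi⟩ := hπ.exists_moveSubgroup_le hL (standardLattice K d).2 j
    exact ⟨i, fun g hg => hj g (hi hg)⟩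
  have hav := fun (T N : Submodule 𝒪[K] (Fin (d + 1) → K))
      (h : π • L ≤ N ∧ N ≤ T ∧ T ≤ L) =>
    exists_averaging_filtrationSubgroup (m := m) hπ hp ρ hL hsmoothL h.1 h.2.1 h.2.2
  -- The operator is defined for all pairs of lattices, being zero outside the range in which it is
  -- used.
  have hav' : ∀ T N : Submodule 𝒪[K] (Fin (d + 1) → K), ∃ q : V →ₗ[R] V,
      (π • L ≤ N ∧ N ≤ T ∧ T ≤ L) → _ := fun T N => by
    by_cases h : π • L ≤ N ∧ N ≤ T ∧ T ≤ L
    · obtain ⟨q, hq⟩ := hav T N h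
      exact ⟨q, fun _ => hq⟩
    · exact ⟨0, fun h' => absurd h' h⟩
  choose q hq using hav'
  have hfixed : ∀ σ, ∀ v ∈ fixedValues ρ (m + 1) Y (insert x σ), ∀ s ∈ insert x σ,
      moveSubgroup (nrm s) (π ^ (m + 1) • nrm s) ≤ vectorStabilizer ρ v := by
    intro σ v hv s hs
    by_cases h0 : v = 0
    · intro g _
      change ρ g v = v
      rw [h0, map_zero]
    · have hτ := mem_faces_of_mem_fixedValues hv h0
      rw [mem_fixedValues_of_mem hτ, mem_fixedBy_congruenceSubgroup hπ] at hv
      exact hv s hs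
  -- The filtration subgroup preserves the lattice of s, so it normalizes the congruence subgroup of
  -- s, and its average preserves the vectors fixed by that subgroup.
  have hstable : ∀ T ∈ D, ∀ N ∈ D, nrm N ≤ nrm T → ∀ s, (s = x ∨ s ∈ D ∧ nrm s ≤ nrm T) →
      ∀ v, moveSubgroup (nrm s) (π ^ (m + 1) • nrm s) ≤ vectorStabilizer ρ v →
        moveSubgroup (nrm s) (π ^ (m + 1) • nrm s) ≤ vectorStabilizer ρ (q (nrm T) (nrm N) v) := by
    intro T hT N hN hNT s hs v hv
    rw [← mem_fixedBy_iff_le_vectorStabilizer] at hv ⊢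
    refine (hq _ _ ⟨hDM N hN, hNT, hDL T hT⟩).2.2.2.2 _ (fun h hh u hu => ?_) v hv
    refine apply_mem_vectorStabilizer_of_conj (fun g hg => ?_) hu
    have h1 := inv_mem hh
    have hs' : Preserves h⁻¹ (nrm s) := by
      rcases hs with rfl | ⟨hsD, hsT⟩
      · have := (preserves_left_of_mem_filtrationSubgroup h1).smul π
        rwa [hML] at this
      · exact preserves_of_mem_filtrationSubgroup hπ (hDM s hsD) hsT h1
    have h2 := conj_mem_moveSubgroup hs' (hs'.smul (π ^ (m + 1))) hg
    rwa [inv_inv] at h2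
  have hcD : IsChainOn (fun σ => fixedValues ρ (m + 1) Y (insert x σ)) D k c := by
    refine ⟨hc.mem, fun σ hσ => ⟨fun t ht => ?_, (hc.supp σ hσ).2⟩⟩
    have hτ := mem_faces_of_mem_fixedValues (hc.mem σ) hσ
    have hlt : M < nrm t := (hc.supp σ hσ).1 ht
    have ht' : t ∈ insert x σ := Finset.mem_insert_of_mem ht
    refine Finset.mem_filter.mpr ⟨hU x hx t hlt.le, Y.down_closed _ hτ _
      (Finset.singleton_subset_iff.mpr ht') (Finset.singleton_nonempty t), hlt, ?_⟩
    rcases (Y.isSimplex _ hτ).normalizedLattice_le_or_le hπ (Finset.mem_insert_self x σ) ht' with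
      h | h
    · exact h.2
    · exact absurd h.1 (not_le_of_gt hlt)
  suffices h : ∃ b, IsChainOn (fun σ => fixedValues ρ (m + 1) Y (insert x σ)) D (k + 1) b ∧
      boundary R U b = c by
    obtain ⟨b, hb, hbc⟩ := h
    exact ⟨b, hb.mono fun t ht => hDlt t ht, hbc⟩
  refine exists_boundary_eq_of_projections (normalizedLattice_injective hπ) hDU
    (F := fun σ => fixedValues ρ (m + 1) Y (insert x σ)) ?_ ?_ q ?_ ?_ ?_ ?_ hk hcD hcycle
  · intro s hs t ht
    obtain ⟨u, hu, hsup, huπ⟩ := hY.exists_sup_mem_faces hπ hϖ hM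
      (isNormalized_normalizedLattice hπ x) (hDY s hs) (hDY t ht) ⟨(hDlt s hs).le, hDπ s hs⟩
      ⟨(hDlt t ht).le, hDπ t ht⟩
    have hsu : nrm s ≤ nrm u := le_sup_left.trans hsup.ge
    exact ⟨u, Finset.mem_filter.mpr ⟨hU s (hDU hs) u hsu, hu, (hDlt s hs).trans_le hsu, huπ⟩,
      hsup⟩
  · exact fun σ τ _ h => fixedValues_anti Y _ _ (Finset.insert_nonempty x σ)
      (Finset.insert_subset_insert x h)
  · intro T hT N hN hNT σ _ hNσ v hv
    refine (hq _ _ ⟨hDM N hN, hNT, hDL T hT⟩).2.1 v ?_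
    change filtrationSubgroup π m L (nrm T) (nrm N) ≤ vectorStabilizer ρ v
    obtain ⟨f, hf⟩ := hπ.exists_adapted_chain hL {nrm N}
      (by simpa using ⟨hDM N hN, hDL N hN⟩) (by simp)
    refine (filtrationSubgroup_le_sup hπ (hf _ (Finset.mem_singleton_self _)) hNT).trans
      (sup_le ?_ ?_)
    · rw [← hΓx]
      exact hfixed σ v hv x (Finset.mem_insert_self x σ)
    · exact hfixed σ v hv N (Finset.mem_insert_of_mem hNσ)
  · intro T hT N hN N' hN' hNT hN'T σ _ _ v _
    have q1 := hq _ _ ⟨hDM N hN, hNT, hDL T hT⟩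
    have q2 := hq _ _ ⟨hDM N' hN', hN'T, hDL T hT⟩
    have q3 := hq _ (nrm N ⊔ nrm N')
      ⟨(hDM N hN).trans le_sup_left, sup_le hNT hN'T, hDL T hT⟩
    obtain ⟨f, hf⟩ := hπ.exists_adapted_chain hL {nrm T}
      (by simpa using ⟨hDM T hT, hDL T hT⟩) (by simp)
    have hle : ∀ {A B : Submodule 𝒪[K] (Fin (d + 1) → K)}, A ≤ B →
        filtrationSubgroup π m L (nrm T) A ≤ filtrationSubgroup π m L (nrm T) B := fun h =>
      inf_le_inf_right _ (moveSubgroup_mono (units_smul_mono _ h))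
    -- `w` is fixed by the groups of N and N', hence by that of N ⊔ N', so averaging over the latter
    -- fixes `w`. That average also absorbs the two inner ones, because their groups are contained
    -- in its group.
    set w := q (nrm T) (nrm N) (q (nrm T) (nrm N') v)
    have h1 : filtrationSubgroup π m L (nrm T) (nrm N') ≤ vectorStabilizer ρ w := by
      rw [← mem_fixedBy_iff_le_vectorStabilizer]
      refine q1.2.2.2.2 _ (fun h hh u hu => ?_) _ fun h => q2.1 h h.2 v
      exact apply_mem_vectorStabilizer_of_conj
        (fun g hg => conj_mem_filtrationSubgroup hπ (hDM N' hN') hN'T hh hg) hu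
    have h2 : filtrationSubgroup π m L (nrm T) (nrm N) ≤ vectorStabilizer ρ w :=
      fun h hh => q1.1 h hh _
    have h3 : q (nrm T) (nrm N ⊔ nrm N') w = w := q3.2.1 w fun h hh =>
      (filtrationSubgroup_sup_le hπ (hf _ (Finset.mem_singleton_self _)) (hDM N hN) hNT
        (hDM N' hN') hN'T).trans (sup_le h2 h1) hh
    rw [← h3]
    rw [q1.2.2.2.1 _ fun h hh u => q3.2.2.1 h (hle le_sup_left hh) u]
    exact q2.2.2.2.1 _ (fun h hh u => q3.2.2.1 h (hle le_sup_right hh) u) v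
  · intro T hT N hN hNT σ hσ _ hσT v hv
    by_cases h0 : v = 0
    · rw [h0, map_zero]; exact zero_mem _
    have hτ := mem_faces_of_mem_fixedValues hv h0
    rw [mem_fixedValues_of_mem hτ, mem_fixedBy_congruenceSubgroup hπ]
    exact fun s hs => hstable T hT N hN hNT s
      ((Finset.mem_insert.mp hs).imp id fun h => ⟨hσ h, hσT s h⟩) v (hfixed σ v hv s hs)
  · intro T hT σ hσ _ hσT v hv
    by_cases h0 : v = 0
    · rw [h0, map_zero]; exact zero_mem _
    have hτ := mem_faces_of_mem_fixedValues hv h0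
    have hτM : ∀ t ∈ insert x σ, M ≤ nrm t ∧ π • nrm t ≤ M := by
      intro t ht
      rcases Finset.mem_insert.mp ht with rfl | ht
      · exact ⟨le_rfl, hπ.smul_le _⟩
      · exact ⟨(hDlt t (hσ ht)).le, hDπ t (hσ ht)⟩
    have hτT : ∀ t ∈ insert x σ, nrm t ≤ nrm T := by
      intro t ht
      rcases Finset.mem_insert.mp ht with rfl | ht
      · exact (hDlt T hT).le
      · exact hσT t ht
    have hmem := hY.insert_mem_faces hπ hϖ hM hτ hτM (hDY T hT) ⟨(hDlt T hT).le, hDπ T hT⟩ hτT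
    rw [Finset.insert_comm, mem_fixedValues_of_mem hmem, mem_fixedBy_congruenceSubgroup hπ]
    intro s hs
    rcases Finset.mem_insert.mp hs with rfl | hs
    -- For the new vertex the congruence subgroup lies in the group averaged over; for the old
    -- vertices invariance is preserved.
    · exact (moveSubgroup_top_le_filtrationSubgroup hπ (hDM s hT) (hDL s hT)).trans
        fun h hh => (hq _ _ ⟨hDM s hT, le_rfl, hDL s hT⟩).1 h hh v
    · exact hstable T hT T hT le_rfl s
        ((Finset.mem_insert.mp hs).imp id fun h => ⟨hσ h, hσT s h⟩) v (hfixed σ v hv s hs)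

/-- Writing n = m + 1 provides the exponent `m` of the filtration subgroups. The two criteria then
apply on an upward closed finite set of vertices. -/
theorem fixedSystem_isAcyclicOn {n : ℕ} (hn : 1 ≤ n) : (fixedSystem ρ n).IsAcyclicOn Y := by
  obtain ⟨m, rfl⟩ := Nat.exists_eq_add_of_le' hn
  refine isAcyclicOn_of_exists_boundary_eq Y fun S => ?_
  obtain ⟨U, hSU, hU⟩ := exists_finset_upperClosed hπ S
  refine ⟨U, hSU, fun k hk c hc hcycle => ?_⟩
  refine exists_boundary_eq_of_links (normalizedLattice_injective hπ) hU
    (fixedValues_anti Y) ?_ ?_ hk hc hcycle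
  · intro σ hσ s hs t ht
    obtain ⟨v, hv, h0⟩ := Submodule.exists_mem_ne_zero_of_ne_bot hσ
    have h1 := Y.isSimplex σ (mem_faces_of_mem_fixedValues hv h0)
    exact (h1.normalizedLattice_le_or_le hπ hs ht).imp And.left And.left
  · exact fun x hx k hk c hc hcycle =>
      exists_boundary_eq_of_upperLink hπ hϖ hY hp hsmooth hU hx hk hc hcycle

end Acyclicity

end BruhatTits

end

/-! ### The three coefficient rings -/

theorem mainTheorem9
    (K : Type*) [Field K] [CharZero K] [ValuativeRel K] [TopologicalSpace K]
    [IsNonarchimedeanLocalField K]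
    (p : ℕ) [CharP 𝓀[K] p] (ϖ : 𝒪[K]) (hϖ : Irreducible ϖ) (d n : ℕ) (hn : 1 ≤ n)
    (A : Type*) [CommRing A] [IsDomain A] [IsPrincipalIdealRing A] (hp : IsUnit (p : A))
    (V : Type*) [AddCommGroup V] [Module A V]
    (ρ : Representation A (GL (Fin (d + 1)) K) V)
    (hsmooth : BruhatTits.IsSmooth ρ)
    (hgen : BruhatTits.IsGeneratedByFixed ρ (BruhatTits.standardCongruenceSubgroup K d n))
    (Y : BruhatTits.Subcomplex K d) (hY : BruhatTits.GeodesicallyConvex ϖ Y.realization)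
    [LinearOrder (BruhatTits.Vertex K d)] :
    (BruhatTits.fixedSystem (BruhatTits.baseChange A ρ) n).IsAcyclicOn Y ∧
    (BruhatTits.fixedSystem (BruhatTits.baseChange (FractionRing A) ρ) n).IsAcyclicOn Y ∧
    ∀ a : A, (BruhatTits.fixedSystem
      (BruhatTits.baseChange (A ⧸ Ideal.span {a}) ρ) n).IsAcyclicOn Y := by
  have h0 : (ϖ : K) ≠ 0 := fun h => hϖ.ne_zero (Subtype.ext h)
  have hπ : BruhatTits.IsUniformizer (Units.mk0 (ϖ : K) h0) := ⟨ϖ, hϖ, rfl⟩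
  -- Only the invertibility of `p` and smoothness have to pass to the base change, and both do for
  -- any `A`-algebra.
  have hunit : ∀ (Λ : Type _) [CommRing Λ] [Algebra A Λ], IsUnit (p : Λ) := fun Λ _ _ => by
    simpa using hp.map (algebraMap A Λ)
  exact ⟨BruhatTits.fixedSystem_isAcyclicOn hπ rfl hY (hunit A)
      (hsmooth.exists_moveSubgroup_fixed_baseChange hπ A) hn,
    BruhatTits.fixedSystem_isAcyclicOn hπ rfl hY (hunit (FractionRing A))
      (hsmooth.exists_moveSubgroup_fixed_baseChange hπ (FractionRing A)) hn,
    fun a => BruhatTits.fixedSystem_isAcyclicOn hπ rfl hY (hunit (A ⧸ Ideal.span {a}))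
      (hsmooth.exists_moveSubgroup_fixed_baseChange hπ (A ⧸ Ideal.span {a})) hn⟩
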